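/- Notation. Let $d\ge 1$, $s\ge 0$, $v_s(z)=(1+|z|^2)^{s/2}$ for $z\in\mathbb R^{2d}$, and let $\langle\cdot,\cdot\rangle$ be the pairing of $\mathcal S'$ and $\mathcal S$, conjugate-linear in the second argument. Fix any window $g\in\mathcal S(\mathbb R^{2d})\setminus\{0\}$, and for $\sigma\in\mathcal S'(\mathbb R^{2d})$ put $V_g\sigma(z,\zeta)=\langle\sigma, e^{2\pi i\zeta\cdot(\,\cdot\,)}g(\,\cdot\,-z)\rangle$, $z,\zeta\in\mathbb R^{2d}$. Let $$M^{\infty,1}_{1\otimes v_s}=\Big\{\sigma\in\mathcal S'(\mathbb R^{2d}):\int_{\mathbb R^{2d}}\sup_{z}|V_g\sigma(z,\zeta)|\,v_s(\zeta)\,d\zeta<\infty\Big\},$$ $$W(\mathcal FL^\infty,L^1_{v_s})=\Big\{\sigma\in\mathcal S'(\mathbb R^{2d}):\int_{\mathbb R^{2d}}\sup_{\zeta}|V_g\sigma(z,\zeta)|\,v_s(z)\,dz<\infty\Big\}.$$ For $\tau\in[0,1]$ and $f,h\in\mathcal S(\mathbb R^d)$ let $$W_\tau(f,h)(x,\omega)=\int_{\mathbb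 R^d}e^{-2\pi iy\cdot\omega}f(x+\tau y)\overline{h(x-(1-\tau)y)}\,dy,$$ and for $\sigma\in\mathcal S'(\mathbb R^{2d})$ let $\mathrm{Op}_\tau(\sigma)$ be defined by $\langle\mathrm{Op}_\tau(\sigma)f,h\rangle=\langle\sigma,W_\tau(h,f)\rangle$. An identity $\mathrm{Op}_{\tau_1}(a)\mathrm{Op}_{\tau_2}(b)=\mathrm{Op}_\tau(c)$ means that $\mathrm{Op}_{\tau_1}(a)$ and $\mathrm{Op}_{\tau_2}(b)$ extend to bounded operators on $L^2(\mathbb R^d)$, and that the composition of these extensions is the bounded extension of $\mathrm{Op}_\tau(c)$ to $L^2(\mathbb R^d)$. **Theorem.** 1. For any $a,b\in W(\mathcal FL^\infty,L^1_{v_s})$ and $\tau\in(0,1)$ there exists a symbol $c\in M^{\infty,1}_{1\otimes v_s}$ such that $\mathrm{Op}_\tau(a)\,\mathrm{Op}_{1-\tau}(b)=\mathrm{Op}_{1/2}(c)$. 2. $M^{\infty,1}_{1\otimes v_s}$ and $W(\mathcal FL^\infty,L^1_{v_s})$ are linear subspaces of $\mathcal S'(\mathbb R^{2d})$. For all fixed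 $\tau,\tau_0\in(0,1)$, $M^{\infty,1}_{1\otimes v_s}$ is an associative unital complex algebra under a product $(b_1,b_2)\mapsto b_1\sharp b_2$ with $\mathrm{Op}_{\tau_0}(b_1)\mathrm{Op}_{\tau_0}(b_2)=\mathrm{Op}_{\tau_0}(b_1\sharp b_2)$, whose unit has the identity of $L^2(\mathbb R^d)$ as its $\mathrm{Op}_{\tau_0}$; and $W(\mathcal FL^\infty,L^1_{v_s})$ is a (unital) bimodule over this algebra under bilinear laws $(b,a)\mapsto c_1$ and $(a,b)\mapsto c_2$, for $b\in M^{\infty,1}_{1\otimes v_s}$ and $a\in W(\mathcal FL^\infty,L^1_{v_s})$, such that $$\mathrm{Op}_{\tau_0}(b)\mathrm{Op}_\tau(a)=\mathrm{Op}_\tau(c_1),\qquad \mathrm{Op}_\tau(a)\mathrm{Op}_{\tau_0}(b)=\mathrm{Op}_\tau(c_2).$$ 3. No $\tau$-quantization rule makes the amalgam space an algebra: for all $\tau_1,\tau_2\in(0,1)$ and $\tau\in[0,1]$ (in particular for $\tau_1=\tau_2=\tau\in(0,1)$) there exist $a,b\in W(\mathcal FL^\infty,L^1_{v_s})$ such that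 $\mathrm{Op}_{\tau_1}(a)$ and $\mathrm{Op}_{\tau_2}(b)$ extend to bounded operators on $L^2(\mathbb R^d)$ and the composition of these extensions is not the extension of $\mathrm{Op}_\tau(c)$ for any $c\in W(\mathcal FL^\infty,L^1_{v_s})$. -/

import Mathlib

open MeasureTheory SchwartzMap
open scoped ENNReal FourierTransform ContDiff InnerProductSpace ComplexConjugate

noncomputable section

namespace TauPseudo

/-- The configuration space `ℝᵈ` with its Euclidean structure. -/
abbrev Conf (d : ℕ) : Type := EuclideanSpace ℝ (Fin d)

/-- The phase space `ℝ²ᵈ = ℝᵈ × ℝᵈ`, with points `z = (x, ω)`. -/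
abbrev Phase (d : ℕ) : Type := Conf d × Conf d

section PartialFourier

variable {d : ℕ} {V : Type} [NormedAddCommGroup V] [NormedSpace ℂ V]

/-- Partial Fourier transform with respect to the second `d`-dimensional variable. -/
def partialFourier (F : 𝓢(Phase d, V)) (z : Phase d) : V :=
  𝓕 (fun y : Conf d ↦ F (z.1, y)) z.2

/-- The bilinear form `((x, y), (a, b)) ↦ y ⬝ b` on phase space. -/
def sndForm (d : ℕ) : Phase d →L[ℝ] Phase d →L[ℝ] ℝ :=
  (innerSL ℝ).bilinearComp (ContinuousLinearMap.snd ℝ (Conf d) (Conf d))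
    (ContinuousLinearMap.snd ℝ (Conf d) (Conf d))

/-- The function whose partial Fourier transform is the derivative of the one of `F`. -/
def partialFourierDeriv (F : 𝓢(Phase d, V)) : 𝓢(Phase d, Phase d →L[ℝ] V) :=
  SchwartzMap.postcompCLM
      (((ContinuousLinearMap.compL ℝ (Phase d) (Phase d) V).flip
        ((ContinuousLinearMap.inl ℝ (Conf d) (Conf d)).comp
          (ContinuousLinearMap.fst ℝ (Conf d) (Conf d)))))
      (SchwartzMap.fderivCLM ℝ (Phase d) V F) +
    (-(2 * Real.pi * Complex.I)) • SchwartzMap.smulRightCLM ℂ V (sndForm d) F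

theorem exists_slice_bound {W : Type} [NormedAddCommGroup W] [NormedSpace ℂ W]
    (F : 𝓢(Phase d, W)) (k n m : ℕ) :
    ∃ C : ℝ, ∀ x y : Conf d,
      (1 + ‖x‖) ^ k * (1 + ‖y‖) ^ m * ‖iteratedFDeriv ℝ n F (x, y)‖ ≤ C := by
  refine ⟨_, fun x y ↦ le_trans ?_ (SchwartzMap.one_add_le_sup_seminorm_apply (𝕜 := ℝ)
    (m := (k + m, n)) (k := k + m) le_rfl le_rfl F (x, y))⟩
  have h1 : ‖x‖ ≤ ‖(x, y)‖ := norm_fst_le (x, y)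
  have h2 : ‖y‖ ≤ ‖(x, y)‖ := norm_snd_le (x, y)
  rw [pow_add]
  gcongr

theorem exists_slice_dominated {W : Type} [NormedAddCommGroup W] [NormedSpace ℂ W]
    (F : 𝓢(Phase d, W)) (k n p : ℕ) :
    ∃ b : Conf d → ℝ, Integrable b ∧ ∀ x y : Conf d,
      (1 + ‖x‖) ^ k * (‖y‖ ^ p * ‖iteratedFDeriv ℝ n F (x, y)‖) ≤ b y := by
  set N := (volume : Measure (Conf d)).integrablePower
  obtain ⟨C, hC⟩ := exists_slice_bound F k n (p + N)
  refine ⟨fun y ↦ C * (1 + ‖y‖) ^ (-(N : ℝ)),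
    (Measure.integrable_pow_neg_integrablePower (volume : Measure (Conf d))).const_mul C, fun x y ↦ ?_⟩
  have hy : (0 : ℝ) < 1 + ‖y‖ := by positivity
  beta_reduce
  rw [Real.rpow_neg hy.le, Real.rpow_natCast, ← div_eq_mul_inv, le_div_iff₀ (by positivity)]
  refine le_trans ?_ (hC x y)
  have h : ‖y‖ ^ p ≤ (1 + ‖y‖) ^ p := by gcongr; linarith
  calc (1 + ‖x‖) ^ k * (‖y‖ ^ p * ‖iteratedFDeriv ℝ n F (x, y)‖) * (1 + ‖y‖) ^ N
      = (1 + ‖x‖) ^ k * (‖y‖ ^ p * (1 + ‖y‖) ^ N) * ‖iteratedFDeriv ℝ n F (x, y)‖ := by ring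
    _ ≤ (1 + ‖x‖) ^ k * ((1 + ‖y‖) ^ p * (1 + ‖y‖) ^ N) * ‖iteratedFDeriv ℝ n F (x, y)‖ := by
        gcongr
    _ = _ := by rw [pow_add]

theorem slice_integrable {W : Type} [NormedAddCommGroup W] [NormedSpace ℂ W]
    (F : 𝓢(Phase d, W)) (x : Conf d) : Integrable (fun y ↦ F (x, y)) := by
  obtain ⟨b, hb, h⟩ := exists_slice_dominated F 0 0 0
  refine hb.mono' (by
    have : Continuous fun y ↦ F (x, y) := F.continuous.comp (by fun_prop)
    exact this.aestronglyMeasurable) (Filter.Eventually.of_forall fun y ↦ ?_)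
  simpa using h x y

theorem hasFDerivAt_partialFourier (F : 𝓢(Phase d, V)) (z : Phase d) :
    HasFDerivAt (partialFourier F) (partialFourier (partialFourierDeriv F) z) z := by
  obtain ⟨b, hb, h⟩ := exists_slice_dominated (partialFourierDeriv F) 0 0 0
  have hc (W : Type) [NormedAddCommGroup W] [NormedSpace ℂ W] (G : 𝓢(Phase d, W)) (z : Phase d) :
      AEStronglyMeasurable (fun y : Conf d ↦ 𝐞 (-⟪y, z.2⟫_ℝ) • G (z.1, y)) := by
    apply Continuous.aestronglyMeasurable
    exact (Real.continuous_fourierChar.comp (by fun_prop)).smul (G.continuous.comp (by fun_prop))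
  refine hasFDerivAt_integral_of_dominated_of_fderiv_le (𝕜 := ℝ)
    (F := fun (z : Phase d) (y : Conf d) ↦ 𝐞 (-⟪y, z.2⟫_ℝ) • F (z.1, y))
    (F' := fun (z : Phase d) (y : Conf d) ↦ 𝐞 (-⟪y, z.2⟫_ℝ) • partialFourierDeriv F (z.1, y))
    (bound := b) Filter.univ_mem
    (Filter.Eventually.of_forall fun w ↦ hc V F w) ?_ (hc _ _ z)
    (Filter.Eventually.of_forall fun y w _ ↦ by
      rw [Circle.smul_def, norm_smul, Circle.norm_coe, one_mul]; simpa using h w.1 y) hb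
    (Filter.Eventually.of_forall fun y w _ ↦ ?_)
  · exact (slice_integrable F z.1).mono (hc V F z) (Filter.Eventually.of_forall fun y ↦ by simp)
  · have h1 : HasFDerivAt (fun w : Phase d ↦ F (w.1, y))
        ((fderiv ℝ F (w.1, y)).comp ((ContinuousLinearMap.inl ℝ (Conf d) (Conf d)).comp
          (ContinuousLinearMap.fst ℝ (Conf d) (Conf d)))) w := by
      have e : HasFDerivAt (fun w : Phase d ↦ (w.1, y))
          ((ContinuousLinearMap.inl ℝ (Conf d) (Conf d)).comp
          (ContinuousLinearMap.fst ℝ (Conf d) (Conf d))) w := by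
        have := (hasFDerivAt_fst (𝕜 := ℝ) (p := w)).prodMk (hasFDerivAt_const y w)
        convert! this using 1
      exact HasFDerivAt.comp w ((F.smooth 1).differentiable (by simp) (w.1, y)).hasFDerivAt e
    have h2 : HasFDerivAt (fun w : Phase d ↦ (𝐞 (-⟪y, w.2⟫_ℝ) : ℂ))
        ((-(2 * Real.pi * Complex.I) * 𝐞 (-⟪y, w.2⟫_ℝ) : ℂ) •
          (Complex.ofRealCLM.comp (sndForm d (w.1, y)))) w := by
      have e : HasFDerivAt (fun w : Phase d ↦ -⟪y, w.2⟫_ℝ) (-(sndForm d (w.1, y))) w :=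
        (sndForm d (w.1, y)).hasFDerivAt.neg
      have := (Real.hasDerivAt_fourierChar (-⟪y, w.2⟫_ℝ)).hasFDerivAt.restrictScalars ℝ |>.comp w e
      convert! this using 1
      ext v
      · simp; ring
      · simp; ring
    have := h2.smul h1
    convert! this using 1
    ext v
    · simp [partialFourierDeriv, Circle.smul_def, mul_smul, smul_add]
      exact (smul_comm _ _ _).trans (congrArg _ ((smul_comm _ _ _).trans (congrArg _ (smul_comm _ _ _))))
    · simp [partialFourierDeriv, Circle.smul_def, mul_smul, smul_add]
      exact (smul_comm _ _ _).trans (congrArg _ ((smul_comm _ _ _).trans (congrArg _ (smul_comm _ _ _))))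

theorem exists_partialFourier_bound (F : 𝓢(Phase d, V)) (k : ℕ) :
    ∃ C : ℝ, ∀ z : Phase d, ‖z‖ ^ k * ‖partialFourier F z‖ ≤ C := by
  obtain ⟨b, hb, h⟩ := exists_slice_dominated F k 0 0
  choose c hc hc' using fun n : ℕ ↦ exists_slice_dominated F 0 n 0
  have hsm (x : Conf d) : ContDiff ℝ ∞ (fun y ↦ F (x, y)) :=
    (F.smooth ⊤).comp (by fun_prop)
  have hit (x y : Conf d) (n : ℕ) : ‖iteratedFDeriv ℝ n (fun y ↦ F (x, y)) y‖ ≤ c n y := by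
    have e : (fun y ↦ F (x, y)) = (fun w ↦ F ((x, 0) + w)) ∘
        (ContinuousLinearMap.inr ℝ (Conf d) (Conf d)) := by ext y; simp
    have hs : ContDiff ℝ n (fun w ↦ F ((x, 0) + w)) := (F.smooth n).comp (by fun_prop)
    rw [e, ContinuousLinearMap.iteratedFDeriv_comp_right _ hs _ le_rfl,
      iteratedFDeriv_comp_add_left]
    refine (ContinuousMultilinearMap.norm_compContinuousLinearMap_le _ _).trans ?_
    have := hc' n x y
    simp only [pow_zero, one_mul] at this
    refine le_trans ?_ this
    simp only [ContinuousLinearMap.inr_apply, Prod.mk_add_mk, add_zero, zero_add]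
    refine mul_le_of_le_one_right (norm_nonneg _) ?_
    refine Finset.prod_le_one (fun _ _ ↦ norm_nonneg _) fun _ _ ↦ ?_
    exact ContinuousLinearMap.norm_inr_le_one ℝ (Conf d) (Conf d)
  have hint (x : Conf d) (n : ℕ) :
      Integrable (fun y ↦ ‖iteratedFDeriv ℝ n (fun y ↦ F (x, y)) y‖) :=
    (hc n).mono' ((hsm x).continuous_iteratedFDeriv (by exact_mod_cast le_top)).norm.aestronglyMeasurable
      (Filter.Eventually.of_forall fun y ↦ by simpa using hit x y n)
  refine ⟨(∫ y, b y) + (2 * Real.pi) ^ 0 * (2 * (0 : ℕ) + 2) ^ k *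
    ∑ p ∈ Finset.range (0 + 1) ×ˢ Finset.range (k + 1), ∫ y, c p.2 y, fun z ↦ ?_⟩
  have hz : ‖z‖ ^ k ≤ ‖z.1‖ ^ k + ‖z.2‖ ^ k := by
    rcases max_choice ‖z.1‖ ‖z.2‖ with h | h <;> rw [Prod.norm_def, h] <;> simp
  have h1 : ‖z.1‖ ^ k * ‖partialFourier F z‖ ≤ ∫ y, b y := by
    have : ‖partialFourier F z‖ ≤ ∫ y, ‖F (z.1, y)‖ :=
      VectorFourier.norm_fourierIntegral_le_integral_norm _ _ _ _ _
    calc ‖z.1‖ ^ k * ‖partialFourier F z‖ ≤ ‖z.1‖ ^ k * ∫ y, ‖F (z.1, y)‖ := by gcongr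
      _ = ∫ y, ‖z.1‖ ^ k * ‖F (z.1, y)‖ := (integral_const_mul _ _).symm
      _ ≤ ∫ y, b y := by
        refine integral_mono ((slice_integrable F z.1).norm.const_mul _) hb fun y ↦ ?_
        refine le_trans ?_ (h z.1 y)
        simp only [pow_zero, one_mul, norm_iteratedFDeriv_zero]
        gcongr
        linarith
  have h2 := Real.pow_mul_norm_iteratedFDeriv_fourier_le (K := 0) (N := ⊤) (hsm z.1)
    (fun i n hi _ ↦ by
      obtain rfl : i = 0 := by simpa using hi
      simpa using hint z.1 n) (k := 0) (n := k) le_rfl le_top z.2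
  rw [norm_iteratedFDeriv_zero] at h2
  calc ‖z‖ ^ k * ‖partialFourier F z‖
      ≤ ‖z.1‖ ^ k * ‖partialFourier F z‖ + ‖z.2‖ ^ k * ‖partialFourier F z‖ := by
        rw [← add_mul]; gcongr
    _ ≤ _ := by
        refine add_le_add h1 (h2.trans (mul_le_mul_of_nonneg_left ?_ (by positivity)))
        refine Finset.sum_le_sum fun p hp ↦ ?_
        have hp0 : p.1 = 0 := by
          simpa using (Finset.mem_product.1 hp).1
        have := integral_mono (hint z.1 p.2) (hc p.2) fun y ↦ hit z.1 y p.2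
        simpa only [hp0, pow_zero, one_mul] using this

theorem contDiff_partialFourier (n : ℕ) : ∀ {W : Type} [NormedAddCommGroup W] [NormedSpace ℂ W]
    (F : 𝓢(Phase d, W)), ContDiff ℝ n (partialFourier F) := by
  induction n with
  | zero =>
    intro W _ _ F
    exact contDiff_zero.2 (continuous_iff_continuousAt.2
      fun z ↦ (hasFDerivAt_partialFourier F z).continuousAt)
  | succ n ih =>
    intro W _ _ F
    exact_mod_cast contDiff_succ_iff_hasFDerivAt.2
      ⟨_, ih (partialFourierDeriv F), hasFDerivAt_partialFourier F⟩

theorem decay_partialFourier (k n : ℕ) : ∀ {W : Type} [NormedAddCommGroup W] [NormedSpace ℂ W]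
    (F : 𝓢(Phase d, W)),
    ∃ C : ℝ, ∀ z, ‖z‖ ^ k * ‖iteratedFDeriv ℝ n (partialFourier F) z‖ ≤ C := by
  induction n with
  | zero =>
    intro W _ _ F
    simpa using exists_partialFourier_bound F k
  | succ n ih =>
    intro W _ _ F
    obtain ⟨C, hC⟩ := ih (partialFourierDeriv F)
    refine ⟨C, fun z ↦ ?_⟩
    have : fderiv ℝ (partialFourier F) = partialFourier (partialFourierDeriv F) :=
      funext fun z ↦ (hasFDerivAt_partialFourier F z).fderiv
    rw [← norm_iteratedFDeriv_fderiv, this]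
    exact hC z

end PartialFourier

section Wigner

variable {d : ℕ}

theorem decay_tensor (f g : 𝓢(Conf d, ℂ)) (k n : ℕ) :
    ∃ C : ℝ, ∀ z : Phase d,
      ‖z‖ ^ k * ‖iteratedFDeriv ℝ n (fun w : Phase d ↦ f w.1 * g w.2) z‖ ≤ C := by
  have hf : ContDiff ℝ ∞ (fun w : Phase d ↦ f w.1) := (f.smooth ⊤).comp contDiff_fst
  have hg : ContDiff ℝ ∞ (fun w : Phase d ↦ g w.2) := (g.smooth ⊤).comp contDiff_snd
  have bf (i : ℕ) (z : Phase d) :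
      ‖iteratedFDeriv ℝ i (fun w : Phase d ↦ f w.1) z‖ ≤ ‖iteratedFDeriv ℝ i f z.1‖ := by
    have := (ContinuousLinearMap.fst ℝ (Conf d) (Conf d)).iteratedFDeriv_comp_right
      (f.smooth i) z (i := i) le_rfl
    refine (congrArg norm this).le.trans <|
      (ContinuousMultilinearMap.norm_compContinuousLinearMap_le _ _).trans ?_
    exact mul_le_of_le_one_right (norm_nonneg _) (Finset.prod_le_one (fun _ _ ↦ norm_nonneg _)
      fun _ _ ↦ ContinuousLinearMap.norm_fst_le ℝ (Conf d) (Conf d))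
  have bg (i : ℕ) (z : Phase d) :
      ‖iteratedFDeriv ℝ i (fun w : Phase d ↦ g w.2) z‖ ≤ ‖iteratedFDeriv ℝ i g z.2‖ := by
    have := (ContinuousLinearMap.snd ℝ (Conf d) (Conf d)).iteratedFDeriv_comp_right
      (g.smooth i) z (i := i) le_rfl
    refine (congrArg norm this).le.trans <|
      (ContinuousMultilinearMap.norm_compContinuousLinearMap_le _ _).trans ?_
    exact mul_le_of_le_one_right (norm_nonneg _) (Finset.prod_le_one (fun _ _ ↦ norm_nonneg _)
      fun _ _ ↦ ContinuousLinearMap.norm_snd_le ℝ (Conf d) (Conf d))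
  let S (h : 𝓢(Conf d, ℂ)) (j i : ℕ) : ℝ := SchwartzMap.seminorm ℝ j i h
  refine ⟨∑ i ∈ Finset.range (n + 1), (n.choose i : ℝ) *
    (S f k i * S g 0 (n - i) + S f 0 i * S g k (n - i)), fun z ↦ ?_⟩
  have hz : ‖z‖ ^ k ≤ ‖z.1‖ ^ k + ‖z.2‖ ^ k := by
    rcases max_choice ‖z.1‖ ‖z.2‖ with h | h <;> rw [Prod.norm_def, h] <;> simp
  have hm := norm_iteratedFDeriv_mul_le hf hg z (n := n) (by exact_mod_cast le_top)
  calc _ ≤ ‖z‖ ^ k * ∑ i ∈ Finset.range (n + 1), (n.choose i : ℝ) *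
        ‖iteratedFDeriv ℝ i (fun w : Phase d ↦ f w.1) z‖ *
        ‖iteratedFDeriv ℝ (n - i) (fun w : Phase d ↦ g w.2) z‖ := by gcongr
    _ ≤ (‖z.1‖ ^ k + ‖z.2‖ ^ k) * ∑ i ∈ Finset.range (n + 1), (n.choose i : ℝ) *
        ‖iteratedFDeriv ℝ i f z.1‖ * ‖iteratedFDeriv ℝ (n - i) g z.2‖ := by
        gcongr with i hi i hi
        · exact bf i z
        · exact bg (n - i) z
    _ = ∑ i ∈ Finset.range (n + 1), (n.choose i : ℝ) *
        ((‖z.1‖ ^ k * ‖iteratedFDeriv ℝ i f z.1‖) * (‖z.2‖ ^ 0 * ‖iteratedFDeriv ℝ (n - i) g z.2‖) +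
        (‖z.1‖ ^ 0 * ‖iteratedFDeriv ℝ i f z.1‖) *
          (‖z.2‖ ^ k * ‖iteratedFDeriv ℝ (n - i) g z.2‖)) := by
        rw [Finset.mul_sum]; refine Finset.sum_congr rfl fun i _ ↦ ?_; ring
    _ ≤ _ := by
        gcongr with i hi <;> exact SchwartzMap.le_seminorm ℝ _ _ _ _

/-- The tensor product `(f ⊗ g)(u, w) = f(u) g(w)`. -/
def tensor (f g : 𝓢(Conf d, ℂ)) : 𝓢(Phase d, ℂ) where
  toFun z := f z.1 * g z.2
  smooth' := ((f.smooth ⊤).comp contDiff_fst).mul ((g.smooth ⊤).comp contDiff_snd)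
  decay' := decay_tensor f g

/-- Complex conjugation of Schwartz functions. -/
def conjS {E : Type} [NormedAddCommGroup E] [NormedSpace ℝ E] (f : 𝓢(E, ℂ)) : 𝓢(E, ℂ) :=
  SchwartzMap.postcompCLM (𝕜 := ℝ) (Complex.conjCLE : ℂ →L[ℝ] ℂ) f

@[simp]
theorem conjS_apply {E : Type} [NormedAddCommGroup E] [NormedSpace ℝ E] (f : 𝓢(E, ℂ)) (x : E) :
    conjS f x = conj (f x) := rfl

/-- The change of variables `(x, y) ↦ (x + τ y, x - (1 - τ) y)`. -/
def tauShear (d : ℕ) (τ : ℝ) : Phase d ≃L[ℝ] Phase d :=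
  LinearEquiv.toContinuousLinearEquiv
    { toFun := fun z ↦ (z.1 + τ • z.2, z.1 - (1 - τ) • z.2)
      invFun := fun z ↦ ((1 - τ) • z.1 + τ • z.2, z.1 - z.2)
      map_add' := fun z w ↦ by ext i <;> simp <;> ring
      map_smul' := fun c z ↦ by ext i <;> simp <;> ring
      left_inv := fun z ↦ by ext i <;> simp <;> ring
      right_inv := fun z ↦ by ext i <;> simp <;> ring }

/-- `(x, y) ↦ f(x + τ y) * conj (g(x - (1 - τ) y))` as a Schwartz function on phase space. -/
def tauKernel (τ : ℝ) (f g : 𝓢(Conf d, ℂ)) : 𝓢(Phase d, ℂ) :=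
  SchwartzMap.compCLMOfContinuousLinearEquiv ℂ (tauShear d τ) (tensor f (conjS g))

theorem tauWigner_eq (τ : ℝ) (f g : 𝓢(Conf d, ℂ)) :
    (fun z : Phase d ↦ ∫ y : Conf d, Complex.exp (-2 * Real.pi * Complex.I * ⟪y, z.2⟫_ℝ) *
      (f (z.1 + τ • y) * conj (g (z.1 - (1 - τ) • y)))) = partialFourier (tauKernel τ f g) := by
  ext z
  rw [partialFourier, Real.fourier_eq']
  refine integral_congr_ae (Filter.Eventually.of_forall fun y ↦ ?_)
  have : tauKernel τ f g (z.1, y) = f (z.1 + τ • y) * conj (g (z.1 - (1 - τ) • y)) := rfl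
  simp only [this, smul_eq_mul]
  congr 2
  push_cast
  ring

/-- The cross-`τ`-Wigner distribution
`W_τ(f, g)(x, ω) = ∫ exp(-2πi y⬝ω) f(x + τ y) conj(g(x - (1 - τ) y)) dy`. -/
def tauWigner (τ : ℝ) (f g : 𝓢(Conf d, ℂ)) : 𝓢(Phase d, ℂ) where
  toFun z := ∫ y : Conf d, Complex.exp (-2 * Real.pi * Complex.I * ⟪y, z.2⟫_ℝ) *
    (f (z.1 + τ • y) * conj (g (z.1 - (1 - τ) • y)))
  smooth' := by
    rw [tauWigner_eq]
    exact contDiff_infty.2 fun n ↦ contDiff_partialFourier n _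
  decay' := fun k n ↦ by
    rw [tauWigner_eq]
    exact decay_partialFourier k n _

end Wigner

section TimeFrequency

variable {d : ℕ}

theorem hasTemperateGrowth_char (ζ : Phase d) : Function.HasTemperateGrowth fun t : Phase d ↦
    Complex.exp (2 * Real.pi * Complex.I * ((⟪ζ.1, t.1⟫_ℝ + ⟪ζ.2, t.2⟫_ℝ : ℝ) : ℂ)) := by
  have hlin : Function.HasTemperateGrowth
      (fun t : Phase d ↦ ⟪ζ.1, t.1⟫_ℝ + ⟪ζ.2, t.2⟫_ℝ) :=
    (((innerSL ℝ ζ.1).comp (ContinuousLinearMap.fst ℝ (Conf d) (Conf d))) +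
      ((innerSL ℝ ζ.2).comp
        (ContinuousLinearMap.snd ℝ (Conf d) (Conf d)))).hasTemperateGrowth
  have hexp : Function.HasTemperateGrowth
      (fun r : ℝ ↦ Complex.exp (2 * Real.pi * Complex.I * (r : ℂ))) := by
    refine ⟨(contDiff_const.mul Complex.ofRealCLM.contDiff).cexp, fun n ↦ ⟨0, ‖(2 * Real.pi * Complex.I : ℂ)‖ ^ n, fun r ↦ ?_⟩⟩
    have h (n : ℕ) : iteratedDeriv n
        (fun r : ℝ ↦ Complex.exp (2 * Real.pi * Complex.I * (r : ℂ))) = fun r : ℝ ↦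
        (2 * Real.pi * Complex.I) ^ n * Complex.exp (2 * Real.pi * Complex.I * (r : ℂ)) := by
      induction n with
      | zero => simp
      | succ n ih =>
        rw [iteratedDeriv_succ, ih]
        ext r
        have h1 : HasDerivAt (fun r : ℝ ↦ 2 * Real.pi * Complex.I * (r : ℂ))
            (2 * Real.pi * Complex.I) r := by
          simpa using (Complex.ofRealCLM.hasDerivAt (x := r)).const_mul (2 * Real.pi * Complex.I)
        rw [(h1.cexp.const_mul _).deriv]
        ring
    rw [norm_iteratedFDeriv_eq_norm_iteratedDeriv, h, norm_mul]
    have : ‖Complex.exp (2 * Real.pi * Complex.I * (r : ℂ))‖ = 1 := by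
      rw [Complex.norm_exp]; simp
    simp [this]
  exact hexp.comp hlin

/-- The time-frequency shift `π(z, ζ) g (t) = exp(2πi ζ⬝t) g(t - z)` on `ℝ²ᵈ`. -/
def tfShift (z ζ : Phase d) (g : 𝓢(Phase d, ℂ)) : 𝓢(Phase d, ℂ) :=
  SchwartzMap.smulLeftCLM ℂ
    (fun t : Phase d ↦
      Complex.exp (2 * Real.pi * Complex.I * ((⟪ζ.1, t.1⟫_ℝ + ⟪ζ.2, t.2⟫_ℝ : ℝ) : ℂ)))
    (SchwartzMap.compSubConstCLM ℂ z g)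

theorem tfShift_apply (z ζ : Phase d) (g : 𝓢(Phase d, ℂ)) (t : Phase d) :
    tfShift z ζ g t =
      Complex.exp (2 * Real.pi * Complex.I * ((⟪ζ.1, t.1⟫_ℝ + ⟪ζ.2, t.2⟫_ℝ : ℝ) : ℂ)) *
        g (t - z) := by
  rw [tfShift, SchwartzMap.smulLeftCLM_apply_apply (hasTemperateGrowth_char ζ),
    SchwartzMap.compSubConstCLM_apply, smul_eq_mul]

/-- The pairing `⟨σ, φ⟩` of a tempered distribution with a Schwartz function, conjugate-linear in
the second argument. -/
def pair (σ : 𝓢'(Phase d, ℂ)) (φ : 𝓢(Phase d, ℂ)) : ℂ := σ (conjS φ)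

/-- The short-time Fourier transform `V_g σ (z, ζ) = ⟨σ, π(z, ζ) g⟩`. -/
def stft (g : 𝓢(Phase d, ℂ)) (σ : 𝓢'(Phase d, ℂ)) (z ζ : Phase d) : ℂ :=
  pair σ (tfShift z ζ g)

/-- The weight `v_s(z) = (1 + |z|²)^(s/2)` on `ℝ²ᵈ`, with `|z|` the Euclidean norm. -/
def polyWeight (s : ℝ) (z : Phase d) : ℝ := (1 + (‖z.1‖ ^ 2 + ‖z.2‖ ^ 2)) ^ (s / 2)

/-- Membership in the weighted Sjöstrand class `M^{∞,1}_{1 ⊗ v_s}(ℝ²ᵈ)`, measured with the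
window `g`. -/
def MemSjostrand (g : 𝓢(Phase d, ℂ)) (s : ℝ) (σ : 𝓢'(Phase d, ℂ)) : Prop :=
  ∫⁻ ζ : Phase d, (⨆ z : Phase d, ‖stft g σ z ζ‖ₑ) * ENNReal.ofReal (polyWeight s ζ) < ⊤

/-- Membership in the Wiener amalgam space `W(𝓕L^∞, L^1_{v_s})(ℝ²ᵈ)`, measured with the
window `g`. -/
def MemAmalgam (g : 𝓢(Phase d, ℂ)) (s : ℝ) (σ : 𝓢'(Phase d, ℂ)) : Prop :=
  ∫⁻ z : Phase d, (⨆ ζ : Phase d, ‖stft g σ z ζ‖ₑ) * ENNReal.ofReal (polyWeight s z) < ⊤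

end TimeFrequency

section Operators

variable {d : ℕ}

/-- The Hilbert space `L²(ℝᵈ)`. -/
abbrev L2 (d : ℕ) : Type := Lp ℂ 2 (volume : Measure (Conf d))

/-- The bounded operator `A` on `L²(ℝᵈ)` is (the continuous extension to `L²(ℝᵈ)` of) the
`τ`-pseudodifferential operator `Op_τ(σ)`, which is defined weakly by
`⟨Op_τ(σ) f, h⟩ = ⟨σ, W_τ(h, f)⟩` for Schwartz functions `f, h`. The inner product of Mathlib is
linear in its second argument, so `⟨A f, h⟩` reads `inner ℂ h (A f)`. -/
def IsOp (τ : ℝ) (σ : 𝓢'(Phase d, ℂ)) (A : L2 d →L[ℂ] L2 d) : Prop :=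
  ∀ f h : 𝓢(Conf d, ℂ), inner ℂ (h.toLp 2) (A (f.toLp 2)) = pair σ (tauWigner τ h f)

/-- `Op_{τ₁}(a) Op_{τ₂}(b) = Op_τ(c)`: both factors are bounded on `L²(ℝᵈ)` and their composition
is `Op_τ(c)`. -/
def IsOpComp (τ₁ : ℝ) (a : 𝓢'(Phase d, ℂ)) (τ₂ : ℝ) (b : 𝓢'(Phase d, ℂ))
    (τ : ℝ) (c : 𝓢'(Phase d, ℂ)) : Prop :=
  ∃ A B : L2 d →L[ℂ] L2 d, IsOp τ₁ a A ∧ IsOp τ₂ b B ∧ IsOp τ c (A ∘L B)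

end Operators

/-- `mul` and `one` make `M` an associative unital `ℂ`-algebra, and `l`, `r` make `W` a unital
`M`-`M`-bimodule. All maps are bilinear by their type. -/
structure IsAlgebraBimodule {M W : Type} [AddCommGroup M] [Module ℂ M] [AddCommGroup W]
    [Module ℂ W] (mul : M →ₗ[ℂ] M →ₗ[ℂ] M) (one : M) (l : M →ₗ[ℂ] W →ₗ[ℂ] W)
    (r : W →ₗ[ℂ] M →ₗ[ℂ] W) : Prop where
  mul_assoc : ∀ b₁ b₂ b₃, mul (mul b₁ b₂) b₃ = mul b₁ (mul b₂ b₃)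
  one_mul : ∀ b, mul one b = b
  mul_one : ∀ b, mul b one = b
  left_mul : ∀ b₁ b₂ a, l (mul b₁ b₂) a = l b₁ (l b₂ a)
  left_one : ∀ a, l one a = a
  right_mul : ∀ a b₁ b₂, r a (mul b₁ b₂) = r (r a b₁) b₂
  right_one : ∀ a, r a one = a
  left_right : ∀ b₁ a b₂, r (l b₁ a) b₂ = l b₁ (r a b₂)

end TauPseudo
end

open TauPseudo

noncomputable section

set_option linter.unusedSectionVars false

namespace TauPseudo

/-! Fix a nonzero Schwartz function `φ` on `ℝᵈ`, put `π(z)φ` for its time-frequency shifts, and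
describe an operator `A` by the matrix `⟨A π(z)φ, π(w)φ⟩`. For `A = Op_τ(σ)` this entry is `σ`
paired with `W_τ(π(w)φ, π(z)φ)`. By covariance of the Wigner distribution (`tauWigner_tfC`), this is
a unimodular multiple of the short-time Fourier transform of `σ`, with window `W_τ(φ, φ)`, at
position `((1 - τ) w₁ + τ z₁, τ w₂ + (1 - τ) z₂)` and frequency `J(w - z)`. So the matrix is the
transform of the symbol in other linear coordinates (`symKer_eq`).

Both symbol classes then become decay conditions on matrices. A supremum over positions leaves a
function of `w - z`: the Sjöstrand class, for every `τ`, consists of the symbols whose matrix is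
dominated by `H(w - z)` with `H` in weighted `L¹`. A supremum over frequencies leaves a function of
the position, which for `0 < τ < 1` is an invertible linear image of `w - U_τ z`, where `U_τ(x, ω) =
(-τ/(1-τ) x, -(1-τ)/τ ω)`: the amalgam space consists of the symbols whose matrix is dominated by
`H(w - U_τ z)` (`memSjostrand_iff`, `memAmalgam_iff`).

A matrix localized along the graph of a linear isomorphism gives a bounded operator by Schur's test
(`exists_isOp_of_localized`), and matrices localized along `U` and `V` multiply, by a weighted Young
inequality, to one localized along `UV` (`Localized.comp`). Every bounded operator has a unique
`τ`-symbol (`exists_isOp_symbol`, `IsOp.symbol_unique`), so the class of a composition is read off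
its graph. Since `U_τ U_{1-τ} = 1`, two amalgam operators with parameters `τ` and `1 - τ` compose to
a Sjöstrand one; since `1 · U_τ = U_τ · 1 = U_τ`, the amalgam space is a bimodule, whose laws are
inherited from composition of operators.

For the negative part take both symbols to be the Dirac mass at the origin. Its operators are
reflected dilations, and two of them compose to a multiple of a dilation by some `r > 0`. The matrix
of that dilation has a nonzero constant value along a graph whose `τ`-positions fill phase space, so
the supremum over frequencies of the transform of its symbol is bounded below on a set of infinite
measure.

The analytic basis is the reconstruction formula `map_reconstruction`, valid under any continuous
functional on Schwartz space. It yields independence of the window, uniqueness of symbols and the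
expansion of operators in time-frequency shifts. -/

theorem one_add_norm_le_mul {G : Type} [NormedAddCommGroup G] (x y : G) : 1 + ‖x‖ ≤ (1 + ‖x - y‖) * (1 + ‖y‖) := by
  have : ‖x‖ ≤ ‖x - y‖ + ‖y‖ := by simpa using norm_add_le (x - y) y
  nlinarith [mul_nonneg (norm_nonneg (x - y)) (norm_nonneg y)]

/-! ### Characters and time-frequency shifts of Schwartz functions -/

section Character

variable {E : Type} [NormedAddCommGroup E] [NormedSpace ℝ E]

/-- The character `t ↦ exp(2πi B(ζ, t))` attached to a bilinear form `B`. -/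
def chr (B : E →L[ℝ] E →L[ℝ] ℝ) (ζ t : E) : ℂ :=
  Complex.exp (2 * Real.pi * Complex.I * ((B ζ t : ℝ) : ℂ))

variable (B : E →L[ℝ] E →L[ℝ] ℝ)

@[simp]
theorem norm_chr (ζ t : E) : ‖chr B ζ t‖ = 1 := by
  rw [chr, Complex.norm_exp]; simp

theorem chr_add_left (ζ ζ' t : E) : chr B (ζ + ζ') t = chr B ζ t * chr B ζ' t := by
  simp only [chr, map_add, _root_.add_apply, Complex.ofReal_add, mul_add,
    Complex.exp_add]

theorem chr_add_right (ζ t t' : E) : chr B ζ (t + t') = chr B ζ t * chr B ζ t' := by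
  simp only [chr, map_add, Complex.ofReal_add, mul_add, Complex.exp_add]

theorem chr_neg_left (ζ t : E) : chr B (-ζ) t = conj (chr B ζ t) := by
  simp only [chr, ← Complex.exp_conj]
  simp [map_ofNat]

theorem chr_sub_left (ζ ζ' t : E) : chr B (ζ - ζ') t = chr B ζ t * conj (chr B ζ' t) := by
  rw [sub_eq_add_neg, chr_add_left, chr_neg_left]

theorem chr_mul_conj (ζ t : E) : chr B ζ t * conj (chr B ζ t) = 1 := by
  rw [Complex.mul_conj, Complex.normSq_eq_norm_sq]; simp

theorem contDiff_chr : ContDiff ℝ ∞ fun p : E × E ↦ chr B p.1 p.2 := by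
  have h : ContDiff ℝ ∞ fun p : E × E ↦ B p.1 p.2 := by fun_prop
  exact (contDiff_const.mul (Complex.ofRealCLM.contDiff.comp h)).cexp

@[fun_prop]
theorem continuous_chr : Continuous fun p : E × E ↦ chr B p.1 p.2 := (contDiff_chr B).continuous

theorem norm_iteratedFDeriv_exp_real (n : ℕ) (r : ℝ) :
    ‖iteratedFDeriv ℝ n (fun r : ℝ ↦ Complex.exp (2 * Real.pi * Complex.I * (r : ℂ))) r‖ =
      (2 * Real.pi) ^ n := by
  have h (n : ℕ) : iteratedDeriv n
      (fun r : ℝ ↦ Complex.exp (2 * Real.pi * Complex.I * (r : ℂ))) = fun r : ℝ ↦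
      (2 * Real.pi * Complex.I) ^ n * Complex.exp (2 * Real.pi * Complex.I * (r : ℂ)) := by
    induction n with
    | zero => simp
    | succ n ih =>
      rw [iteratedDeriv_succ, ih]
      ext r
      have h1 : HasDerivAt (fun r : ℝ ↦ 2 * Real.pi * Complex.I * (r : ℂ))
          (2 * Real.pi * Complex.I) r := by
        simpa using (Complex.ofRealCLM.hasDerivAt (x := r)).const_mul (2 * Real.pi * Complex.I)
      rw [(h1.cexp.const_mul _).deriv]
      ring
  rw [norm_iteratedFDeriv_eq_norm_iteratedDeriv, h, norm_mul]
  have : ‖Complex.exp (2 * Real.pi * Complex.I * (r : ℂ))‖ = 1 := by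
    rw [Complex.norm_exp]; simp
  simp [this, abs_of_pos Real.pi_pos]

theorem norm_iteratedFDeriv_chr_le (ζ t : E) (n : ℕ) :
    ‖iteratedFDeriv ℝ n (chr B ζ) t‖ ≤ (2 * Real.pi * ‖B‖ * ‖ζ‖) ^ n := by
  have hs : ContDiff ℝ n (fun r : ℝ ↦ Complex.exp (2 * Real.pi * Complex.I * (r : ℂ))) :=
    (contDiff_const.mul Complex.ofRealCLM.contDiff).cexp
  have h := (B ζ).iteratedFDeriv_comp_right hs t (i := n) le_rfl
  refine (congrArg norm h).le.trans <|
    (ContinuousMultilinearMap.norm_compContinuousLinearMap_le _ _).trans ?_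
  rw [norm_iteratedFDeriv_exp_real, Finset.prod_const, Finset.card_univ, Fintype.card_fin,
    mul_assoc (2 * Real.pi), mul_pow (2 * Real.pi)]
  gcongr
  exact B.le_opNorm ζ

theorem hasTemperateGrowth_chr (ζ : E) : (chr B ζ).HasTemperateGrowth := by
  refine ⟨(contDiff_chr B).comp (contDiff_const.prodMk contDiff_id), fun n ↦
    ⟨0, (2 * Real.pi * ‖B‖ * ‖ζ‖) ^ n, fun t ↦ ?_⟩⟩
  simpa using norm_iteratedFDeriv_chr_le B ζ t n

/-- The time-frequency shift `π(z, ζ) g (t) = exp(2πi B(ζ, t)) g(t - z)`. -/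
def tf (z ζ : E) (g : 𝓢(E, ℂ)) : 𝓢(E, ℂ) :=
  SchwartzMap.smulLeftCLM ℂ (chr B ζ) (SchwartzMap.compSubConstCLM ℂ z g)

@[simp]
theorem tf_apply (z ζ : E) (g : 𝓢(E, ℂ)) (t : E) : tf B z ζ g t = chr B ζ t * g (t - z) := by
  rw [tf, SchwartzMap.smulLeftCLM_apply_apply (hasTemperateGrowth_chr B ζ),
    SchwartzMap.compSubConstCLM_apply, smul_eq_mul]

theorem norm_tf_apply (z ζ : E) (g : 𝓢(E, ℂ)) (t : E) : ‖tf B z ζ g t‖ = ‖g (t - z)‖ := by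
  simp

theorem exists_one_add_norm_bound {F : Type} [NormedAddCommGroup F] [NormedSpace ℝ F]
    (g : 𝓢(E, F)) (k n : ℕ) :
    ∃ C : ℝ, 0 ≤ C ∧ ∀ j ≤ n, ∀ t, (1 + ‖t‖) ^ k * ‖iteratedFDeriv ℝ j g t‖ ≤ C := by
  refine ⟨_, by positivity, fun j hj t ↦ SchwartzMap.one_add_le_sup_seminorm_apply (𝕜 := ℝ)
    (m := (k, n)) le_rfl hj g t⟩

/-- Leibniz's rule: derivatives falling on the character cost powers of the frequency, while moving
the weight from `t` to `t - z` costs a power of `1 + ‖z‖`. Polynomial growth of the shifts is what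
lets rapidly decaying coefficients superpose them in every seminorm. -/
theorem exists_seminorm_tf_le (g : 𝓢(E, ℂ)) (k n : ℕ) :
    ∃ C : ℝ, 0 ≤ C ∧ ∀ z ζ : E,
      SchwartzMap.seminorm ℝ k n (tf B z ζ g) ≤ C * ((1 + ‖z‖) ^ k * (1 + ‖ζ‖) ^ n) := by
  obtain ⟨S, hS0, hS⟩ := exists_one_add_norm_bound g k n
  set b := 2 * Real.pi * ‖B‖ with hb
  have hb0 : 0 ≤ b := by positivity
  refine ⟨∑ i ∈ Finset.range (n + 1), (n.choose i : ℝ) * (1 + b) ^ n * S, by positivity,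
    fun z ζ ↦ SchwartzMap.seminorm_le_bound ℝ k n _ (by positivity) fun t ↦ ?_⟩
  have e : (tf B z ζ g : E → ℂ) = fun t ↦ chr B ζ t * g (t - z) := by ext t; simp
  have hc : ContDiff ℝ ∞ (chr B ζ) := (hasTemperateGrowth_chr B ζ).1
  have hg : ContDiff ℝ ∞ (fun t ↦ g (t - z)) := (g.smooth ⊤).comp (contDiff_id.sub contDiff_const)
  rw [e, Finset.sum_mul]
  refine (mul_le_mul_of_nonneg_left
    (norm_iteratedFDeriv_mul_le hc hg t (n := n) (by exact_mod_cast le_top))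
    (by positivity)).trans ?_
  rw [Finset.mul_sum]
  refine Finset.sum_le_sum fun i hi ↦ ?_
  have hi' : i ≤ n := by simpa [Nat.lt_succ_iff] using hi
  have h1 : ‖iteratedFDeriv ℝ i (chr B ζ) t‖ ≤ (1 + b) ^ n * (1 + ‖ζ‖) ^ n := by
    refine (norm_iteratedFDeriv_chr_le B ζ t i).trans ?_
    rw [← mul_pow]
    have : b * ‖ζ‖ ≤ (1 + b) * (1 + ‖ζ‖) := by nlinarith [norm_nonneg ζ]
    calc (b * ‖ζ‖) ^ i ≤ ((1 + b) * (1 + ‖ζ‖)) ^ i := by gcongr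
      _ ≤ _ := pow_le_pow_right₀ (by nlinarith [norm_nonneg ζ]) hi'
  have h2 : ‖t‖ ^ k * ‖iteratedFDeriv ℝ (n - i) (fun t ↦ g (t - z)) t‖ ≤ (1 + ‖z‖) ^ k * S := by
    rw [iteratedFDeriv_comp_sub]
    have h3 : ‖t‖ ^ k ≤ (1 + ‖z‖) ^ k * (1 + ‖t - z‖) ^ k := by
      rw [← mul_pow]
      gcongr
      linarith [one_add_norm_le_mul t z]
    calc _ ≤ (1 + ‖z‖) ^ k * (1 + ‖t - z‖) ^ k * ‖iteratedFDeriv ℝ (n - i) g (t - z)‖ := by gcongr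
      _ = (1 + ‖z‖) ^ k * ((1 + ‖t - z‖) ^ k * ‖iteratedFDeriv ℝ (n - i) g (t - z)‖) := by ring
      _ ≤ _ := by gcongr; exact hS _ (by omega) _
  calc _ = (n.choose i : ℝ) * ‖iteratedFDeriv ℝ i (chr B ζ) t‖ *
        (‖t‖ ^ k * ‖iteratedFDeriv ℝ (n - i) (fun t ↦ g (t - z)) t‖) := by ring
    _ ≤ (n.choose i : ℝ) * ((1 + b) ^ n * (1 + ‖ζ‖) ^ n) * ((1 + ‖z‖) ^ k * S) := by gcongr
    _ = _ := by ring

theorem continuous_iteratedFDeriv_of_jointly {Λ : Type} [NormedAddCommGroup Λ] [NormedSpace ℝ Λ]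
    {F : Type} [NormedAddCommGroup F] [NormedSpace ℝ F] {f : Λ → E → F}
    (hf : ContDiff ℝ ∞ fun p : Λ × E ↦ f p.1 p.2) (n : ℕ) :
    Continuous fun p : Λ × E ↦ iteratedFDeriv ℝ n (f p.1) p.2 := by
  have h (p : Λ × E) : iteratedFDeriv ℝ n (f p.1) p.2 =
      (iteratedFDeriv ℝ n (fun p : Λ × E ↦ f p.1 p.2) p).compContinuousLinearMap
        fun _ ↦ ContinuousLinearMap.inr ℝ Λ E := by
    have e : f p.1 = (fun w : Λ × E ↦ f ((p.1, 0) + w).1 ((p.1, 0) + w).2) ∘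
        (ContinuousLinearMap.inr ℝ Λ E) := by ext y; simp
    have hs : ContDiff ℝ n (fun w : Λ × E ↦ f ((p.1, 0) + w).1 ((p.1, 0) + w).2) :=
      (hf.of_le (by exact_mod_cast le_top)).comp (contDiff_const.add contDiff_id)
    rw [e, ContinuousLinearMap.iteratedFDeriv_comp_right _ hs _ le_rfl,
      iteratedFDeriv_comp_add_left (f := fun w : Λ × E ↦ f w.1 w.2)]
    simp
  simp only [h]
  exact (ContinuousMultilinearMap.compContinuousLinearMapL
    (fun _ : Fin n ↦ ContinuousLinearMap.inr ℝ Λ E)).continuous.comp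
    (hf.continuous_iteratedFDeriv (by exact_mod_cast le_top))

/-- One additional order of decay, bounded locally uniformly in the parameter, makes the tails
outside a large ball small; inside the ball joint smoothness and compactness give uniform
convergence of derivatives. -/
theorem continuous_schwartz_of_jointly [ProperSpace E] {Λ : Type} [NormedAddCommGroup Λ]
    [NormedSpace ℝ Λ] {F : Type} [NormedAddCommGroup F] [NormedSpace ℝ F] {K : Λ → 𝓢(E, F)}
    (hK : ContDiff ℝ ∞ fun p : Λ × E ↦ K p.1 p.2)
    (hb : ∀ k n : ℕ, ∀ l : Λ, ∃ C : ℝ, ∀ᶠ m in nhds l, SchwartzMap.seminorm ℝ k n (K m) ≤ C) :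
    Continuous K := by
  rw [continuous_iff_continuousAt]
  intro l
  rw [ContinuousAt, (schwartz_withSeminorms ℝ E F).tendsto_nhds]
  rintro ⟨k, n⟩ ε hε
  obtain ⟨C, hC⟩ := hb (k + 1) n l
  have hCl : SchwartzMap.seminorm ℝ (k + 1) n (K l) ≤ C := hC.self_of_nhds
  have hC0 : 0 ≤ C := (apply_nonneg _ _).trans hCl
  -- The tail is at most `2 * C / R`, and this radius makes it at most `ε / 2`; the `+ 1` keeps the
  -- radius positive when `C = 0`.
  set R : ℝ := 4 * C / ε + 1 with hR
  have hR0 : 0 < R := by positivity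
  have hcont := continuous_iteratedFDeriv_of_jointly (f := fun l t ↦ K l t) hK n
  have hloc : ∀ᶠ m in nhds l, ∀ t ∈ Metric.closedBall (0 : E) R,
      R ^ k * ‖iteratedFDeriv ℝ n (K m) t - iteratedFDeriv ℝ n (K l) t‖ < ε / 2 := by
    refine (isCompact_closedBall _ _).eventually_forall_of_forall_eventually fun t _ ↦ ?_
    have hc : Continuous fun p : Λ × E ↦
        R ^ k * ‖iteratedFDeriv ℝ n (K p.1) p.2 - iteratedFDeriv ℝ n (K l) p.2‖ :=
      continuous_const.mul ((hcont.sub (hcont.comp (continuous_const.prodMk continuous_snd))).norm)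
    exact hc.continuousAt.eventually_lt continuousAt_const (by simpa using hε)
  filter_upwards [hC, hloc] with m hm hml
  refine lt_of_le_of_lt (SchwartzMap.seminorm_le_bound ℝ k n _ (M := ε / 2) (by positivity)
    fun t ↦ ?_) (half_lt_self hε)
  have e : iteratedFDeriv ℝ n (K m - K l) t =
      iteratedFDeriv ℝ n (K m) t - iteratedFDeriv ℝ n (K l) t :=
    iteratedFDeriv_sub_apply ((K m).contDiffAt n) ((K l).contDiffAt n)
  rw [e]
  by_cases ht : ‖t‖ ≤ R
  · refine le_trans ?_ (hml t (by simpa using ht)).le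
    gcongr
  · have ht' : R < ‖t‖ := not_le.1 ht
    have h1 := (SchwartzMap.le_seminorm ℝ (k + 1) n (K m) t).trans hm
    have h2 := (SchwartzMap.le_seminorm ℝ (k + 1) n (K l) t).trans hCl
    have h3 : ‖t‖ * (‖t‖ ^ k * ‖iteratedFDeriv ℝ n (K m) t - iteratedFDeriv ℝ n (K l) t‖) ≤
        2 * C := by
      calc _ = ‖t‖ ^ (k + 1) * ‖iteratedFDeriv ℝ n (K m) t - iteratedFDeriv ℝ n (K l) t‖ := by
            ring
        _ ≤ ‖t‖ ^ (k + 1) * (‖iteratedFDeriv ℝ n (K m) t‖ + ‖iteratedFDeriv ℝ n (K l) t‖) := by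
            gcongr; exact norm_sub_le _ _
        _ ≤ _ := by linarith
    have h4 : R * (‖t‖ ^ k * ‖iteratedFDeriv ℝ n (K m) t - iteratedFDeriv ℝ n (K l) t‖) ≤
        2 * C := le_trans (by gcongr) h3
    have h5 : 2 * C ≤ R * (ε / 2) := by
      have : R * (ε / 2) = 2 * C + ε / 2 := by rw [hR]; field_simp; ring
      linarith
    exact le_of_mul_le_mul_left (h4.trans h5) hR0

theorem continuous_tf [FiniteDimensional ℝ E] (g : 𝓢(E, ℂ)) :
    Continuous fun p : E × E ↦ tf B p.1 p.2 g := by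
  refine continuous_schwartz_of_jointly ?_ fun k n l ↦ ?_
  · simp only [tf_apply]
    exact ((contDiff_chr B).comp ((contDiff_snd.comp contDiff_fst).prodMk contDiff_snd)).mul
      ((g.smooth ⊤).comp (contDiff_snd.sub (contDiff_fst.comp contDiff_fst)))
  · obtain ⟨C, hC0, hC⟩ := exists_seminorm_tf_le B g k n
    refine ⟨C * ((1 + ‖l.1‖) ^ k * (1 + ‖l.2‖) ^ n) + 1, ?_⟩
    have hc : Continuous fun p : E × E ↦ C * ((1 + ‖p.1‖) ^ k * (1 + ‖p.2‖) ^ n) := by fun_prop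
    filter_upwards [hc.continuousAt.eventually_lt
      (continuousAt_const (y := C * ((1 + ‖l.1‖) ^ k * (1 + ‖l.2‖) ^ n) + 1)) (by simp)] with p hp
    exact (hC p.1 p.2).trans hp.le

end Character

/-! ### Continuous functionals commute with integrals of Schwartz functions -/

section Interchange

variable {E : Type} [NormedAddCommGroup E] [NormedSpace ℝ E]
  {X : Type} [TopologicalSpace X] [SecondCountableTopology X] [MeasurableSpace X] [BorelSpace X]
  {μ : Measure X}

/-- A copy of the normed space of continuous multilinear maps in `n` variables. -/
def MultiMap (E : Type) [NormedAddCommGroup E] [NormedSpace ℝ E] (n : ℕ) (F : Type)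
    [NormedAddCommGroup F] [NormedSpace ℝ F] : Type := E [×n]→L[ℝ] F

instance (n : ℕ) (F : Type) [NormedAddCommGroup F] [NormedSpace ℝ F] :
    NormedAddCommGroup (MultiMap E n F) :=
  inferInstanceAs (NormedAddCommGroup (E [×n]→L[ℝ] F))

instance (n : ℕ) (F : Type) [NormedAddCommGroup F] [NormedSpace ℝ F] :
    NormedSpace ℝ (MultiMap E n F) :=
  inferInstanceAs (NormedSpace ℝ (E [×n]→L[ℝ] F))

instance (n : ℕ) (F : Type) [NormedAddCommGroup F] [NormedSpace ℝ F] [CompleteSpace F] :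
    CompleteSpace (MultiMap E n F) :=
  inferInstanceAs (CompleteSpace (E [×n]→L[ℝ] F))

/-- The `n`-th derivative as an element of `MultiMap`. -/
def nthDeriv {F : Type} [NormedAddCommGroup F] [NormedSpace ℝ F] (n : ℕ) (f : 𝓢(E, F)) (e : E) :
    MultiMap E n F := iteratedFDeriv ℝ n f e

/-- Currying of the last variable. -/
def curryLast (E : Type) [NormedAddCommGroup E] [NormedSpace ℝ E] (n : ℕ) (F : Type)
    [NormedAddCommGroup F] [NormedSpace ℝ F] : MultiMap E n (E →L[ℝ] F) ≃L[ℝ] MultiMap E (n + 1) F :=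
  (continuousMultilinearCurryRightEquiv' ℝ n E F).symm.toContinuousLinearEquiv

/-- Multilinear maps in no variables are constants. -/
def curryZero (E : Type) [NormedAddCommGroup E] [NormedSpace ℝ E] (F : Type)
    [NormedAddCommGroup F] [NormedSpace ℝ F] : F ≃L[ℝ] MultiMap E 0 F :=
  (continuousMultilinearCurryFin0 ℝ E F).symm.toContinuousLinearEquiv

/-- Induction by differentiating under the integral sign, dominated by the seminorm of index `(0,
1)`. The target space is generalized because the inductive step passes to derivatives, which take
values in linear maps. -/
theorem nthDeriv_eq_integral (n : ℕ) : ∀ {F : Type} [NormedAddCommGroup F]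
    [NormedSpace ℝ F] [CompleteSpace F] {K : X → 𝓢(E, F)} {φ : 𝓢(E, F)}, Continuous K →
    (∀ m : ℕ, Integrable (fun x ↦ SchwartzMap.seminorm ℝ 0 m (K x)) μ) →
    (∀ e, φ e = ∫ x, K x e ∂μ) →
    ∀ e, nthDeriv n φ e = ∫ x, nthDeriv n (K x) e ∂μ := by
  induction n with
  | zero =>
    intro F _ _ _ K φ hK hint hφ e
    have h0 (f : 𝓢(E, F)) : nthDeriv 0 f e = curryZero E F (f e) := rfl
    simp only [h0, hφ e]
    exact ((curryZero E F).integral_comp_comm (fun x ↦ K x e)).symm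
  | succ n ih =>
    intro F _ _ _ K φ hK hint hφ e
    have hev (G : Type) [NormedAddCommGroup G] [NormedSpace ℝ G] (e : E) :
        Continuous fun f : 𝓢(E, G) ↦ f e := by
      have : Continuous fun f : 𝓢(E, G) ↦
          SchwartzMap.toBoundedContinuousFunctionCLM ℝ E G f e :=
        (BoundedContinuousFunction.evalCLM ℝ e).continuous.comp
          (SchwartzMap.toBoundedContinuousFunctionCLM ℝ E G).continuous
      exact this
    have hfd : ∀ e, SchwartzMap.fderivCLM ℝ E F φ e =
        ∫ x, SchwartzMap.fderivCLM ℝ E F (K x) e ∂μ := by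
      intro e
      have hd : HasFDerivAt (fun e ↦ ∫ x, K x e ∂μ) (∫ x, fderiv ℝ (K x) e ∂μ) e := by
        refine hasFDerivAt_integral_of_dominated_of_fderiv_le (𝕜 := ℝ) (F := fun e x ↦ K x e)
          (F' := fun e x ↦ fderiv ℝ (K x) e)
          (bound := fun x ↦ SchwartzMap.seminorm ℝ 0 1 (K x)) Filter.univ_mem
          (Filter.Eventually.of_forall fun e ↦
            ((hev F e).comp hK).aestronglyMeasurable)
          ?_ ?_ (Filter.Eventually.of_forall fun x e _ ↦ ?_) (hint 1)
          (Filter.Eventually.of_forall fun x e _ ↦ (K x).differentiableAt.hasFDerivAt)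
        · refine (hint 0).mono' ((hev F e).comp hK).aestronglyMeasurable
            (Filter.Eventually.of_forall fun x ↦ SchwartzMap.norm_le_seminorm ℝ (K x) e)
        · exact ((hev _ e).comp
            ((SchwartzMap.fderivCLM ℝ E F).continuous.comp hK)).aestronglyMeasurable
        · rw [← norm_iteratedFDeriv_one]
          exact SchwartzMap.norm_iteratedFDeriv_le_seminorm ℝ (K x) 1 e
      have : (φ : E → F) = fun e ↦ ∫ x, K x e ∂μ := funext hφ
      rw [SchwartzMap.fderivCLM_apply, this, hd.fderiv]
      rfl
    have hs (m : ℕ) (f : 𝓢(E, F)) : SchwartzMap.seminorm ℝ 0 m (SchwartzMap.fderivCLM ℝ E F f) ≤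
        SchwartzMap.seminorm ℝ 0 (m + 1) f := by
      refine SchwartzMap.seminorm_le_bound ℝ 0 m _ (apply_nonneg _ _) fun e ↦ ?_
      have : (SchwartzMap.fderivCLM ℝ E F f : E → E →L[ℝ] F) = fderiv ℝ f := rfl
      rw [this, norm_iteratedFDeriv_fderiv]
      exact SchwartzMap.le_seminorm ℝ 0 (m + 1) f e
    have hcs (m : ℕ) (G : Type) [NormedAddCommGroup G] [NormedSpace ℝ G] :
        Continuous (SchwartzMap.seminorm ℝ 0 m : 𝓢(E, G) → ℝ) :=
      (schwartz_withSeminorms ℝ E G).continuous_seminorm (0, m)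
    have hc : Continuous fun x ↦ SchwartzMap.fderivCLM ℝ E F (K x) :=
      (SchwartzMap.fderivCLM ℝ E F).continuous.comp hK
    have := ih hc (fun m ↦ (hint (m + 1)).mono' ((hcs m _).comp hc).aestronglyMeasurable
      (Filter.Eventually.of_forall fun x ↦ by
        rw [Real.norm_of_nonneg (apply_nonneg _ _)]; exact hs m (K x))) hfd e
    have h1 (f : 𝓢(E, F)) : nthDeriv (n + 1) f e =
        curryLast E n F (nthDeriv n (SchwartzMap.fderivCLM ℝ E F f) e) := by
      rw [nthDeriv, iteratedFDeriv_succ_eq_comp_right]; rfl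
    rw [h1 φ, this]
    simp only [h1]
    exact ((curryLast E n F).integral_comp_comm _).symm

/-- `f ↦ (t ↦ ‖t‖ ^ k • D^n f t)` as a map into bounded continuous functions. -/
def weightedDeriv (E : Type) [NormedAddCommGroup E] [NormedSpace ℝ E] (k n : ℕ) :
    𝓢(E, ℂ) →ₗ[ℝ] BoundedContinuousFunction E (MultiMap E n ℂ) where
  toFun f := BoundedContinuousFunction.ofNormedAddCommGroup
    (fun t ↦ ‖t‖ ^ k • nthDeriv n f t)
    ((continuous_norm.pow k).smul
      (show Continuous (iteratedFDeriv ℝ n f) from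
        (f.smooth ⊤).continuous_iteratedFDeriv (by exact_mod_cast le_top)))
    (SchwartzMap.seminorm ℝ k n f) fun t ↦ by
      rw [norm_smul, norm_pow, norm_norm]; exact SchwartzMap.le_seminorm ℝ k n f t
  map_add' f g := by
    ext1 t
    have : nthDeriv n (f + g) t = nthDeriv n f t + nthDeriv n g t :=
      iteratedFDeriv_add_apply (f.contDiffAt n) (g.contDiffAt n)
    simp [this]
  map_smul' c f := by
    ext1 t
    have : nthDeriv n (c • f) t = c • nthDeriv n f t :=
      iteratedFDeriv_const_smul_apply (f.contDiffAt n)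
    simp [this, smul_comm c]

theorem weightedDeriv_apply (k n : ℕ) (f : 𝓢(E, ℂ)) (t : E) :
    weightedDeriv E k n f t = ‖t‖ ^ k • nthDeriv n f t := rfl

theorem norm_weightedDeriv (k n : ℕ) (f : 𝓢(E, ℂ)) :
    ‖weightedDeriv E k n f‖ = SchwartzMap.seminorm ℝ k n f := by
  refine le_antisymm ((BoundedContinuousFunction.norm_le (apply_nonneg _ _)).2 fun t ↦ by
      rw [weightedDeriv_apply, norm_smul, norm_pow, norm_norm]
      exact SchwartzMap.le_seminorm ℝ k n f t)
    (SchwartzMap.seminorm_le_bound ℝ k n f (norm_nonneg _) fun t ↦ ?_)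
  refine le_trans (le_of_eq ?_) ((weightedDeriv E k n f).norm_coe_le_norm t)
  rw [weightedDeriv_apply, norm_smul, norm_pow, norm_norm]
  rfl

theorem continuous_weightedDeriv (k n : ℕ) : Continuous (weightedDeriv E k n) := by
  refine continuous_of_continuousAt_zero (weightedDeriv E k n) ?_
  rw [ContinuousAt, map_zero]
  refine tendsto_zero_iff_norm_tendsto_zero.2 ?_
  simp only [norm_weightedDeriv]
  exact ((schwartz_withSeminorms ℝ E ℂ).continuous_seminorm (k, n)).tendsto' 0 0 (map_zero _)

/-- A continuous functional is controlled by finitely many seminorms, hence factors through an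
embedding into a finite product of Banach spaces of bounded continuous functions. Hahn-Banach
extends it to the whole product, where a continuous functional commutes with the Bochner integral.
-/
theorem map_eq_integral_real {K : X → 𝓢(E, ℂ)} {φ : 𝓢(E, ℂ)} (hK : Continuous K)
    (hint : ∀ k m : ℕ, Integrable (fun x ↦ SchwartzMap.seminorm ℝ k m (K x)) μ)
    (hφ : ∀ e, φ e = ∫ x, K x e ∂μ) (T : 𝓢(E, ℂ) →L[ℝ] ℝ) :
    Integrable (fun x ↦ T (K x)) μ ∧ T φ = ∫ x, T (K x) ∂μ := by
  obtain ⟨s, C, -, hC⟩ := Seminorm.bound_of_continuous (schwartz_withSeminorms ℝ E ℂ)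
    ((normSeminorm ℝ ℝ).comp T.toLinearMap) (continuous_norm.comp T.continuous)
  -- The sup norm is added to the controlling seminorms to make the embedding injective.
  let s' := insert (0, 0) s
  let ι : 𝓢(E, ℂ) →ₗ[ℝ] (∀ i : s', BoundedContinuousFunction E (MultiMap E i.1.2 ℂ)) := LinearMap.pi fun i ↦ weightedDeriv E i.1.1 i.1.2
  have hι : Continuous ι := continuous_pi fun i ↦ continuous_weightedDeriv i.1.1 i.1.2
  have hsemi (i) (hi : i ∈ s') (f : 𝓢(E, ℂ)) : SchwartzMap.seminorm ℝ i.1 i.2 f ≤ ‖ι f‖ := by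
    rw [← norm_weightedDeriv]
    exact norm_le_pi_norm (ι f) ⟨i, hi⟩
  have hinj : Function.Injective ι := by
    refine (injective_iff_map_eq_zero ι).2 fun f hf ↦ ?_
    ext t
    have h1 := (SchwartzMap.norm_le_seminorm ℝ f t).trans
      (hsemi (0, 0) (Finset.mem_insert_self _ _) f)
    rw [hf, norm_zero] at h1
    simpa using h1
  have hT (f : 𝓢(E, ℂ)) : ‖T f‖ ≤ C * ‖ι f‖ := by
    refine (hC f).trans ?_
    refine mul_le_mul_of_nonneg_left (Seminorm.finset_sup_apply_le (norm_nonneg _) fun i hi ↦ ?_)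
      C.2
    exact hsemi i (Finset.mem_insert_of_mem hi) f
  let ei := LinearEquiv.ofInjective ι hinj
  let T₀ : StrongDual ℝ (LinearMap.range ι) :=
    (T.toLinearMap.comp ei.symm.toLinearMap).mkContinuous C fun y ↦ by
      have := hT (ei.symm y)
      have h2 : ι (ei.symm y) = y := congrArg Subtype.val (ei.apply_symm_apply y)
      rw [h2] at this
      exact this
  obtain ⟨T₁, hT₁, -⟩ := exists_extension_norm_eq _ T₀
  have hTι (f : 𝓢(E, ℂ)) : T₁ (ι f) = T f := by
    have h := hT₁ (ei f)
    have h' : T₀ (ei f) = T f := by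
      change T (ei.symm (ei f)) = T f
      rw [LinearEquiv.symm_apply_apply]
    exact h.trans h'
  have hIi (i : s') : Integrable (fun x ↦ weightedDeriv E i.1.1 i.1.2 (K x)) μ :=
    (hint i.1.1 i.1.2).mono' ((continuous_weightedDeriv _ _).comp hK).aestronglyMeasurable
      (Filter.Eventually.of_forall fun x ↦ (norm_weightedDeriv _ _ _).le)
  have hI : Integrable (fun x ↦ ι (K x)) μ := Integrable.of_eval hIi
  have hIφ : ι φ = ∫ x, ι (K x) ∂μ := by
    funext i
    refine Eq.trans ?_ (eval_integral hIi i).symm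
    ext1 t
    have h1 := (BoundedContinuousFunction.evalCLM ℝ t).integral_comp_comm (hIi i)
    refine Eq.trans ?_ h1
    change ‖t‖ ^ i.1.1 • nthDeriv i.1.2 φ t = ∫ x, ‖t‖ ^ i.1.1 • nthDeriv i.1.2 (K x) t ∂μ
    rw [integral_smul, nthDeriv_eq_integral i.1.2 hK (hint 0) hφ]
  constructor
  · simpa only [hTι] using T₁.integrable_comp hI
  · rw [← hTι, hIφ, ← T₁.integral_comp_comm hI]
    simp only [hTι]

/-- The functional is only real-linear, so that conjugate-linear pairings are covered; its real and
imaginary parts are treated separately. -/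
theorem map_eq_integral {K : X → 𝓢(E, ℂ)} {φ : 𝓢(E, ℂ)} (hK : Continuous K)
    (hint : ∀ k m : ℕ, Integrable (fun x ↦ SchwartzMap.seminorm ℝ k m (K x)) μ)
    (hφ : ∀ e, φ e = ∫ x, K x e ∂μ) (T : 𝓢(E, ℂ) →L[ℝ] ℂ) :
    Integrable (fun x ↦ T (K x)) μ ∧ T φ = ∫ x, T (K x) ∂μ := by
  obtain ⟨hr, hr'⟩ := map_eq_integral_real hK hint hφ (Complex.reCLM.comp T)
  obtain ⟨hi, hi'⟩ := map_eq_integral_real hK hint hφ (Complex.imCLM.comp T)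
  have h : Integrable (fun x ↦ T (K x)) μ := by
    have := (hr.ofReal (𝕜 := ℂ)).add ((hi.ofReal (𝕜 := ℂ)).mul_const Complex.I)
    refine this.congr (Filter.Eventually.of_forall fun x ↦ ?_)
    exact Complex.re_add_im (T (K x))
  refine ⟨h, Complex.ext ?_ ?_⟩
  · have := Complex.reCLM.integral_comp_comm h
    exact hr'.trans this
  · have := Complex.imCLM.integral_comp_comm h
    exact hi'.trans this

end Interchange

/-! ### Decay and inversion of the short-time Fourier transform -/

section STFT

variable {E : Type} [NormedAddCommGroup E] [NormedSpace ℝ E] [FiniteDimensional ℝ E]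
  [MeasureSpace E] [BorelSpace E] [(volume : Measure E).IsAddHaarMeasure]

/-- A bilinear form for which the Fourier inversion formula holds on Schwartz functions. -/
structure IsFourierForm (B : E →L[ℝ] E →L[ℝ] ℝ) : Prop where
  nondeg : ∃ C : ℝ, 0 ≤ C ∧ ∀ ζ : E, ∃ v : E, ‖v‖ ≤ 1 ∧ ‖ζ‖ ≤ C * |B ζ v|
  inversion : ∀ (ψ : 𝓢(E, ℂ)) (t : E),
    ∫ ζ, chr B ζ t * ∫ u, conj (chr B ζ u) * ψ u = ψ t

/-- The product of two Schwartz functions. -/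
def mulS (f g : 𝓢(E, ℂ)) : 𝓢(E, ℂ) := SchwartzMap.pairing (ContinuousLinearMap.mul ℂ ℂ) f g

@[simp]
theorem mulS_apply (f g : 𝓢(E, ℂ)) (t : E) : mulS f g t = f t * g t := rfl

/-- The real-linear functional `f ↦ ∫ conj f * ψ`. -/
def innerCLM (ψ : 𝓢(E, ℂ)) : 𝓢(E, ℂ) →L[ℝ] ℂ :=
  ((SchwartzMap.integralCLM ℂ volume).comp
    (SchwartzMap.pairing (ContinuousLinearMap.mul ℂ ℂ) ψ)).restrictScalars ℝ |>.comp
    (SchwartzMap.postcompCLM (𝕜 := ℝ) (Complex.conjCLE : ℂ →L[ℝ] ℂ))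

theorem innerCLM_apply (ψ f : 𝓢(E, ℂ)) : innerCLM ψ f = ∫ t, conj (f t) * ψ t := by
  change ∫ t, ψ t * conj (f t) = _
  simp only [mul_comm]

variable (B : E →L[ℝ] E →L[ℝ] ℝ)

/-- The short-time Fourier transform of a Schwartz function. -/
def stftS (G ψ : 𝓢(E, ℂ)) (p : E × E) : ℂ := ∫ t, conj (tf B p.1 p.2 G t) * ψ t

theorem continuous_stftS (G ψ : 𝓢(E, ℂ)) : Continuous (stftS B G ψ) := by
  have : stftS B G ψ = fun p ↦ innerCLM ψ (tf B p.1 p.2 G) := by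
    ext p; rw [innerCLM_apply]; rfl
  rw [this]
  exact (innerCLM ψ).continuous.comp (continuous_tf B G)

/-- For a fixed position the transform is the Fourier transform of the windowed function; both its
decay in frequency and its inversion come from here. -/
theorem stftS_eq (G ψ : 𝓢(E, ℂ)) (p : E × E) : stftS B G ψ p =
    ∫ u, conj (chr B p.2 u) * mulS (SchwartzMap.compSubConstCLM ℂ p.1 (conjS G)) ψ u := by
  rw [stftS]
  congr 1 with t
  simp [mul_assoc]

/-- The window decays in `t - z` and `ψ` decays in `t`; since `1 + ‖z‖ ≤ (1 + ‖t - z‖)(1 + ‖t‖)`,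
together they give decay in both `z` and `t`, uniformly in `ψ` up to one seminorm. -/
theorem exists_iteratedFDeriv_window_le (G : 𝓢(E, ℂ)) (N M : ℕ) :
    ∃ C : ℝ, 0 ≤ C ∧ ∀ (ψ : 𝓢(E, ℂ)) (z t : E) (p : ℕ), p ≤ N →
      (1 + ‖z‖) ^ N * ‖iteratedFDeriv ℝ p (mulS (SchwartzMap.compSubConstCLM ℂ z G) ψ) t‖ *
        (1 + ‖t‖) ^ M ≤ C * (Finset.Iic (N + M, N)).sup (schwartzSeminormFamily ℝ E ℂ) ψ := by
  obtain ⟨S, hS0, hS⟩ := exists_one_add_norm_bound G N N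
  refine ⟨2 ^ N * S * 2 ^ (N + M), by positivity, fun ψ z t p hp ↦ ?_⟩
  set Q := (Finset.Iic (N + M, N)).sup (schwartzSeminormFamily ℝ E ℂ) ψ with hQ
  have hQ0 : 0 ≤ Q := apply_nonneg _ _
  have hψ (j : ℕ) (hj : j ≤ N) :
      (1 + ‖t‖) ^ (N + M) * ‖iteratedFDeriv ℝ j ψ t‖ ≤ 2 ^ (N + M) * Q :=
    SchwartzMap.one_add_le_sup_seminorm_apply (𝕜 := ℝ) (m := (N + M, N)) le_rfl hj ψ t
  have hg : ContDiff ℝ ∞ (fun t ↦ G (t - z)) := (G.smooth ⊤).comp (contDiff_id.sub contDiff_const)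
  have h := norm_iteratedFDeriv_mul_le hg (ψ.smooth ⊤) t (n := p) (by exact_mod_cast le_top)
  have hz : (1 + ‖z‖) ^ N ≤ (1 + ‖t - z‖) ^ N * (1 + ‖t‖) ^ N := by
    rw [← mul_pow, norm_sub_rev]
    gcongr
    exact one_add_norm_le_mul z t
  calc _ ≤ ((1 + ‖t - z‖) ^ N * (1 + ‖t‖) ^ N) * (∑ i ∈ Finset.range (p + 1), (p.choose i : ℝ) *
        ‖iteratedFDeriv ℝ i (fun t ↦ G (t - z)) t‖ * ‖iteratedFDeriv ℝ (p - i) ψ t‖) *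
        (1 + ‖t‖) ^ M := by
        gcongr
        exact h
    _ = ∑ i ∈ Finset.range (p + 1), (p.choose i : ℝ) *
        ((1 + ‖t - z‖) ^ N * ‖iteratedFDeriv ℝ i G (t - z)‖) *
        ((1 + ‖t‖) ^ (N + M) * ‖iteratedFDeriv ℝ (p - i) ψ t‖) := by
        rw [Finset.mul_sum, Finset.sum_mul]
        refine Finset.sum_congr rfl fun i _ ↦ ?_
        rw [iteratedFDeriv_comp_sub, pow_add]
        ring
    _ ≤ ∑ i ∈ Finset.range (p + 1), (p.choose i : ℝ) * S * (2 ^ (N + M) * Q) := by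
        refine Finset.sum_le_sum fun i hi ↦ ?_
        have hi' : i ≤ p := by simpa [Nat.lt_succ_iff] using hi
        rw [mul_assoc (p.choose i : ℝ), mul_assoc (p.choose i : ℝ)]
        exact mul_le_mul_of_nonneg_left (mul_le_mul (hS i (hi'.trans hp) _) (hψ _ (by omega))
          (by positivity) hS0) (by positivity)
    _ = 2 ^ p * S * (2 ^ (N + M) * Q) := by
        rw [← Finset.sum_mul, ← Finset.sum_mul]
        congr 2
        exact_mod_cast Nat.sum_range_choose p
    _ ≤ 2 ^ N * S * (2 ^ (N + M) * Q) := by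
        gcongr
        norm_num
    _ = _ := by ring

variable {B}

/-- Decay in position comes from the overlap of window and function, decay in frequency from
smoothness of the windowed function. -/
theorem exists_stftS_bound (hB : IsFourierForm B) (G : 𝓢(E, ℂ)) (N : ℕ) :
    ∃ (C : ℝ) (m : ℕ × ℕ), 0 ≤ C ∧ ∀ (ψ : 𝓢(E, ℂ)) (p : E × E),
      (1 + ‖p.1‖) ^ N * (1 + ‖p.2‖) ^ N * ‖stftS B G ψ p‖ ≤
        C * (Finset.Iic m).sup (schwartzSeminormFamily ℝ E ℂ) ψ := by
  obtain ⟨c, hc0, hc⟩ := hB.nondeg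
  set M := (volume : Measure E).integrablePower
  obtain ⟨A, hA0, hA⟩ := exists_iteratedFDeriv_window_le (conjS G) N M
  have hI := Measure.integrable_pow_neg_integrablePower (volume : Measure E)
  set I := ∫ t : E, (1 + ‖t‖) ^ (-(M : ℝ))
  have hI0 : 0 ≤ I := integral_nonneg fun t ↦ by positivity
  refine ⟨2 ^ N * (1 + c ^ N) * (2 ^ N * ((N + 1) * (A * I))), (N + M, N), by positivity,
    fun ψ p ↦ ?_⟩
  set Q := (Finset.Iic (N + M, N)).sup (schwartzSeminormFamily ℝ E ℂ) ψ with hQ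
  have hQ0 : 0 ≤ Q := apply_nonneg _ _
  set h := mulS (SchwartzMap.compSubConstCLM ℂ p.1 (conjS G)) ψ with hh
  have hint (j : ℕ) (hj : j ≤ N) :
      (1 + ‖p.1‖) ^ N * ∫ t, ‖t‖ ^ 0 * ‖iteratedFDeriv ℝ j h t‖ ≤ A * Q * I := by
    rw [← integral_const_mul, ← integral_const_mul]
    refine integral_mono_of_nonneg (Filter.Eventually.of_forall fun t ↦ by positivity)
      (hI.const_mul _) (Filter.Eventually.of_forall fun t ↦ ?_)
    have ht : (0 : ℝ) < 1 + ‖t‖ := by positivity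
    beta_reduce
    rw [Real.rpow_neg ht.le, Real.rpow_natCast, ← div_eq_mul_inv, le_div_iff₀ (by positivity),
      pow_zero, one_mul]
    exact hA ψ p.1 t j hj
  have hV : stftS B G ψ p =
      VectorFourier.fourierIntegral 𝐞 volume B.flip.toLinearMap₁₂ h p.2 := by
    rw [stftS_eq, VectorFourier.fourierIntegral]
    congr 1 with u
    rw [Circle.smul_def, smul_eq_mul, chr, Real.fourierChar_apply, ← Complex.exp_conj]
    congr 2
    simp [map_ofNat]
    ring
  have key (n : ℕ) (hn : n ≤ N) (v : E) (hv : ‖v‖ ≤ 1) :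
      (1 + ‖p.1‖) ^ N * (|B p.2 v| ^ n * ‖stftS B G ψ p‖) ≤ 2 ^ N * ((N + 1) * (A * Q * I)) := by
    have h1 := VectorFourier.pow_mul_norm_iteratedFDeriv_fourierIntegral_le (L := B.flip)
      (μ := volume) (K := 0) (N := ⊤) (f := h) (h.smooth ⊤)
      (fun k n _ _ ↦ h.integrable_pow_mul_iteratedFDeriv volume k n) (k := 0) (n := n) le_rfl le_top
      v p.2
    rw [norm_iteratedFDeriv_zero, ← hV] at h1
    have h2 : ∑ q ∈ Finset.range (0 + 1) ×ˢ Finset.range (n + 1),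
        (1 + ‖p.1‖) ^ N * ∫ t, ‖t‖ ^ q.1 * ‖iteratedFDeriv ℝ q.2 h t‖ ≤ (n + 1) * (A * Q * I) := by
      refine (Finset.sum_le_card_nsmul _ _ (A * Q * I) fun q hq ↦ ?_).trans ?_
      · simp only [Finset.mem_product, Finset.mem_range] at hq
        have hq1 : q.1 = 0 := by omega
        rw [hq1]
        exact hint _ (by omega)
      · simp
    calc _ ≤ (1 + ‖p.1‖) ^ N * (‖v‖ ^ n * (2 * Real.pi * ‖B.flip‖) ^ 0 * (2 * (0 : ℕ) + 2) ^ n *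
          ∑ q ∈ Finset.range (0 + 1) ×ˢ Finset.range (n + 1),
            ∫ t, ‖t‖ ^ q.1 * ‖iteratedFDeriv ℝ q.2 h t‖) := by
          exact mul_le_mul_of_nonneg_left h1 (by positivity)
      _ = ‖v‖ ^ n * 2 ^ n * ∑ q ∈ Finset.range (0 + 1) ×ˢ Finset.range (n + 1),
            (1 + ‖p.1‖) ^ N * ∫ t, ‖t‖ ^ q.1 * ‖iteratedFDeriv ℝ q.2 h t‖ := by
          rw [← Finset.mul_sum]
          push_cast
          ring
      _ ≤ 1 * 2 ^ N * ((N + 1) * (A * Q * I)) := by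
          have hvn : ‖v‖ ^ n ≤ 1 := pow_le_one₀ (norm_nonneg _) hv
          have h2n : (2 : ℝ) ^ n ≤ 2 ^ N := pow_le_pow_right₀ (by norm_num) hn
          have h3 : ((n : ℝ) + 1) * (A * Q * I) ≤ (N + 1) * (A * Q * I) := by gcongr
          have h4 := h2.trans h3
          gcongr
      _ = _ := by ring
  -- Nondegeneracy supplies a direction in which the form sees the full size of the frequency; the
  -- bounds for `0` and for `N` derivatives in that direction are then added.
  obtain ⟨v, hv, hv'⟩ := hc p.2
  have h0 := key 0 (Nat.zero_le _) v hv
  have hN := key N le_rfl v hv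
  rw [pow_zero, one_mul] at h0
  have hpow : (1 + ‖p.2‖) ^ N ≤ 2 ^ N * (1 + c ^ N * |B p.2 v| ^ N) := by
    rw [← mul_pow c]
    have : (1 + ‖p.2‖) ^ N ≤ 2 ^ N * (1 + ‖p.2‖ ^ N) := by
      rcases le_total ‖p.2‖ 1 with h | h
      · calc (1 + ‖p.2‖) ^ N ≤ 2 ^ N := by gcongr; linarith
          _ ≤ _ := le_mul_of_one_le_right (by positivity) (by simp)
      · calc (1 + ‖p.2‖) ^ N ≤ (2 * ‖p.2‖) ^ N := by gcongr; linarith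
          _ = 2 ^ N * ‖p.2‖ ^ N := mul_pow _ _ _
          _ ≤ _ := by gcongr; linarith
    refine this.trans ?_
    gcongr
  set a := (1 + ‖p.1‖) ^ N
  set w := ‖stftS B G ψ p‖
  calc a * (1 + ‖p.2‖) ^ N * w ≤ a * (2 ^ N * (1 + c ^ N * |B p.2 v| ^ N)) * w := by
        gcongr
    _ = 2 ^ N * (a * w + c ^ N * (a * (|B p.2 v| ^ N * w))) := by ring
    _ ≤ 2 ^ N * (2 ^ N * ((N + 1) * (A * Q * I)) +
        c ^ N * (2 ^ N * ((N + 1) * (A * Q * I)))) := by gcongr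
    _ = _ := by ring

theorem integrable_prod_one_add :
    Integrable fun p : E × E ↦
      (1 + ‖p.1‖) ^ (-((volume : Measure E).integrablePower : ℝ)) *
        (1 + ‖p.2‖) ^ (-((volume : Measure E).integrablePower : ℝ)) :=
  (Measure.integrable_pow_neg_integrablePower (volume : Measure E)).mul_prod
    (Measure.integrable_pow_neg_integrablePower (volume : Measure E))

theorem exists_weighted_stftS_le (hB : IsFourierForm B) (G : 𝓢(E, ℂ)) (k : ℕ) :
    ∃ (C : ℝ) (m : ℕ × ℕ), 0 ≤ C ∧ ∀ (ψ : 𝓢(E, ℂ)) (p : E × E),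
      (1 + ‖p.1‖) ^ k * (1 + ‖p.2‖) ^ k * ‖stftS B G ψ p‖ ≤
        C * (Finset.Iic m).sup (schwartzSeminormFamily ℝ E ℂ) ψ *
          ((1 + ‖p.1‖) ^ (-((volume : Measure E).integrablePower : ℝ)) *
          (1 + ‖p.2‖) ^ (-((volume : Measure E).integrablePower : ℝ))) := by
  obtain ⟨C, m, hC0, hC⟩ := exists_stftS_bound hB G (k + (volume : Measure E).integrablePower)
  refine ⟨C, m, hC0, fun ψ p ↦ ?_⟩
  have h1 : (0 : ℝ) < 1 + ‖p.1‖ := by positivity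
  have h2 : (0 : ℝ) < 1 + ‖p.2‖ := by positivity
  rw [Real.rpow_neg h1.le, Real.rpow_natCast, Real.rpow_neg h2.le, Real.rpow_natCast,
    ← mul_inv, ← div_eq_mul_inv, le_div_iff₀ (by positivity)]
  refine le_trans (le_of_eq ?_) (hC ψ p)
  rw [pow_add, pow_add]
  ring

theorem integrable_weighted_stftS (hB : IsFourierForm B) (G ψ : 𝓢(E, ℂ)) (k : ℕ) :
    Integrable fun p : E × E ↦ (1 + ‖p.1‖) ^ k * (1 + ‖p.2‖) ^ k * ‖stftS B G ψ p‖ := by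
  obtain ⟨C, m, hC0, hC⟩ := exists_weighted_stftS_le hB G k
  refine (integrable_prod_one_add.const_mul
    (C * (Finset.Iic m).sup (schwartzSeminormFamily ℝ E ℂ) ψ)).mono' ?_
    (Filter.Eventually.of_forall fun p ↦ ?_)
  · have := continuous_stftS B G ψ
    have h : Continuous fun p : E × E ↦
      (1 + ‖p.1‖) ^ k * (1 + ‖p.2‖) ^ k * ‖stftS B G ψ p‖ := by fun_prop
    exact h.aestronglyMeasurable
  · rw [Real.norm_of_nonneg (by positivity)]
    exact hC ψ p

theorem integrable_stftS (hB : IsFourierForm B) (G ψ : 𝓢(E, ℂ)) :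
    Integrable (stftS B G ψ) :=
  (integrable_weighted_stftS hB G ψ 0).mono' (continuous_stftS B G ψ).aestronglyMeasurable
    (Filter.Eventually.of_forall fun p ↦ by simp)

/-- Fubini: for fixed `z`, Fourier inversion in the frequency returns `conj (G (t - z)) * G' (t - z)
* ψ t`, and integration over `z` produces the inner product of the windows. -/
theorem integral_stftS_mul_tf (hB : IsFourierForm B) (G G' ψ : 𝓢(E, ℂ)) (t : E) :
    ∫ p : E × E, stftS B G ψ p * tf B p.1 p.2 G' t = (∫ u, conj (G u) * G' u) * ψ t := by
  have hi : Integrable fun p : E × E ↦ stftS B G ψ p * tf B p.1 p.2 G' t := by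
    refine (integrable_stftS hB G ψ).mul_bdd (c := SchwartzMap.seminorm ℝ 0 0 G') ?_
      (Filter.Eventually.of_forall fun p ↦ ?_)
    · have : Continuous fun p : E × E ↦ tf B p.1 p.2 G' t := by
        simp only [tf_apply]
        exact ((continuous_chr B).comp (continuous_snd.prodMk continuous_const)).mul
          (G'.continuous.comp (by fun_prop))
      exact this.aestronglyMeasurable
    · rw [norm_tf_apply]
      exact SchwartzMap.norm_le_seminorm ℝ G' _
  rw [Measure.volume_eq_prod, integral_prod _ (by rwa [← Measure.volume_eq_prod])]
  have h1 (z : E) : ∫ ζ, stftS B G ψ (z, ζ) * tf B z ζ G' t =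
      conj (G (t - z)) * G' (t - z) * ψ t := by
    have h2 := hB.inversion (mulS (SchwartzMap.compSubConstCLM ℂ z (conjS G)) ψ) t
    simp only [← stftS_eq B G ψ (z, _)] at h2
    calc _ = ∫ ζ, G' (t - z) * (chr B ζ t * stftS B G ψ (z, ζ)) := by
          congr 1 with ζ
          rw [tf_apply]
          ring
      _ = _ := by
          rw [integral_const_mul]
          have h3 : ∀ ζ, stftS B G ψ (z, ζ) = ∫ u, conj (chr B ζ u) *
            mulS (SchwartzMap.compSubConstCLM ℂ z (conjS G)) ψ u := fun ζ ↦ stftS_eq B G ψ (z, ζ)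
          simp only [h3]
          rw [hB.inversion]
          simp
          ring
  simp only [h1]
  rw [integral_mul_const]
  congr 1
  exact integral_sub_left_eq_self (fun u ↦ conj (G u) * G' u) volume t

/-- Reconstruction of a Schwartz function from its short-time Fourier transform, under an arbitrary
continuous functional. -/
theorem map_reconstruction (hB : IsFourierForm B) (G G' ψ : 𝓢(E, ℂ)) (T : 𝓢(E, ℂ) →L[ℝ] ℂ) :
    Integrable (fun p : E × E ↦ T (stftS B G ψ p • tf B p.1 p.2 G')) ∧
      T ((∫ u, conj (G u) * G' u) • ψ) = ∫ p : E × E, T (stftS B G ψ p • tf B p.1 p.2 G') := by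
  refine map_eq_integral ((continuous_stftS B G ψ).smul (continuous_tf B G')) (fun k n ↦ ?_)
    (fun e ↦ ?_) T
  · obtain ⟨C, hC0, hC⟩ := exists_seminorm_tf_le B G' k n
    refine ((integrable_weighted_stftS hB G ψ (k + n)).const_mul C).mono' ?_
      (Filter.Eventually.of_forall fun p ↦ ?_)
    · exact (((schwartz_withSeminorms ℝ E ℂ).continuous_seminorm (k, n)).comp
        ((continuous_stftS B G ψ).smul (continuous_tf B G'))).aestronglyMeasurable
    · rw [Real.norm_of_nonneg (apply_nonneg _ _)]
      have h1 : SchwartzMap.seminorm ℝ k n (stftS B G ψ p • tf B p.1 p.2 G') =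
          ‖stftS B G ψ p‖ * SchwartzMap.seminorm ℝ k n (tf B p.1 p.2 G') :=
        map_smul_eq_mul (SchwartzMap.seminorm ℂ k n) _ _
      refine h1.le.trans ?_
      calc _ ≤ ‖stftS B G ψ p‖ * (C * ((1 + ‖p.1‖) ^ k * (1 + ‖p.2‖) ^ n)) := by
            gcongr; exact hC _ _
        _ ≤ ‖stftS B G ψ p‖ * (C * ((1 + ‖p.1‖) ^ (k + n) * (1 + ‖p.2‖) ^ (k + n))) := by
            gcongr <;> simp
        _ = _ := by ring
  · rw [_root_.smul_apply, smul_eq_mul, ← integral_stftS_mul_tf hB]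
    rfl

end STFT

/-! ### Independence of the mixed norms from the window -/

section WindowChange

variable {E : Type} [NormedAddCommGroup E] [NormedSpace ℝ E] [FiniteDimensional ℝ E]
  [MeasureSpace E] [BorelSpace E] [(volume : Measure E).IsAddHaarMeasure]
  {B : E →L[ℝ] E →L[ℝ] ℝ}

instance : (volume : Measure (E × E)).IsAddHaarMeasure :=
  inferInstanceAs ((volume : Measure E).prod (volume : Measure E)).IsAddHaarMeasure

/-- Translating the integration variable combines the two shifts into one and leaves only unimodular
factors. -/
theorem norm_stftS_tf (G g : 𝓢(E, ℂ)) (q p : E × E) :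
    ‖stftS B G (tf B q.1 q.2 g) p‖ = ‖stftS B G g (p - q)‖ := by
  have h : stftS B G (tf B q.1 q.2 g) p =
      (conj (chr B p.2 q.1) * chr B q.2 q.1) * stftS B G g (p - q) := by
    rw [stftS, stftS, ← integral_const_mul,
      ← integral_add_right_eq_self (fun t ↦ conj (tf B p.1 p.2 G t) * tf B q.1 q.2 g t) q.1]
    congr 1 with t
    simp only [tf_apply, Prod.fst_sub, Prod.snd_sub, chr_add_right, chr_sub_left, map_mul,
      RingHomCompTriple.comp_apply, RingHom.id_apply]
    rw [add_sub_cancel_right, show t - (p.1 - q.1) = t + q.1 - p.1 by abel]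
    ring
  rw [h, norm_mul, norm_mul, RCLike.norm_conj, norm_chr, norm_chr, one_mul, one_mul]

theorem integral_conj_mul_self_ne_zero {g : 𝓢(E, ℂ)} (hg : g ≠ 0) :
    ∫ u, conj (g u) * g u ≠ 0 := by
  have h1 : ∀ u, conj (g u) * g u = ((‖g u‖ ^ 2 : ℝ) : ℂ) := fun u ↦ by
    rw [mul_comm, Complex.mul_conj, Complex.normSq_eq_norm_sq]
  simp only [h1]
  rw [integral_complex_ofReal, Ne, Complex.ofReal_eq_zero]
  obtain ⟨t, ht⟩ : ∃ t, g t ≠ 0 := by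
    by_contra! h
    exact hg (by ext t; simpa using h t)
  have hc : Continuous fun u ↦ ‖g u‖ ^ 2 := by have := g.continuous; fun_prop
  have hint : Integrable fun u ↦ ‖g u‖ ^ 2 := by
    have := ((mulS (conjS g) g).integrable (μ := volume)).norm
    refine this.congr (Filter.Eventually.of_forall fun u ↦ ?_)
    simp [pow_two]
  exact (integral_pos_of_integrable_nonneg_nonzero hc hint (fun u ↦ by positivity)
    (by simpa using ht : ‖g t‖ ^ 2 ≠ 0)).ne'

/-- Pointwise domination of one short-time Fourier transform by another. -/
theorem enorm_map_tf_le (hB : IsFourierForm B) {g₀ : 𝓢(E, ℂ)} (hg₀ : g₀ ≠ 0) (g₁ : 𝓢(E, ℂ))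
    (T : 𝓢(E, ℂ) →L[ℝ] ℂ) (hT : ∀ (c : ℂ) (φ : 𝓢(E, ℂ)), ‖T (c • φ)‖ = ‖c‖ * ‖T φ‖) :
    ∃ C : ℝ≥0∞, C ≠ ⊤ ∧ ∀ q : E × E, ‖T (tf B q.1 q.2 g₁)‖ₑ ≤
      C * ∫⁻ r : E × E, ‖stftS B g₀ g₁ r‖ₑ * ‖T (tf B (q + r).1 (q + r).2 g₀)‖ₑ := by
  set c := ∫ u, conj (g₀ u) * g₀ u with hc
  have hc0 : c ≠ 0 := integral_conj_mul_self_ne_zero hg₀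
  have hT' (c : ℂ) (φ : 𝓢(E, ℂ)) : ‖T (c • φ)‖ₑ = ‖c‖ₑ * ‖T φ‖ₑ := by
    rw [← ofReal_norm, hT, ENNReal.ofReal_mul (norm_nonneg _), ofReal_norm,
      ofReal_norm]
  refine ⟨‖c‖ₑ⁻¹, by simpa using hc0, fun q ↦ ?_⟩
  -- The shifted window `g₁` is expanded in shifts of `g₀`; the coefficients depend, up to phase,
  -- only on the difference of the phase-space points.
  have h := (map_reconstruction hB g₀ g₀ (tf B q.1 q.2 g₁) T).2
  have h1 : ‖c‖ₑ * ‖T (tf B q.1 q.2 g₁)‖ₑ ≤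
      ∫⁻ p : E × E, ‖stftS B g₀ g₁ (p - q)‖ₑ * ‖T (tf B p.1 p.2 g₀)‖ₑ := by
    rw [← hT', h]
    refine (enorm_integral_le_lintegral_enorm _).trans (le_of_eq ?_)
    congr 1 with p
    rw [hT', ← ofReal_norm (stftS B g₀ (tf B q.1 q.2 g₁) p), norm_stftS_tf,
      ofReal_norm]
  rw [← ENNReal.div_eq_inv_mul, ENNReal.le_div_iff_mul_le (by simp [hc0]) (by simp), mul_comm]
  refine h1.trans (le_of_eq ?_)
  rw [← lintegral_add_left_eq_self _ q]
  simp only [add_sub_cancel_left]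

/-- Weighted Young inequality for a moderate weight. -/
theorem lintegral_weight_convolution_le {Y : Type} [MeasureSpace Y] [SFinite (volume : Measure Y)]
    {v N₀ N₁ : E → ℝ≥0∞} {Θ : Y → ℝ≥0∞} {ρ : Y → E}
    {C K : ℝ≥0∞} (hv : Measurable v) (hN₀ : Measurable N₀) (hΘ : Measurable Θ) (hρ : Measurable ρ)
    (hK : ∀ x y, v (x - y) ≤ K * (v x * v y))
    (h : ∀ x, N₁ x ≤ C * ∫⁻ r, Θ r * N₀ (x + ρ r)) :
    ∫⁻ x, N₁ x * v x ≤ C * (K * ((∫⁻ r, Θ r * v (ρ r)) * ∫⁻ x, N₀ x * v x)) := by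
  calc ∫⁻ x, N₁ x * v x ≤ ∫⁻ x, C * ∫⁻ r, Θ r * N₀ (x + ρ r) * v x := by
        refine lintegral_mono fun x ↦ ?_
        rw [lintegral_mul_const _ (by fun_prop), ← mul_assoc]
        gcongr
        exact h x
    _ = C * ∫⁻ r, ∫⁻ x, Θ r * N₀ (x + ρ r) * v x := by
        rw [lintegral_const_mul _ (by fun_prop), lintegral_lintegral_swap (by fun_prop)]
    _ ≤ C * ∫⁻ r, ∫⁻ x, K * ((Θ r * v (ρ r)) * (N₀ x * v x)) := by
        refine mul_le_mul_right (lintegral_mono fun r ↦ ?_) _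
        -- The translation is moved from the function to the weight, where moderateness separates it
        -- off.
        rw [← lintegral_sub_right_eq_self _ (ρ r)]
        refine lintegral_mono fun x ↦ ?_
        rw [sub_add_cancel]
        calc _ ≤ Θ r * N₀ x * (K * (v x * v (ρ r))) := by gcongr; exact hK _ _
          _ = _ := by ring
    _ = _ := by
        have h1 (r : Y) : ∫⁻ x, K * ((Θ r * v (ρ r)) * (N₀ x * v x)) =
            K * ((Θ r * v (ρ r)) * ∫⁻ x, N₀ x * v x) := by
          rw [lintegral_const_mul _ (by fun_prop), lintegral_const_mul _ (by fun_prop)]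
        simp only [h1]
        rw [lintegral_const_mul _ (by fun_prop), lintegral_mul_const _ (by fun_prop)]

theorem continuous_enorm_map_tf (g : 𝓢(E, ℂ)) (T : 𝓢(E, ℂ) →L[ℝ] ℂ) :
    Continuous fun p : E × E ↦ ‖T (tf B p.1 p.2 g)‖ₑ :=
  (T.continuous.comp (continuous_tf B g)).enorm

/-- The supremum is uncountable, but a supremum of continuous functions is lower semicontinuous. -/
theorem measurable_iSup_snd (g : 𝓢(E, ℂ)) (T : 𝓢(E, ℂ) →L[ℝ] ℂ) :
    Measurable fun z : E ↦ ⨆ ζ : E, ‖T (tf B z ζ g)‖ₑ :=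
  (lowerSemicontinuous_iSup fun _ ↦ ((continuous_enorm_map_tf (B := B) g T).comp
    (continuous_id.prodMk continuous_const)).lowerSemicontinuous).measurable

theorem measurable_iSup_fst (g : 𝓢(E, ℂ)) (T : 𝓢(E, ℂ) →L[ℝ] ℂ) :
    Measurable fun ζ : E ↦ ⨆ z : E, ‖T (tf B z ζ g)‖ₑ :=
  (lowerSemicontinuous_iSup fun _ ↦ ((continuous_enorm_map_tf (B := B) g T).comp
    (continuous_const.prodMk continuous_id)).lowerSemicontinuous).measurable

theorem lintegral_stftS_mul_lt_top {X : Type} [NormedAddCommGroup X] (hB : IsFourierForm B)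
    (G ψ : 𝓢(E, ℂ)) {v : X → ℝ≥0∞} {A : ℝ} {k : ℕ}
    (hv : ∀ x, v x ≤ ENNReal.ofReal (A * (1 + ‖x‖) ^ k)) {ρ : E × E → X} (hρ : ∀ r, ‖ρ r‖ ≤ ‖r‖) :
    ∫⁻ r, ‖stftS B G ψ r‖ₑ * v (ρ r) < ⊤ := by
  have h := (integrable_weighted_stftS hB G ψ k).const_mul |A|
  refine lt_of_le_of_lt (lintegral_mono fun r ↦ ?_) h.lintegral_lt_top
  rw [← ofReal_norm]
  refine (mul_le_mul_right (hv _) _).trans ?_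
  rw [← ENNReal.ofReal_mul (norm_nonneg _)]
  refine ENNReal.ofReal_le_ofReal ?_
  have h1 : 1 + ‖ρ r‖ ≤ (1 + ‖r.1‖) * (1 + ‖r.2‖) := by
    have h2 := (hρ r).trans (show ‖r‖ ≤ ‖r.1‖ + ‖r.2‖ by
      rw [Prod.norm_def]; exact max_le (by simp) (by simp))
    nlinarith [mul_nonneg (norm_nonneg r.1) (norm_nonneg r.2)]
  calc _ ≤ ‖stftS B G ψ r‖ * (|A| * ((1 + ‖r.1‖) * (1 + ‖r.2‖)) ^ k) := by
        gcongr; exact le_abs_self A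
    _ = _ := by rw [mul_pow]; ring

/-- Finiteness of the weighted mixed norm `L^1_v(L^∞)` does not depend on the window. -/
theorem lintegral_iSup_snd_lt_top (hB : IsFourierForm B) {g₀ : 𝓢(E, ℂ)} (hg₀ : g₀ ≠ 0)
    (g₁ : 𝓢(E, ℂ)) (T : 𝓢(E, ℂ) →L[ℝ] ℂ)
    (hT : ∀ (c : ℂ) (φ : 𝓢(E, ℂ)), ‖T (c • φ)‖ = ‖c‖ * ‖T φ‖) {v : E → ℝ≥0∞} {K : ℝ≥0∞}
    {A : ℝ} {k : ℕ} (hvm : Measurable v) (hK' : K ≠ ⊤)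
    (hK : ∀ x y, v (x - y) ≤ K * (v x * v y))
    (hv : ∀ x, v x ≤ ENNReal.ofReal (A * (1 + ‖x‖) ^ k))
    (h : ∫⁻ z, (⨆ ζ, ‖T (tf B z ζ g₀)‖ₑ) * v z < ⊤) :
    ∫⁻ z, (⨆ ζ, ‖T (tf B z ζ g₁)‖ₑ) * v z < ⊤ := by
  obtain ⟨C, hC, hCle⟩ := enorm_map_tf_le hB hg₀ g₁ T hT
  -- After the supremum over frequencies only the position part of the shift remains, hence the
  -- choice of `ρ`.
  refine lt_of_le_of_lt (lintegral_weight_convolution_le (C := C)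
    (Θ := fun r ↦ ‖stftS B g₀ g₁ r‖ₑ) (ρ := Prod.fst) hvm (measurable_iSup_snd (B := B) g₀ T)
    (continuous_stftS B g₀ g₁).enorm.measurable measurable_fst hK fun z ↦ iSup_le fun ζ ↦ ?_) ?_
  · refine (hCle (z, ζ)).trans ?_
    gcongr with r
    exact le_iSup (fun ζ ↦ ‖T (tf B (z + r.1) ζ g₀)‖ₑ) (ζ + r.2)
  · exact ENNReal.mul_lt_top hC.lt_top (ENNReal.mul_lt_top hK'.lt_top (ENNReal.mul_lt_top
      (lintegral_stftS_mul_lt_top hB g₀ g₁ hv norm_fst_le) h))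

/-- Finiteness of the weighted mixed norm in the other order does not depend on the window. -/
theorem lintegral_iSup_fst_lt_top (hB : IsFourierForm B) {g₀ : 𝓢(E, ℂ)} (hg₀ : g₀ ≠ 0)
    (g₁ : 𝓢(E, ℂ)) (T : 𝓢(E, ℂ) →L[ℝ] ℂ)
    (hT : ∀ (c : ℂ) (φ : 𝓢(E, ℂ)), ‖T (c • φ)‖ = ‖c‖ * ‖T φ‖) {v : E → ℝ≥0∞} {K : ℝ≥0∞}
    {A : ℝ} {k : ℕ} (hvm : Measurable v) (hK' : K ≠ ⊤)
    (hK : ∀ x y, v (x - y) ≤ K * (v x * v y))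
    (hv : ∀ x, v x ≤ ENNReal.ofReal (A * (1 + ‖x‖) ^ k))
    (h : ∫⁻ ζ, (⨆ z, ‖T (tf B z ζ g₀)‖ₑ) * v ζ < ⊤) :
    ∫⁻ ζ, (⨆ z, ‖T (tf B z ζ g₁)‖ₑ) * v ζ < ⊤ := by
  obtain ⟨C, hC, hCle⟩ := enorm_map_tf_le hB hg₀ g₁ T hT
  refine lt_of_le_of_lt (lintegral_weight_convolution_le (C := C)
    (Θ := fun r ↦ ‖stftS B g₀ g₁ r‖ₑ) (ρ := Prod.snd) hvm (measurable_iSup_fst (B := B) g₀ T)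
    (continuous_stftS B g₀ g₁).enorm.measurable measurable_snd hK fun ζ ↦ iSup_le fun z ↦ ?_) ?_
  · refine (hCle (z, ζ)).trans ?_
    gcongr with r
    exact le_iSup (fun z ↦ ‖T (tf B z (ζ + r.2) g₀)‖ₑ) (z + r.1)
  · exact ENNReal.mul_lt_top hC.lt_top (ENNReal.mul_lt_top hK'.lt_top (ENNReal.mul_lt_top
      (lintegral_stftS_mul_lt_top hB g₀ g₁ hv norm_snd_le) h))

end WindowChange

/-! ### The duality pairings on Euclidean space and on phase space -/

section Forms

/-- The inner product as a bilinear form. -/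
def innerForm (F : Type) [NormedAddCommGroup F] [InnerProductSpace ℝ F] : F →L[ℝ] F →L[ℝ] ℝ :=
  innerSL ℝ

@[simp]
theorem innerForm_apply {F : Type} [NormedAddCommGroup F] [InnerProductSpace ℝ F] (x y : F) :
    innerForm F x y = ⟪x, y⟫_ℝ := rfl

theorem isFourierForm_innerForm {F : Type} [NormedAddCommGroup F] [InnerProductSpace ℝ F]
    [FiniteDimensional ℝ F] [MeasurableSpace F] [BorelSpace F] :
    IsFourierForm (innerForm F) where
  nondeg := by
    refine ⟨1, zero_le_one, fun ζ ↦ ⟨(‖ζ‖⁻¹ : ℝ) • ζ, ?_, ?_⟩⟩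
    · rw [norm_smul, norm_inv, norm_norm]
      exact inv_mul_le_one
    · rw [innerForm_apply, inner_smul_right, real_inner_self_eq_norm_sq, one_mul]
      rcases eq_or_ne ‖ζ‖ 0 with h | h
      · simp [h]
      · rw [pow_two, inv_mul_cancel_left₀ h, abs_norm]
  inversion ψ t := by
    have h : 𝓕⁻ (𝓕 ψ) t = ψ t := by rw [FourierTransform.fourierInv_fourier_eq]
    rw [SchwartzMap.fourierInv_coe, SchwartzMap.fourier_coe, Real.fourierInv_eq'] at h
    rw [← h]
    congr 1 with ζ
    rw [Real.fourier_eq', smul_eq_mul, chr]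
    congr 1
    · congr 1
      simp
      ring
    · congr 1 with u
      rw [chr, ← Complex.exp_conj, smul_eq_mul]
      congr 2
      simp [map_ofNat, real_inner_comm]
      ring

/-- The form `(ζ, t) ↦ ζ₁ ⬝ t₁ + ζ₂ ⬝ t₂` on phase space. -/
def phaseForm (d : ℕ) : Phase d →L[ℝ] Phase d →L[ℝ] ℝ :=
  (innerForm (Conf d)).bilinearComp (ContinuousLinearMap.fst ℝ (Conf d) (Conf d))
    (ContinuousLinearMap.fst ℝ (Conf d) (Conf d)) + sndForm d

@[simp]
theorem phaseForm_apply {d : ℕ} (ζ t : Phase d) :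
    phaseForm d ζ t = ⟪ζ.1, t.1⟫_ℝ + ⟪ζ.2, t.2⟫_ℝ := rfl

/-- Phase space carries the maximum norm, so inversion is transported from the Euclidean product
along the measure-preserving identification. For nondegeneracy it suffices to test the component in
which the maximum is attained. -/
theorem isFourierForm_phaseForm (d : ℕ) : IsFourierForm (phaseForm d) where
  nondeg := by
    obtain ⟨c, hc0, hc⟩ := (isFourierForm_innerForm (F := Conf d)).nondeg
    refine ⟨c, hc0, fun ζ ↦ ?_⟩
    rcases max_choice ‖ζ.1‖ ‖ζ.2‖ with h | h
    · obtain ⟨v, hv, hv'⟩ := hc ζ.1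
      refine ⟨(v, 0), by simpa [Prod.norm_def] using hv, ?_⟩
      rw [Prod.norm_def, h]
      simpa using hv'
    · obtain ⟨v, hv, hv'⟩ := hc ζ.2
      refine ⟨(0, v), by simpa [Prod.norm_def] using hv, ?_⟩
      rw [Prod.norm_def, h]
      simpa using hv'
  inversion ψ t := by
    let e := WithLp.prodContinuousLinearEquiv 2 ℝ (Conf d) (Conf d)
    have he : MeasurePreserving e := WithLp.volume_preserving_ofLp (Conf d) (Conf d)
    have hm : MeasurableEmbedding e := e.toHomeomorph.measurableEmbedding
    have h := (isFourierForm_innerForm (F := WithLp 2 (Conf d × Conf d))).inversion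
      (SchwartzMap.compCLMOfContinuousLinearEquiv ℂ e ψ) (e.symm t)
    have hchr (x : WithLp 2 (Conf d × Conf d)) (y : WithLp 2 (Conf d × Conf d)) :
        chr (innerForm _) x y = chr (phaseForm d) (e x) (e y) := by
      simp only [chr, innerForm_apply, phaseForm_apply, WithLp.prod_inner_apply]
      rfl
    simp only [hchr, SchwartzMap.compCLMOfContinuousLinearEquiv_apply, Function.comp_apply,
      ContinuousLinearEquiv.apply_symm_apply] at h
    rw [← h, ← he.integral_comp hm]
    congr 1 with x
    rw [← he.integral_comp hm]

end Forms

/-! ### Moderateness and growth of the weight -/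

section Weight

variable {d : ℕ} {s : ℝ}

/-- The weight `v_s` with values in `[0, ∞]`. -/
def ew (s : ℝ) (z : Phase d) : ℝ≥0∞ := ENNReal.ofReal (polyWeight s z)

theorem one_le_polyWeight (hs : 0 ≤ s) (z : Phase d) : 1 ≤ polyWeight s z :=
  Real.one_le_rpow (by nlinarith [sq_nonneg ‖z.1‖, sq_nonneg ‖z.2‖]) (by positivity)

theorem one_le_ew (hs : 0 ≤ s) (z : Phase d) : 1 ≤ ew s z := by
  rw [ew, ENNReal.one_le_ofReal]
  exact one_le_polyWeight hs z

@[fun_prop]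
theorem measurable_ew (s : ℝ) : Measurable (ew s : Phase d → ℝ≥0∞) := by
  have : Measurable fun z : Phase d ↦ (1 + (‖z.1‖ ^ 2 + ‖z.2‖ ^ 2)) ^ (s / 2) := by fun_prop
  exact this.ennreal_ofReal

theorem ew_le_mul_of_le (hs : 0 ≤ s) {x : Phase d} {K a : ℝ} (hK : 0 ≤ K) (ha : 0 ≤ a)
    (h : 1 + (‖x.1‖ ^ 2 + ‖x.2‖ ^ 2) ≤ K * a) :
    ew s x ≤ ENNReal.ofReal (K ^ (s / 2)) * ENNReal.ofReal (a ^ (s / 2)) := by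
  rw [← ENNReal.ofReal_mul (by positivity), ← Real.mul_rpow hK ha]
  exact ENNReal.ofReal_le_ofReal (Real.rpow_le_rpow (by positivity) h (by positivity))

/-- Rests on `1 + |x - y|² ≤ 2 (1 + |x|²)(1 + |y|²)`. -/
theorem ew_sub_le (hs : 0 ≤ s) (x y : Phase d) :
    ew s (x - y) ≤ ENNReal.ofReal (2 ^ (s / 2)) * (ew s x * ew s y) := by
  refine (ew_le_mul_of_le hs zero_le_two
    (a := (1 + (‖x.1‖ ^ 2 + ‖x.2‖ ^ 2)) * (1 + (‖y.1‖ ^ 2 + ‖y.2‖ ^ 2))) (by positivity) ?_).trans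
    (le_of_eq ?_)
  · have h (a b : Conf d) : ‖a - b‖ ^ 2 ≤ 2 * (‖a‖ ^ 2 + ‖b‖ ^ 2) := by
      have := norm_sub_le a b
      nlinarith [sq_nonneg (‖a‖ - ‖b‖), norm_nonneg (a - b), norm_nonneg a, norm_nonneg b]
    have h1 := h x.1 y.1
    have h2 := h x.2 y.2
    simp only [Prod.fst_sub, Prod.snd_sub]
    nlinarith [mul_nonneg (add_nonneg (sq_nonneg ‖x.1‖) (sq_nonneg ‖x.2‖))
      (add_nonneg (sq_nonneg ‖y.1‖) (sq_nonneg ‖y.2‖))]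
  · rw [Real.mul_rpow (by positivity) (by positivity), ENNReal.ofReal_mul (by positivity)]
    rfl

theorem exists_ew_le_pow (hs : 0 ≤ s) : ∃ (A : ℝ) (k : ℕ), ∀ x : Phase d,
    ew s x ≤ ENNReal.ofReal (A * (1 + ‖x‖) ^ k) := by
  refine ⟨3 ^ (s / 2), ⌈s⌉₊, fun x ↦ ?_⟩
  refine (ew_le_mul_of_le hs (by norm_num : (0 : ℝ) ≤ 3) (a := (1 + ‖x‖) ^ 2) (by positivity)
    ?_).trans ?_
  · have h1 : ‖x.1‖ ≤ ‖x‖ := norm_fst_le x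
    have h2 : ‖x.2‖ ≤ ‖x‖ := norm_snd_le x
    nlinarith [norm_nonneg x.1, norm_nonneg x.2]
  · rw [← ENNReal.ofReal_mul (by positivity)]
    refine ENNReal.ofReal_le_ofReal ?_
    gcongr
    rw [← Real.rpow_natCast, ← Real.rpow_mul (by positivity), ← Real.rpow_natCast]
    refine Real.rpow_le_rpow_of_exponent_le (by linarith [norm_nonneg x]) ?_
    push_cast
    linarith [Nat.le_ceil s]

end Weight

/-! ### The two symbol classes as subspaces, independent of the window -/

section Membership

variable {d : ℕ} {s : ℝ}

theorem tfShift_eq_tf (z ζ : Phase d) (g : 𝓢(Phase d, ℂ)) :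
    tfShift z ζ g = tf (phaseForm d) z ζ g := by
  ext t
  rw [tfShift_apply, tf_apply, chr, phaseForm_apply]

/-- The pairing with a tempered distribution as a real-linear functional. -/
def pairCLM (σ : 𝓢'(Phase d, ℂ)) : 𝓢(Phase d, ℂ) →L[ℝ] ℂ :=
  (show 𝓢(Phase d, ℂ) →L[ℂ] ℂ from σ).restrictScalars ℝ |>.comp
    (SchwartzMap.postcompCLM (𝕜 := ℝ) (Complex.conjCLE : ℂ →L[ℝ] ℂ))

@[simp]
theorem pairCLM_apply (σ : 𝓢'(Phase d, ℂ)) (φ : 𝓢(Phase d, ℂ)) : pairCLM σ φ = pair σ φ := rfl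

theorem conjS_smul {E : Type} [NormedAddCommGroup E] [NormedSpace ℝ E] (c : ℂ) (φ : 𝓢(E, ℂ)) :
    conjS (c • φ) = conj c • conjS φ := by
  ext t; simp

@[simp]
theorem conjS_conjS {E : Type} [NormedAddCommGroup E] [NormedSpace ℝ E] (φ : 𝓢(E, ℂ)) :
    conjS (conjS φ) = φ := by
  ext t; simp

theorem pair_smul (σ : 𝓢'(Phase d, ℂ)) (c : ℂ) (φ : 𝓢(Phase d, ℂ)) :
    pair σ (c • φ) = conj c * pair σ φ := by
  rw [pair, conjS_smul, map_smul, smul_eq_mul, pair]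

theorem norm_pair_smul (σ : 𝓢'(Phase d, ℂ)) (c : ℂ) (φ : 𝓢(Phase d, ℂ)) :
    ‖pairCLM σ (c • φ)‖ = ‖c‖ * ‖pairCLM σ φ‖ := by
  rw [pairCLM_apply, pair_smul, norm_mul, RCLike.norm_conj, pairCLM_apply]

theorem stft_eq (g : 𝓢(Phase d, ℂ)) (σ : 𝓢'(Phase d, ℂ)) (z ζ : Phase d) :
    stft g σ z ζ = pairCLM σ (tf (phaseForm d) z ζ g) := by
  rw [stft, tfShift_eq_tf, pairCLM_apply]

theorem MemSjostrand.of_window (hs : 0 ≤ s) {g₀ : 𝓢(Phase d, ℂ)} (hg₀ : g₀ ≠ 0)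
    (g₁ : 𝓢(Phase d, ℂ)) {σ : 𝓢'(Phase d, ℂ)} (h : MemSjostrand g₀ s σ) :
    MemSjostrand g₁ s σ := by
  obtain ⟨A, k, hA⟩ := exists_ew_le_pow (d := d) hs
  simp only [MemSjostrand, stft_eq] at h ⊢
  exact lintegral_iSup_fst_lt_top (isFourierForm_phaseForm d) hg₀ g₁ (pairCLM σ)
    (norm_pair_smul σ) (measurable_ew s) ENNReal.ofReal_ne_top (ew_sub_le hs) hA h

theorem MemAmalgam.of_window (hs : 0 ≤ s) {g₀ : 𝓢(Phase d, ℂ)} (hg₀ : g₀ ≠ 0)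
    (g₁ : 𝓢(Phase d, ℂ)) {σ : 𝓢'(Phase d, ℂ)} (h : MemAmalgam g₀ s σ) :
    MemAmalgam g₁ s σ := by
  obtain ⟨A, k, hA⟩ := exists_ew_le_pow (d := d) hs
  simp only [MemAmalgam, stft_eq] at h ⊢
  exact lintegral_iSup_snd_lt_top (isFourierForm_phaseForm d) hg₀ g₁ (pairCLM σ)
    (norm_pair_smul σ) (measurable_ew s) ENNReal.ofReal_ne_top (ew_sub_le hs) hA h

theorem stft_add (g : 𝓢(Phase d, ℂ)) (σ σ' : 𝓢'(Phase d, ℂ)) (z ζ : Phase d) :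
    stft g (σ + σ') z ζ = stft g σ z ζ + stft g σ' z ζ := rfl

theorem stft_smul (g : 𝓢(Phase d, ℂ)) (c : ℂ) (σ : 𝓢'(Phase d, ℂ)) (z ζ : Phase d) :
    stft g (c • σ) z ζ = c * stft g σ z ζ := rfl

theorem stft_zero (g : 𝓢(Phase d, ℂ)) (z ζ : Phase d) :
    stft g (0 : 𝓢'(Phase d, ℂ)) z ζ = 0 := rfl

theorem measurable_iSup_stft_snd (g : 𝓢(Phase d, ℂ)) (σ : 𝓢'(Phase d, ℂ)) :
    Measurable fun z ↦ ⨆ ζ, ‖stft g σ z ζ‖ₑ := by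
  simp only [stft_eq]
  exact measurable_iSup_snd g (pairCLM σ)

theorem measurable_iSup_stft_fst (g : 𝓢(Phase d, ℂ)) (σ : 𝓢'(Phase d, ℂ)) :
    Measurable fun ζ ↦ ⨆ z, ‖stft g σ z ζ‖ₑ := by
  simp only [stft_eq]
  exact measurable_iSup_fst g (pairCLM σ)

theorem measurable_iSup_stft_fst_mul (g : 𝓢(Phase d, ℂ)) (s : ℝ) (σ : 𝓢'(Phase d, ℂ)) :
    Measurable fun ζ ↦ (⨆ z, ‖stft g σ z ζ‖ₑ) * ENNReal.ofReal (polyWeight s ζ) :=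
  (measurable_iSup_stft_fst g σ).mul (measurable_ew s)

theorem measurable_iSup_stft_snd_mul (g : 𝓢(Phase d, ℂ)) (s : ℝ) (σ : 𝓢'(Phase d, ℂ)) :
    Measurable fun z ↦ (⨆ ζ, ‖stft g σ z ζ‖ₑ) * ENNReal.ofReal (polyWeight s z) :=
  (measurable_iSup_stft_snd g σ).mul (measurable_ew s)

theorem iSup_enorm_add_le {ι : Type} (f g : ι → ℂ) :
    ⨆ i, ‖f i + g i‖ₑ ≤ (⨆ i, ‖f i‖ₑ) + ⨆ i, ‖g i‖ₑ :=
  iSup_le fun i ↦ (enorm_add_le _ _).trans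
    (add_le_add (le_iSup (fun i ↦ ‖f i‖ₑ) i) (le_iSup (fun i ↦ ‖g i‖ₑ) i))

/-- The Sjöstrand class as a subspace. -/
def sjostrand (g : 𝓢(Phase d, ℂ)) (s : ℝ) : Submodule ℂ 𝓢'(Phase d, ℂ) where
  carrier := {σ | MemSjostrand g s σ}
  zero_mem' := by simp [MemSjostrand, stft_zero]
  add_mem' {σ σ'} h h' := by
    simp only [Set.mem_ofPred_eq, MemSjostrand, stft_add] at h h' ⊢
    refine lt_of_le_of_lt (lintegral_mono fun ζ ↦ mul_le_mul_left (iSup_enorm_add_le _ _) _) ?_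
    simp only [add_mul]
    rw [lintegral_add_left (measurable_iSup_stft_fst_mul g s σ)]
    exact ENNReal.add_lt_top.2 ⟨h, h'⟩
  smul_mem' c σ h := by
    simp only [Set.mem_ofPred_eq, MemSjostrand, stft_smul, enorm_mul, ← ENNReal.mul_iSup,
      mul_assoc] at h ⊢
    rw [lintegral_const_mul _ (measurable_iSup_stft_fst_mul g s σ)]
    exact ENNReal.mul_lt_top enorm_lt_top h

/-- The Wiener amalgam space as a subspace. -/
def amalgam (g : 𝓢(Phase d, ℂ)) (s : ℝ) : Submodule ℂ 𝓢'(Phase d, ℂ) where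
  carrier := {σ | MemAmalgam g s σ}
  zero_mem' := by simp [MemAmalgam, stft_zero]
  add_mem' {σ σ'} h h' := by
    simp only [Set.mem_ofPred_eq, MemAmalgam, stft_add] at h h' ⊢
    refine lt_of_le_of_lt (lintegral_mono fun z ↦ mul_le_mul_left (iSup_enorm_add_le _ _) _) ?_
    simp only [add_mul]
    rw [lintegral_add_left (measurable_iSup_stft_snd_mul g s σ)]
    exact ENNReal.add_lt_top.2 ⟨h, h'⟩
  smul_mem' c σ h := by
    simp only [Set.mem_ofPred_eq, MemAmalgam, stft_smul, enorm_mul, ← ENNReal.mul_iSup,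
      mul_assoc] at h ⊢
    rw [lintegral_const_mul _ (measurable_iSup_stft_snd_mul g s σ)]
    exact ENNReal.mul_lt_top enorm_lt_top h

end Membership

/-! ### Covariance of the Wigner distribution and Moyal's formula -/

section WignerIdentities

variable {d : ℕ}

theorem tauWigner_apply (τ : ℝ) (f h : 𝓢(Conf d, ℂ)) (p : Phase d) :
    tauWigner τ f h p = ∫ y : Conf d, conj (chr (innerForm (Conf d)) p.2 y) *
      (f (p.1 + τ • y) * conj (h (p.1 - (1 - τ) • y))) := by
  change ∫ y : Conf d, Complex.exp (-2 * Real.pi * Complex.I * ⟪y, p.2⟫_ℝ) *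
    (f (p.1 + τ • y) * conj (h (p.1 - (1 - τ) • y))) = _
  congr 1 with y
  congr 1
  rw [chr, ← Complex.exp_conj, innerForm_apply, real_inner_comm]
  congr 1
  simp [map_ofNat]

theorem tauWigner_apply_eq_partialFourier (τ : ℝ) (f h : 𝓢(Conf d, ℂ)) (p : Phase d) :
    tauWigner τ f h p = partialFourier (tauKernel τ f h) p :=
  congrFun (tauWigner_eq τ f h) p

/-- The time-frequency shift on `ℝᵈ` at a point of phase space. -/
def tfC (z : Phase d) (f : 𝓢(Conf d, ℂ)) : 𝓢(Conf d, ℂ) := tf (innerForm (Conf d)) z.1 z.2 f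

theorem tfC_apply (z : Phase d) (f : 𝓢(Conf d, ℂ)) (t : Conf d) :
    tfC z f t = chr (innerForm (Conf d)) z.2 t * f (t - z.1) := tf_apply _ _ _ _ _

/-- The position part of the time-frequency shift induced on the `τ`-Wigner distribution. -/
def tauMid (τ : ℝ) (w z : Phase d) : Phase d :=
  ((1 - τ) • w.1 + τ • z.1, τ • w.2 + (1 - τ) • z.2)

/-- The symplectic rotation `(x, ω) ↦ (ω, -x)`. -/
def sympl (z : Phase d) : Phase d := (z.2, -z.1)

/-- The phase factor in the covariance of the `τ`-Wigner distribution. -/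
def tauPhase (τ : ℝ) (w z : Phase d) : ℂ :=
  chr (innerForm (Conf d)) w.2 (τ • (w.1 - z.1)) *
    chr (innerForm (Conf d)) z.2 ((1 - τ) • (w.1 - z.1))

theorem norm_tauPhase (τ : ℝ) (w z : Phase d) : ‖tauPhase τ w z‖ = 1 := by simp [tauPhase]

/-- Shifting both arguments shifts the Wigner distribution: a `τ`-dependent mean of the two points
gives the position, their rotated difference the frequency. This is the algebraic core that turns
symbols into matrices. -/
theorem tauWigner_tfC (τ : ℝ) (w z : Phase d) (f h : 𝓢(Conf d, ℂ)) :
    tauWigner τ (tfC w f) (tfC z h) = tauPhase τ w z •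
      tf (phaseForm d) (tauMid τ w z) (sympl (w - z)) (tauWigner τ f h) := by
  set B := innerForm (Conf d) with hB
  ext p
  -- The substitution `y ↦ y + (w₁ - z₁)` recentres both arguments at the same mean position.
  rw [_root_.smul_apply, tf_apply, tauWigner_apply, tauWigner_apply, smul_eq_mul, tauPhase, ← hB,
    ← integral_const_mul, ← integral_const_mul,
    ← integral_add_right_eq_self (fun y ↦ conj (chr B p.2 y) *
      (tfC w f (p.1 + τ • y) * conj (tfC z h (p.1 - (1 - τ) • y)))) (w.1 - z.1)]
  congr 1 with y
  rw [tfC_apply, tfC_apply]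
  have e1 : p.1 + τ • (y + (w.1 - z.1)) - w.1 = (p - tauMid τ w z).1 + τ • y := by
    simp only [tauMid, Prod.fst_sub]; module
  have e2 : p.1 - (1 - τ) • (y + (w.1 - z.1)) - z.1 = (p - tauMid τ w z).1 - (1 - τ) • y := by
    simp only [tauMid, Prod.fst_sub]; module
  rw [e1, e2]
  have key : conj (chr B p.2 (y + (w.1 - z.1))) * (chr B w.2 (p.1 + τ • (y + (w.1 - z.1))) *
      conj (chr B z.2 (p.1 - (1 - τ) • (y + (w.1 - z.1))))) =
      chr B w.2 (τ • (w.1 - z.1)) * chr B z.2 ((1 - τ) • (w.1 - z.1)) *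
        (chr (phaseForm d) (sympl (w - z)) p * conj (chr B (p - tauMid τ w z).2 y)) := by
    simp only [chr, ← Complex.exp_conj, ← Complex.exp_add]
    congr 1
    simp only [map_mul, Complex.conj_I, Complex.conj_ofReal, map_ofNat, B, innerForm_apply,
      phaseForm_apply, sympl, tauMid, Prod.fst_sub, Prod.snd_sub, inner_add_right, inner_sub_right,
      inner_sub_left, inner_add_left, inner_smul_left, inner_smul_right, inner_neg_left]
    rw [real_inner_comm p.2 w.1, real_inner_comm p.2 z.1]
    push_cast
    simp
    ring
  rw [map_mul]
  linear_combination (f ((p - tauMid τ w z).1 + τ • y) *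
    conj (h ((p - tauMid τ w z).1 - (1 - τ) • y))) * key

/-- The shear has determinant of modulus one: for fixed `y`, translating `x` by `τ y` reduces to `τ
= 0`, and there `(x, y) ↦ (x, x - y)` is a reflection with a translation in `y`. -/
theorem integral_comp_tauShear (τ : ℝ) (Q : 𝓢(Phase d, ℂ)) :
    ∫ p, Q (tauShear d τ p) = ∫ p, Q p := by
  have hi (τ : ℝ) : Integrable (fun p ↦ Q (tauShear d τ p))
      ((volume : Measure (Conf d)).prod (volume : Measure (Conf d))) :=
    (SchwartzMap.compCLMOfContinuousLinearEquiv ℂ (tauShear d τ) Q).integrable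
      (μ := (volume : Measure (Phase d)))
  have e (τ : ℝ) (x y : Conf d) : tauShear d τ (x, y) = (x + τ • y, x - (1 - τ) • y) := rfl
  rw [Measure.volume_eq_prod, integral_prod_symm _ (hi τ),
    integral_prod _ (Q.integrable (μ := (volume : Measure (Phase d))))]
  calc ∫ y, ∫ x, Q (tauShear d τ (x, y)) = ∫ y, ∫ x, Q (tauShear d 0 (x, y)) := by
        congr 1 with y
        rw [← integral_sub_right_eq_self (fun x ↦ Q (tauShear d τ (x, y))) (τ • y)]
        congr 1 with x
        congr 1
        simp only [e, Prod.mk.injEq]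
        constructor <;> module
    _ = ∫ x, ∫ y, Q (tauShear d 0 (x, y)) := by
        rw [← integral_prod_symm _ (hi 0), integral_prod _ (hi 0)]
    _ = ∫ x, ∫ y, Q (x, y) := by
        congr 1 with x
        rw [← integral_sub_left_eq_self (fun y ↦ Q (x, y)) volume x]
        congr 1 with y
        congr 1
        simp [e]

/-- The slice `y ↦ F(x, y)` of a Schwartz function on phase space. -/
def slice (F : 𝓢(Phase d, ℂ)) (x : Conf d) : 𝓢(Conf d, ℂ) :=
  SchwartzMap.compCLMOfAntilipschitz ℂ (K := 1) (g := fun y : Conf d ↦ ((x, y) : Phase d))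
    (by
      have : (fun y : Conf d ↦ ((x, y) : Phase d)) = fun y ↦ (x, 0) +
          (ContinuousLinearMap.inr ℝ (Conf d) (Conf d)) y := by ext y <;> simp
      rw [this]
      exact (Function.HasTemperateGrowth.const _).add
        (ContinuousLinearMap.inr ℝ (Conf d) (Conf d)).hasTemperateGrowth)
    (by
      refine AntilipschitzWith.of_le_mul_dist fun y y' ↦ ?_
      simp [Prod.dist_eq]) F

@[simp]
theorem slice_apply (F : 𝓢(Phase d, ℂ)) (x y : Conf d) : slice F x y = F (x, y) := rfl

/-- Moyal's formula for the `τ`-Wigner distribution. -/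
theorem integral_conj_tauWigner_mul (τ : ℝ) (f h f' h' : 𝓢(Conf d, ℂ)) :
    ∫ p, conj (tauWigner τ f h p) * tauWigner τ f' h' p =
      (∫ x, conj (f x) * f' x) * ∫ x, conj (h' x) * h x := by
  have hi : Integrable (fun p ↦ conj (tauWigner τ f h p) * tauWigner τ f' h' p)
      ((volume : Measure (Conf d)).prod (volume : Measure (Conf d))) :=
    (mulS (conjS (tauWigner τ f h)) (tauWigner τ f' h')).integrable
      (μ := (volume : Measure (Phase d)))
  have hi' : Integrable (fun p ↦ conj (tauKernel τ f h p) * tauKernel τ f' h' p)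
      ((volume : Measure (Conf d)).prod (volume : Measure (Conf d))) :=
    (mulS (conjS (tauKernel τ f h)) (tauKernel τ f' h')).integrable
      (μ := (volume : Measure (Phase d)))
  have hsl (x : Conf d) : ∫ η, conj (tauWigner τ f h (x, η)) * tauWigner τ f' h' (x, η) =
      ∫ y, conj (tauKernel τ f h (x, y)) * tauKernel τ f' h' (x, y) := by
    -- Parseval in the second variable, slice by slice.
    have := SchwartzMap.integral_inner_fourier_fourier (slice (tauKernel τ f h) x)
      (slice (tauKernel τ f' h') x)
    simp only [RCLike.inner_apply', slice_apply] at this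
    rw [← this]
    congr 1 with η
    rw [tauWigner_apply_eq_partialFourier, tauWigner_apply_eq_partialFourier]
    rfl
  rw [Measure.volume_eq_prod, integral_prod _ hi]
  simp only [hsl]
  rw [← integral_prod _ hi', ← Measure.volume_eq_prod]
  have := integral_comp_tauShear τ (mulS (conjS (tensor f (conjS h))) (tensor f' (conjS h')))
  refine this.trans ?_
  rw [Measure.volume_eq_prod, ← integral_prod_mul]
  congr 1 with p
  change conj (f p.1 * conj (h p.2)) * (f' p.1 * conj (h' p.2)) = _
  simp only [map_mul, Complex.conj_conj]
  ring

end WignerIdentities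

/-! ### Linear changes of variables in weighted integrals -/

section ChangeOfVariables

/-- The image of Haar measure under a linear isomorphism is again a Haar measure, hence a multiple
of the original; only finiteness of the factor is ever used. -/
theorem exists_lintegral_comp_eq {E : Type} [NormedAddCommGroup E] [NormedSpace ℝ E]
    [FiniteDimensional ℝ E] [MeasureSpace E] [BorelSpace E]
    [(volume : Measure E).IsAddHaarMeasure] (L : E ≃L[ℝ] E) :
    ∃ c : ℝ≥0∞, c ≠ ⊤ ∧ ∀ f : E → ℝ≥0∞, Measurable f → ∫⁻ x, f (L x) = c * ∫⁻ x, f x := by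
  refine ⟨((Measure.map L volume).addHaarScalarFactor (volume : Measure E) : NNReal),
    ENNReal.coe_ne_top, fun f hf ↦ ?_⟩
  rw [← lintegral_map hf L.continuous.measurable]
  conv_lhs => rw [Measure.isAddLeftInvariant_eq_smul (Measure.map L volume) volume]
  rw [lintegral_smul_measure, ENNReal.smul_def, smul_eq_mul]

variable {d : ℕ} {s : ℝ}

theorem exists_ew_map_le (hs : 0 ≤ s) (L : Phase d →L[ℝ] Phase d) :
    ∃ K : ℝ≥0∞, K ≠ ⊤ ∧ ∀ x, ew s (L x) ≤ K * ew s x := by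
  refine ⟨ENNReal.ofReal ((1 + 2 * ‖L‖ ^ 2) ^ (s / 2)), ENNReal.ofReal_ne_top, fun x ↦ ?_⟩
  refine ew_le_mul_of_le hs (a := 1 + (‖x.1‖ ^ 2 + ‖x.2‖ ^ 2)) (by positivity) (by positivity) ?_
  have hx : ‖x‖ ^ 2 ≤ ‖x.1‖ ^ 2 + ‖x.2‖ ^ 2 := by
    rcases max_choice ‖x.1‖ ‖x.2‖ with h | h <;> rw [Prod.norm_def, h] <;>
      nlinarith [sq_nonneg ‖x.1‖, sq_nonneg ‖x.2‖]
  have h0 : ‖L x‖ ^ 2 ≤ ‖L‖ ^ 2 * ‖x‖ ^ 2 := by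
    rw [← mul_pow]; gcongr; exact L.le_opNorm x
  have h1 : ‖(L x).1‖ ^ 2 ≤ ‖L x‖ ^ 2 := by gcongr; exact norm_fst_le _
  have h2 : ‖(L x).2‖ ^ 2 ≤ ‖L x‖ ^ 2 := by gcongr; exact norm_snd_le _
  nlinarith [sq_nonneg ‖L‖, mul_le_mul_of_nonneg_left hx (sq_nonneg ‖L‖),
    sq_nonneg ‖x.1‖, sq_nonneg ‖x.2‖]

/-- A linear isomorphism changes both the weight and Lebesgue measure by bounded factors only, so
the linear coordinates of an envelope are immaterial. -/
theorem lintegral_comp_mul_ew_lt_top (hs : 0 ≤ s) (L : Phase d ≃L[ℝ] Phase d)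
    {H : Phase d → ℝ≥0∞} (hH : Measurable H) (h : ∫⁻ x, H x * ew s x < ⊤) :
    ∫⁻ x, H (L x) * ew s x < ⊤ := by
  obtain ⟨K, hK, hKle⟩ := exists_ew_map_le hs (L.symm : Phase d →L[ℝ] Phase d)
  obtain ⟨c, hc, hceq⟩ := exists_lintegral_comp_eq L
  calc ∫⁻ x, H (L x) * ew s x ≤ ∫⁻ x, K * (H (L x) * ew s (L x)) := by
        refine lintegral_mono fun x ↦ ?_
        have := hKle (L x)
        rw [ContinuousLinearEquiv.coe_coe, ContinuousLinearEquiv.symm_apply_apply] at this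
        calc _ ≤ H (L x) * (K * ew s (L x)) := by gcongr
          _ = _ := by ring
    _ = K * (c * ∫⁻ x, H x * ew s x) := by
        have hm : Measurable fun x ↦ H (L x) * ew s (L x) :=
          (hH.mul (measurable_ew s)).comp L.continuous.measurable
        rw [lintegral_const_mul _ hm, hceq (fun x ↦ H x * ew s x) (hH.mul (measurable_ew s))]
    _ < ⊤ := ENNReal.mul_lt_top hK.lt_top (ENNReal.mul_lt_top hc.lt_top h)

/-- `(w, z) ↦ (((1 - τ) w₁ + τ z₁, τ w₂ + (1 - τ) z₂), J (w - z))` as a linear equivalence. -/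
def tauEquiv (d : ℕ) (τ : ℝ) : (Phase d × Phase d) ≃L[ℝ] (Phase d × Phase d) :=
  LinearEquiv.toContinuousLinearEquiv
    { toFun := fun p ↦ (tauMid τ p.1 p.2, sympl (p.1 - p.2))
      invFun := fun q ↦ ((q.1.1 - τ • q.2.2, q.1.2 + (1 - τ) • q.2.1),
        (q.1.1 + (1 - τ) • q.2.2, q.1.2 - τ • q.2.1))
      map_add' := fun p q ↦ by
        ext i <;> simp [tauMid, sympl] <;> ring
      map_smul' := fun c p ↦ by
        ext i <;> simp [tauMid, sympl] <;> ring
      left_inv := fun p ↦ by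
        ext i <;> simp [tauMid, sympl] <;> ring
      right_inv := fun q ↦ by
        ext i <;> simp [tauMid, sympl] <;> ring }

@[simp]
theorem tauEquiv_apply (τ : ℝ) (p : Phase d × Phase d) :
    tauEquiv d τ p = (tauMid τ p.1 p.2, sympl (p.1 - p.2)) := rfl

/-- The symplectic rotation as a linear equivalence. -/
def symplEquiv (d : ℕ) : Phase d ≃L[ℝ] Phase d :=
  LinearEquiv.toContinuousLinearEquiv
    { toFun := sympl
      invFun := fun q ↦ (-q.2, q.1)
      map_add' := fun p q ↦ by ext i <;> simp [sympl]; ring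
      map_smul' := fun c p ↦ by ext i <;> simp [sympl]
      left_inv := fun p ↦ by ext i <;> simp [sympl]
      right_inv := fun q ↦ by ext i <;> simp [sympl] }

@[simp]
theorem symplEquiv_apply (z : Phase d) : symplEquiv d z = sympl z := rfl

/-- The map `(x, y) ↦ (α x, β y)` on phase space. -/
def dilate (d : ℕ) {α β : ℝ} (hα : α ≠ 0) (hβ : β ≠ 0) : Phase d ≃L[ℝ] Phase d :=
  LinearEquiv.toContinuousLinearEquiv
    ((LinearEquiv.smulOfNeZero ℝ (Conf d) α hα).prodCongr (LinearEquiv.smulOfNeZero ℝ (Conf d) β hβ))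

@[simp]
theorem dilate_apply {α β : ℝ} (hα : α ≠ 0) (hβ : β ≠ 0) (z : Phase d) :
    dilate d hα hβ z = (α • z.1, β • z.2) := rfl

end ChangeOfVariables

/-! ### Time-frequency shifts as a continuous frame of `L²` -/

section HilbertSpace

variable {d : ℕ}

/-- A Schwartz function as an element of `L²`. -/
def vec : 𝓢(Conf d, ℂ) →L[ℂ] L2 d := SchwartzMap.toLpCLM ℂ ℂ 2 volume

theorem inner_vec (h f : 𝓢(Conf d, ℂ)) :
    inner ℂ (vec h) (vec f) = ∫ x, conj (h x) * f x := by
  refine (SchwartzMap.inner_toL2_toL2_eq h f).trans ?_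
  congr 1 with x
  rw [RCLike.inner_apply']

theorem dense_vec : DenseRange fun f : 𝓢(Conf d, ℂ) ↦ vec f :=
  SchwartzMap.denseRange_toLpCLM (F := ℂ) (E := Conf d) (μ := volume) (p := 2) (by simp)

theorem ext_inner_vec {F G : L2 d} (h : ∀ f : 𝓢(Conf d, ℂ),
    inner ℂ (vec f) F = inner ℂ (vec f) G) : F = G := by
  refine ext_inner_left ℂ fun v ↦ ?_
  exact congrFun (dense_vec.equalizer (g := fun v : L2 d ↦ (inner ℂ v F : ℂ))
    (h := fun v ↦ inner ℂ v G) (by fun_prop) (by fun_prop) (funext h)) v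

theorem clm_ext_vec {A A' : L2 d →L[ℂ] L2 d}
    (h : ∀ f : 𝓢(Conf d, ℂ), A (vec f) = A' (vec f)) : A = A' := by
  ext1 v
  exact congrFun (dense_vec.equalizer (g := A) (h := A') A.continuous A'.continuous
    (funext h)) v

/-- The inner product of `L²` functions, as a number attached to Schwartz functions. -/
def ip (h f : 𝓢(Conf d, ℂ)) : ℂ := ∫ x, conj (h x) * f x

theorem conj_ip (h f : 𝓢(Conf d, ℂ)) : conj (ip h f) = ip f h := by
  rw [ip, ip, ← integral_conj]
  congr 1 with x
  simp [mul_comm]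

/-- The time-frequency shifts of a window as elements of `L²`. -/
def atom (φ : 𝓢(Conf d, ℂ)) (z : Phase d) : L2 d := vec (tfC z φ)

theorem continuous_atom (φ : 𝓢(Conf d, ℂ)) : Continuous (atom φ) := by
  have : Continuous fun z : Phase d ↦ tfC z φ := continuous_tf (innerForm (Conf d)) φ
  exact vec.continuous.comp this

theorem norm_atom (φ : 𝓢(Conf d, ℂ)) (z : Phase d) : ‖atom φ z‖ = ‖vec φ‖ := by
  have h (f : 𝓢(Conf d, ℂ)) : (‖vec f‖ : ℂ) ^ 2 = ∫ x, ((‖f x‖ ^ 2 : ℝ) : ℂ) := by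
    have := inner_self_eq_norm_sq_to_K (𝕜 := ℂ) (vec f)
    rw [inner_vec] at this
    refine this.symm.trans ?_
    congr 1 with x
    rw [mul_comm, Complex.mul_conj, Complex.normSq_eq_norm_sq]
  have h1 := h (tfC z φ)
  have h2 := h φ
  rw [← integral_sub_right_eq_self (fun x ↦ ((‖φ x‖ ^ 2 : ℝ) : ℂ)) z.1] at h2
  have h3 : (‖atom φ z‖ : ℂ) ^ 2 = (‖vec φ‖ : ℂ) ^ 2 := by
    rw [h2]
    refine h1.trans ?_
    congr 1 with x
    rw [tfC, norm_tf_apply]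
  have h4 : ‖atom φ z‖ ^ 2 = ‖vec φ‖ ^ 2 := by exact_mod_cast h3
  exact (pow_left_inj₀ (norm_nonneg _) (norm_nonneg _) two_ne_zero).1 h4

theorem stftS_eq_inner (φ f : 𝓢(Conf d, ℂ)) (z : Phase d) :
    stftS (innerForm (Conf d)) φ f z = inner ℂ (atom φ z) (vec f) :=
  (inner_vec _ _).symm

/-- Reconstruction of a Schwartz function from its short-time Fourier transform, weakly
in `L²`. -/
theorem inner_reconstruction (φ h : 𝓢(Conf d, ℂ)) (F : L2 d) :
    Integrable (fun z ↦ inner ℂ (atom φ z) (vec h) * inner ℂ F (atom φ z)) ∧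
      ip φ φ * inner ℂ F (vec h) =
        ∫ z, inner ℂ (atom φ z) (vec h) * inner ℂ F (atom φ z) := by
  obtain ⟨h1, h2⟩ := map_reconstruction (isFourierForm_innerForm (F := Conf d)) φ φ h
    (((innerSL ℂ F).comp vec).restrictScalars ℝ)
  have e (c : ℂ) (f : 𝓢(Conf d, ℂ)) :
      (((innerSL ℂ F).comp vec).restrictScalars ℝ) (c • f) =
        c * inner ℂ F (vec f) := by
    change inner ℂ F (vec (c • f)) = _
    rw [map_smul, inner_smul_right]
  simp only [e, stftS_eq_inner] at h1 h2
  exact ⟨h1, h2⟩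

theorem inner_reconstruction' (φ h : 𝓢(Conf d, ℂ)) (F : L2 d) :
    Integrable (fun z ↦ inner ℂ (vec h) (atom φ z) * inner ℂ (atom φ z) F) ∧
      ip φ φ * inner ℂ (vec h) F =
        ∫ z, inner ℂ (vec h) (atom φ z) * inner ℂ (atom φ z) F := by
  obtain ⟨h1, h2⟩ := inner_reconstruction φ h F
  constructor
  · have := Complex.conjCLE.toContinuousLinearMap.integrable_comp h1
    refine this.congr (Filter.Eventually.of_forall fun z ↦ ?_)
    simp [mul_comm]
  · have := congrArg conj h2
    rw [map_mul, conj_ip, inner_conj_symm, ← integral_conj] at this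
    rw [this]
    congr 1 with z
    simp

theorem ip_self (φ : 𝓢(Conf d, ℂ)) : ip φ φ = ((‖vec φ‖ ^ 2 : ℝ) : ℂ) := by
  rw [ip, ← inner_vec, inner_self_eq_norm_sq_to_K, Complex.ofReal_pow]
  rfl

/-- The reconstruction formula tested against `h` itself. -/
theorem integral_norm_stft_sq (φ h : 𝓢(Conf d, ℂ)) :
    Integrable (fun z ↦ ‖(inner ℂ (atom φ z) (vec h) : ℂ)‖ ^ 2) ∧
      ‖vec φ‖ ^ 2 * ‖vec h‖ ^ 2 =
        ∫ z, ‖(inner ℂ (atom φ z) (vec h) : ℂ)‖ ^ 2 := by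
  have e (u v : L2 d) : inner ℂ u v * inner ℂ v u = ((‖(inner ℂ u v : ℂ)‖ ^ 2 : ℝ) : ℂ) := by
    rw [← inner_conj_symm v u, Complex.mul_conj, Complex.normSq_eq_norm_sq]
  obtain ⟨h1, h2⟩ := inner_reconstruction φ h (vec h)
  constructor
  · refine (Complex.reCLM.integrable_comp h1).congr (Filter.Eventually.of_forall fun z ↦ ?_)
    beta_reduce
    rw [e]
    exact Complex.ofReal_re _
  · rw [integral_congr_ae (Filter.Eventually.of_forall fun z ↦ e _ _), integral_complex_ofReal,
      ip_self, inner_self_eq_norm_sq_to_K] at h2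
    refine Complex.ofReal_injective ?_
    rw [Complex.ofReal_mul, Complex.ofReal_pow ‖vec h‖]
    exact h2

theorem lintegral_enorm_stft_sq (φ h : 𝓢(Conf d, ℂ)) :
    ∫⁻ z, ‖(inner ℂ (atom φ z) (vec h) : ℂ)‖ₑ ^ 2 =
      ENNReal.ofReal (‖vec φ‖ ^ 2 * ‖vec h‖ ^ 2) := by
  obtain ⟨h1, h2⟩ := integral_norm_stft_sq φ h
  rw [h2, ofReal_integral_eq_lintegral_ofReal h1 (Filter.Eventually.of_forall fun z ↦ sq_nonneg _)]
  congr 1 with z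
  rw [ENNReal.ofReal_pow (norm_nonneg _), ofReal_norm]

end HilbertSpace

/-! ### Sesquilinearity of the Wigner distribution -/

section WignerLinear

variable {d : ℕ}

theorem tauWigner_eq_fourier_slice (τ : ℝ) (f h : 𝓢(Conf d, ℂ)) (p : Phase d) :
    tauWigner τ f h p = (𝓕 (slice (tauKernel τ f h) p.1) : 𝓢(Conf d, ℂ)) p.2 :=
  tauWigner_apply_eq_partialFourier τ f h p

theorem slice_add (F G : 𝓢(Phase d, ℂ)) (x : Conf d) : slice (F + G) x = slice F x + slice G x :=
  rfl

theorem slice_smul (c : ℂ) (F : 𝓢(Phase d, ℂ)) (x : Conf d) : slice (c • F) x = c • slice F x :=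
  rfl

theorem tauWigner_add_left (τ : ℝ) (f f' h : 𝓢(Conf d, ℂ)) :
    tauWigner τ (f + f') h = tauWigner τ f h + tauWigner τ f' h := by
  have e : tauKernel τ (f + f') h = tauKernel τ f h + tauKernel τ f' h := by
    ext p
    exact add_mul _ _ _
  ext p
  rw [_root_.add_apply]
  simp only [tauWigner_eq_fourier_slice, e, slice_add, FourierTransform.fourier_add]
  rfl

theorem tauWigner_add_right (τ : ℝ) (f h h' : 𝓢(Conf d, ℂ)) :
    tauWigner τ f (h + h') = tauWigner τ f h + tauWigner τ f h' := by
  have e : tauKernel τ f (h + h') = tauKernel τ f h + tauKernel τ f h' := by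
    ext p
    change f _ * conj (h _ + h' _) = f _ * conj (h _) + f _ * conj (h' _)
    rw [map_add, mul_add]
  ext p
  rw [_root_.add_apply]
  simp only [tauWigner_eq_fourier_slice, e, slice_add, FourierTransform.fourier_add]
  rfl

theorem tauWigner_smul_left (τ : ℝ) (c : ℂ) (f h : 𝓢(Conf d, ℂ)) :
    tauWigner τ (c • f) h = c • tauWigner τ f h := by
  have e : tauKernel τ (c • f) h = c • tauKernel τ f h := by
    ext p
    exact mul_assoc _ _ _
  ext p
  rw [_root_.smul_apply]
  simp only [tauWigner_eq_fourier_slice, e, slice_smul, FourierTransform.fourier_smul]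
  rfl

theorem tauWigner_smul_right (τ : ℝ) (c : ℂ) (f h : 𝓢(Conf d, ℂ)) :
    tauWigner τ f (c • h) = conj c • tauWigner τ f h := by
  have e : tauKernel τ f (c • h) = conj c • tauKernel τ f h := by
    ext p
    change _ * conj (c * _) = conj c * (_ * _)
    rw [map_mul]
    exact mul_left_comm _ _ _
  ext p
  rw [_root_.smul_apply]
  simp only [tauWigner_eq_fourier_slice, e, slice_smul, FourierTransform.fourier_smul]
  rfl

end WignerLinear

/-! ### Symbols and their matrices: uniqueness and existence -/

section SymbolKernel

variable {d : ℕ} {τ : ℝ} {φ : 𝓢(Conf d, ℂ)}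

theorem integrable_comp_equiv {E F : Type} [NormedAddCommGroup E] [NormedSpace ℝ E]
    [FiniteDimensional ℝ E] [MeasureSpace E] [BorelSpace E]
    [(volume : Measure E).IsAddHaarMeasure] [NormedAddCommGroup F] (L : E ≃L[ℝ] E) {f : E → F}
    (hf : Integrable f) : Integrable fun x ↦ f (L x) := by
  refine (integrable_map_equiv L.toHomeomorph.toMeasurableEquiv f).1 ?_
  change Integrable f (Measure.map L volume)
  rw [Measure.isAddLeftInvariant_eq_smul (Measure.map L volume) volume]
  exact hf.smul_measure_nnreal

/-- The matrix coefficients of a symbol with respect to time-frequency shifts of `φ`. -/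
def symKer (τ : ℝ) (φ : 𝓢(Conf d, ℂ)) (σ : 𝓢'(Phase d, ℂ)) (w z : Phase d) : ℂ :=
  pair σ (tauWigner τ (tfC w φ) (tfC z φ))

/-- The dictionary between symbols and matrices. The coordinates on the right are those of
`tauEquiv`, so no information on the symbol is lost. -/
theorem symKer_eq (σ : 𝓢'(Phase d, ℂ)) (w z : Phase d) : symKer τ φ σ w z =
    conj (tauPhase τ w z) * stft (tauWigner τ φ φ) σ (tauMid τ w z) (sympl (w - z)) := by
  rw [symKer, tauWigner_tfC, pair_smul, stft_eq, pairCLM_apply]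

theorem norm_symKer (σ : 𝓢'(Phase d, ℂ)) (w z : Phase d) : ‖symKer τ φ σ w z‖ =
    ‖stft (tauWigner τ φ φ) σ (tauMid τ w z) (sympl (w - z))‖ := by
  rw [symKer_eq, norm_mul, RCLike.norm_conj, norm_tauPhase, one_mul]

theorem IsOp.inner_atom {σ : 𝓢'(Phase d, ℂ)} {A : L2 d →L[ℂ] L2 d} (h : IsOp τ σ A)
    (w z : Phase d) : inner ℂ (atom φ w) (A (atom φ z)) = symKer τ φ σ w z :=
  h _ _

/-- By Moyal the squared norm of `W_τ(φ, φ)` is `‖φ‖⁴`; hence it is an admissible window. -/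
theorem tauWigner_self_ne_zero (τ : ℝ) (hφ : φ ≠ 0) : tauWigner τ φ φ ≠ 0 := by
  intro h
  have := integral_conj_tauWigner_mul τ φ φ φ φ
  rw [h] at this
  have h0 := integral_conj_mul_self_ne_zero hφ
  refine mul_ne_zero h0 h0 (this.symm.trans ?_)
  simp

theorem ip_self_ne_zero (hφ : φ ≠ 0) : ip φ φ ≠ 0 := integral_conj_mul_self_ne_zero hφ

/-- The reconstruction formula expresses the pairing with any Schwartz function through the
transform alone. -/
theorem ext_stft {G : 𝓢(Phase d, ℂ)} (hG : G ≠ 0) {σ σ' : 𝓢'(Phase d, ℂ)}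
    (h : ∀ z ζ, stft G σ z ζ = stft G σ' z ζ) : σ = σ' := by
  have h0 := integral_conj_mul_self_ne_zero hG
  have key (ψ : 𝓢(Phase d, ℂ)) : pair σ ψ = pair σ' ψ := by
    have h1 := (map_reconstruction (isFourierForm_phaseForm d) G G ψ (pairCLM σ)).2
    have h2 := (map_reconstruction (isFourierForm_phaseForm d) G G ψ (pairCLM σ')).2
    simp only [stft_eq, pairCLM_apply] at h
    simp only [pairCLM_apply, pair_smul, h] at h1 h2
    refine mul_left_cancel₀ ((map_ne_zero conj).2 h0) (h1.trans h2.symm)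
  refine DFunLike.ext _ _ fun χ ↦ ?_
  have := key (conjS χ)
  rwa [pair, pair, conjS_conjS] at this

theorem ext_symKer (hφ : φ ≠ 0) {σ σ' : 𝓢'(Phase d, ℂ)}
    (h : ∀ w z, symKer τ φ σ w z = symKer τ φ σ' w z) : σ = σ' := by
  refine ext_stft (tauWigner_self_ne_zero τ hφ) fun z ζ ↦ ?_
  obtain ⟨p, hp⟩ := (tauEquiv d τ).surjective (z, ζ)
  rw [tauEquiv_apply, Prod.mk.injEq] at hp
  have := h p.1 p.2
  rw [symKer_eq, symKer_eq, hp.1, hp.2] at this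
  refine mul_left_cancel₀ ((map_ne_zero conj).2 ?_) this
  rw [← norm_ne_zero_iff, norm_tauPhase]
  exact one_ne_zero

theorem IsOp.symbol_unique (hφ : φ ≠ 0) {σ σ' : 𝓢'(Phase d, ℂ)} {A : L2 d →L[ℂ] L2 d}
    (h : IsOp τ σ A) (h' : IsOp τ σ' A) : σ = σ' :=
  ext_symKer hφ fun w z ↦ (h.inner_atom w z).symm.trans (h'.inner_atom w z)

theorem IsOp.operator_unique {σ : 𝓢'(Phase d, ℂ)} {A A' : L2 d →L[ℂ] L2 d}
    (h : IsOp τ σ A) (h' : IsOp τ σ A') : A = A' :=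
  clm_ext_vec fun f ↦ ext_inner_vec fun g ↦ (h f g).trans (h' f g).symm

theorem IsOp.add {σ σ' : 𝓢'(Phase d, ℂ)} {A A' : L2 d →L[ℂ] L2 d}
    (h : IsOp τ σ A) (h' : IsOp τ σ' A') : IsOp τ (σ + σ') (A + A') := fun f g ↦ by
  rw [_root_.add_apply, inner_add_right, h, h']
  rfl

theorem IsOp.smul {σ : 𝓢'(Phase d, ℂ)} {A : L2 d →L[ℂ] L2 d} (c : ℂ)
    (h : IsOp τ σ A) : IsOp τ (c • σ) (c • A) := fun f g ↦ by
  rw [_root_.smul_apply, inner_smul_right, h]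
  rfl

theorem integral_tauWigner_tfC_mul (w z : Phase d) (χ : 𝓢(Phase d, ℂ)) :
    ∫ t, tauWigner τ (tfC w φ) (tfC z φ) t * χ t = tauPhase τ w z *
      stftS (phaseForm d) (conjS (tauWigner τ φ φ)) χ (tauMid τ w z, -sympl (w - z)) := by
  rw [stftS, ← integral_const_mul]
  congr 1 with t
  rw [tauWigner_tfC, _root_.smul_apply, smul_eq_mul, tf_apply, tf_apply, chr_neg_left, map_mul,
    conjS_apply, Complex.conj_conj, Complex.conj_conj, mul_assoc]

theorem continuous_tauPhase (τ : ℝ) :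
    Continuous fun p : Phase d × Phase d ↦ tauPhase τ p.1 p.2 := by
  simp only [tauPhase, chr, innerForm_apply]
  fun_prop

theorem continuous_integral_tauWigner_tfC_mul (χ : 𝓢(Phase d, ℂ)) :
    Continuous fun p : Phase d × Phase d ↦
      ∫ t, tauWigner τ (tfC p.1 φ) (tfC p.2 φ) t * χ t := by
  simp only [integral_tauWigner_tfC_mul]
  refine (continuous_tauPhase τ).mul ((continuous_stftS _ _ _).comp ?_)
  have := (tauEquiv d τ).continuous
  exact (this.fst).prodMk this.snd.neg

/-- Up to phase the integral is a short-time Fourier transform of `χ` in linear coordinates, so it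
has an integrable majorant whose shape does not depend on `χ`. A bounded kernel may therefore be
integrated against it to define a tempered distribution. -/
theorem exists_integral_tauWigner_tfC_mul_le (τ : ℝ) (φ : 𝓢(Conf d, ℂ)) :
    ∃ (D : Phase d × Phase d → ℝ) (C : ℝ) (m : ℕ × ℕ), Integrable D ∧ 0 ≤ C ∧
      ∀ (χ : 𝓢(Phase d, ℂ)) (p : Phase d × Phase d),
        ‖∫ t, tauWigner τ (tfC p.1 φ) (tfC p.2 φ) t * χ t‖ ≤
          C * (Finset.Iic m).sup (schwartzSeminormFamily ℝ (Phase d) ℂ) χ * D p := by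
  obtain ⟨C, m, hC0, hC⟩ := exists_weighted_stftS_le (isFourierForm_phaseForm d)
    (conjS (tauWigner τ φ φ)) 0
  refine ⟨_, C, m, integrable_comp_equiv (tauEquiv d τ) integrable_prod_one_add, hC0,
    fun χ p ↦ ?_⟩
  have := hC χ (tauMid τ p.1 p.2, -sympl (p.1 - p.2))
  rw [pow_zero, pow_zero, one_mul, one_mul, norm_neg] at this
  rw [integral_tauWigner_tfC_mul, norm_mul, norm_tauPhase, one_mul]
  exact this

theorem integrable_kernel_mul {k : Phase d × Phase d → ℂ} (hk : Continuous k) {M : ℝ}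
    (hM : ∀ p, ‖k p‖ ≤ M) (χ : 𝓢(Phase d, ℂ)) : Integrable fun p : Phase d × Phase d ↦
      k p * ∫ t, tauWigner τ (tfC p.1 φ) (tfC p.2 φ) t * χ t := by
  obtain ⟨D, C, m, hD, hC0, hC⟩ := exists_integral_tauWigner_tfC_mul_le τ φ
  refine Integrable.bdd_mul (c := M) ?_ hk.aestronglyMeasurable (Filter.Eventually.of_forall hM)
  exact (hD.const_mul _).mono' (continuous_integral_tauWigner_tfC_mul χ).aestronglyMeasurable
    (Filter.Eventually.of_forall (hC χ))

/-- The distribution obtained by superposing cross-Wigner distributions of time-frequency shifts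
against a bounded kernel. -/
theorem exists_distribution_of_kernel (τ : ℝ) (φ : 𝓢(Conf d, ℂ)) {k : Phase d × Phase d → ℂ}
    (hk : Continuous k) {M : ℝ} (hM : ∀ p, ‖k p‖ ≤ M) : ∃ σ : 𝓢'(Phase d, ℂ), ∀ χ : 𝓢(Phase d, ℂ),
      σ χ = ∫ p : Phase d × Phase d, k p * ∫ t, tauWigner τ (tfC p.1 φ) (tfC p.2 φ) t * χ t := by
  obtain ⟨D, C, m, hD, hC0, hC⟩ := exists_integral_tauWigner_tfC_mul_le τ φ
  have hM0 : 0 ≤ M := (norm_nonneg _).trans (hM 0)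
  have hsmul (c : ℂ) (χ : 𝓢(Phase d, ℂ)) :
      ∫ p : Phase d × Phase d, k p * ∫ t, tauWigner τ (tfC p.1 φ) (tfC p.2 φ) t * (c • χ) t =
      c * ∫ p : Phase d × Phase d, k p * ∫ t, tauWigner τ (tfC p.1 φ) (tfC p.2 φ) t * χ t := by
    rw [← integral_const_mul]
    congr 1 with p
    rw [mul_left_comm, ← integral_const_mul c]
    congr 2 with t
    rw [_root_.smul_apply, smul_eq_mul, mul_left_comm]
  have hadd (χ χ' : 𝓢(Phase d, ℂ)) :
      ∫ p : Phase d × Phase d, k p * ∫ t, tauWigner τ (tfC p.1 φ) (tfC p.2 φ) t * (χ + χ') t =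
      (∫ p : Phase d × Phase d, k p * ∫ t, tauWigner τ (tfC p.1 φ) (tfC p.2 φ) t * χ t) +
      ∫ p : Phase d × Phase d, k p * ∫ t, tauWigner τ (tfC p.1 φ) (tfC p.2 φ) t * χ' t := by
    rw [← integral_add (integrable_kernel_mul hk hM χ) (integrable_kernel_mul hk hM χ')]
    congr 1 with p
    rw [← mul_add, ← integral_add]
    · congr 2 with t
      rw [_root_.add_apply, mul_add]
    · exact (mulS _ χ).integrable
    · exact (mulS _ χ').integrable
  let T : 𝓢(Phase d, ℂ) →L[ℝ] ℂ := SchwartzMap.mkCLMtoNormedSpace (σ := RingHom.id ℝ) (fun χ ↦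
      ∫ p : Phase d × Phase d, k p * ∫ t, tauWigner τ (tfC p.1 φ) (tfC p.2 φ) t * χ t) hadd
    (fun c χ ↦ by
      have := hsmul c χ
      rw [RingHom.id_apply, Complex.real_smul, ← this]
      rfl)
    ⟨Finset.Iic m, M * C * ∫ p, ‖D p‖, by positivity, fun χ ↦ by
      refine (norm_integral_le_integral_norm _).trans ?_
      have e : M * C * (∫ p, ‖D p‖) * (Finset.Iic m).sup (schwartzSeminormFamily ℝ (Phase d) ℂ) χ =
          ∫ p, M * (C * (Finset.Iic m).sup (schwartzSeminormFamily ℝ (Phase d) ℂ) χ * ‖D p‖) := by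
        rw [integral_const_mul, integral_const_mul]; ring
      rw [e]
      refine integral_mono (integrable_kernel_mul hk hM χ).norm
        ((hD.norm.const_mul _).const_mul _) fun p ↦ ?_
      beta_reduce
      rw [norm_mul]
      have h1 := (hC χ p).trans (mul_le_mul_of_nonneg_left (le_abs_self (D p))
        (mul_nonneg hC0 (apply_nonneg _ _)))
      exact mul_le_mul (hM p) h1 (norm_nonneg _) hM0⟩
  let S : 𝓢(Phase d, ℂ) →L[ℂ] ℂ :=
    { toFun := T
      map_add' := hadd
      map_smul' := hsmul
      cont := T.continuous }
  exact ⟨show 𝓢'(Phase d, ℂ) from S, fun χ ↦ rfl⟩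

/-- Every bounded operator has a `τ`-symbol. -/
theorem exists_isOp_symbol (hφ : φ ≠ 0) (τ : ℝ) (A : L2 d →L[ℂ] L2 d) :
    ∃ σ : 𝓢'(Phase d, ℂ), IsOp τ σ A := by
  have hk : Continuous fun p : Phase d × Phase d ↦
      (inner ℂ (atom φ p.1) (A (atom φ p.2)) : ℂ) :=
    ((continuous_atom φ).comp continuous_fst).inner
      (A.continuous.comp ((continuous_atom φ).comp continuous_snd))
  have hM (p : Phase d × Phase d) : ‖(inner ℂ (atom φ p.1) (A (atom φ p.2)) : ℂ)‖ ≤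
      ‖vec φ‖ * (‖A‖ * ‖vec φ‖) := by
    refine (norm_inner_le_norm _ _).trans ?_
    rw [norm_atom]
    gcongr
    refine (A.le_opNorm _).trans (le_of_eq ?_)
    rw [norm_atom]
  obtain ⟨σ, hσ⟩ := exists_distribution_of_kernel τ φ hk hM
  have hc := ip_self_ne_zero hφ
  -- One factor for each of the two expansions, of `h` in the variable `w` and of `f` in the
  -- variable `z`.
  refine ⟨(ip φ φ * ip φ φ)⁻¹ • σ, fun f h ↦ ?_⟩
  change _ = (ip φ φ * ip φ φ)⁻¹ * pair σ (tauWigner τ h f)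
  rw [eq_inv_mul_iff_mul_eq₀ (mul_ne_zero hc hc), pair, hσ]
  have hint := integrable_kernel_mul (τ := τ) (φ := φ) hk hM (conjS (tauWigner τ h f))
  have e (p : Phase d × Phase d) :
      ∫ t, tauWigner τ (tfC p.1 φ) (tfC p.2 φ) t * conjS (tauWigner τ h f) t =
        inner ℂ (vec h) (atom φ p.1) * inner ℂ (atom φ p.2) (vec f) := by
    -- Moyal's formula separates the variables `w` and `z`, after which the two expansions are
    -- summed one at a time.
    rw [atom, atom, inner_vec, inner_vec, ← integral_conj_tauWigner_mul τ h f]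
    congr 1 with t
    rw [mul_comm, conjS_apply]
  simp only [e] at hint ⊢
  rw [Measure.volume_eq_prod] at hint ⊢
  rw [integral_prod_symm _ hint]
  have e2 (z : Phase d) : ∫ w, inner ℂ (atom φ w) (A (atom φ z)) *
      (inner ℂ (vec h) (atom φ w) * inner ℂ (atom φ z) (vec f)) =
      ip φ φ * (inner ℂ (atom φ z) (vec f) *
        inner ℂ (ContinuousLinearMap.adjoint A (vec h)) (atom φ z)) := by
    rw [ContinuousLinearMap.adjoint_inner_left, mul_left_comm,
      (inner_reconstruction' φ h (A (atom φ z))).2, ← integral_const_mul]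
    congr 1 with w
    ring
  simp only [e2]
  rw [integral_const_mul, ← (inner_reconstruction φ f _).2,
    ContinuousLinearMap.adjoint_inner_left, mul_assoc]
  rfl

end SymbolKernel

/-! ### Membership in the symbol classes as localization of the matrix -/

section Localization

variable {d : ℕ} {s τ : ℝ} {φ : 𝓢(Conf d, ℂ)}

/-- A kernel on phase space is concentrated around the graph of `U`, with weighted integrable
off-graph decay. -/
def Localized (s : ℝ) (U : Phase d ≃L[ℝ] Phase d) (κ : Phase d → Phase d → ℂ) : Prop :=
  ∃ H : Phase d → ℝ≥0∞, Measurable H ∧ ∫⁻ x, H x * ew s x < ⊤ ∧ ∀ w z, ‖κ w z‖ₑ ≤ H (w - U z)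

theorem enorm_symKer (σ : 𝓢'(Phase d, ℂ)) (w z : Phase d) : ‖symKer τ φ σ w z‖ₑ =
    ‖stft (tauWigner τ φ φ) σ (tauMid τ w z) (sympl (w - z))‖ₑ := by
  rw [← ofReal_norm, norm_symKer, ofReal_norm]

theorem exists_enorm_stft_eq (τ : ℝ) (φ : 𝓢(Conf d, ℂ)) (σ : 𝓢'(Phase d, ℂ)) (Z ζ : Phase d) :
    ∃ w z, tauMid τ w z = Z ∧ sympl (w - z) = ζ ∧
      ‖stft (tauWigner τ φ φ) σ Z ζ‖ₑ = ‖symKer τ φ σ w z‖ₑ := by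
  obtain ⟨p, hp⟩ := (tauEquiv d τ).surjective (Z, ζ)
  rw [tauEquiv_apply, Prod.mk.injEq] at hp
  refine ⟨p.1, p.2, hp.1, hp.2, ?_⟩
  rw [enorm_symKer, hp.1, hp.2]

/-- The supremum over positions leaves an envelope in `w - z`, up to the symplectic rotation.
Conversely every position-frequency pair comes from some `(w, z)`, so an envelope of the matrix
bounds the whole supremum. -/
theorem memSjostrand_iff_localized (hs : 0 ≤ s) (τ : ℝ) (φ : 𝓢(Conf d, ℂ)) (σ : 𝓢'(Phase d, ℂ)) :
    MemSjostrand (tauWigner τ φ φ) s σ ↔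
      Localized s (ContinuousLinearEquiv.refl ℝ (Phase d)) (symKer τ φ σ) := by
  constructor
  · intro h
    have hm := measurable_iSup_stft_fst (tauWigner τ φ φ) σ
    refine ⟨_, hm.comp (symplEquiv d).continuous.measurable,
      lintegral_comp_mul_ew_lt_top hs (symplEquiv d) hm h, fun w z ↦ ?_⟩
    rw [enorm_symKer]
    exact le_iSup (fun Z ↦ ‖stft (tauWigner τ φ φ) σ Z (sympl (w - z))‖ₑ) (tauMid τ w z)
  · rintro ⟨H, hm, hH, h⟩
    refine lt_of_le_of_lt (lintegral_mono fun ζ ↦ mul_le_mul_left (iSup_le fun Z ↦ ?_) _)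
      (lintegral_comp_mul_ew_lt_top hs (symplEquiv d).symm hm hH)
    obtain ⟨w, z, rfl, rfl, e⟩ := exists_enorm_stft_eq τ φ σ Z ζ
    rw [e, ← symplEquiv_apply, ContinuousLinearEquiv.symm_apply_apply]
    exact h w z

/-- The linear map whose graph carries the kernels of `τ`-operators with symbols in the amalgam
space. -/
def tauGraph (d : ℕ) {τ : ℝ} (h0 : τ ≠ 0) (h1 : 1 - τ ≠ 0) : Phase d ≃L[ℝ] Phase d :=
  dilate d (α := -(τ / (1 - τ))) (β := -((1 - τ) / τ)) (neg_ne_zero.2 (div_ne_zero h0 h1))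
    (neg_ne_zero.2 (div_ne_zero h1 h0))

/-- Factoring `1 - τ` and `τ` out of the two components exhibits the position as an invertible image
of a distance to a graph; both endpoints of the parameter interval must be excluded for this. -/
theorem tauMid_eq_dilate (h0 : τ ≠ 0) (h1 : 1 - τ ≠ 0) (w z : Phase d) :
    tauMid τ w z = dilate d h1 h0 (w - tauGraph d h0 h1 z) := by
  simp only [tauMid, tauGraph, dilate_apply, Prod.fst_sub, Prod.snd_sub, neg_smul, sub_neg_eq_add]
  rw [smul_add, smul_add, smul_smul, smul_smul, mul_div_cancel₀ _ h0, mul_div_cancel₀ _ h1]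

theorem memAmalgam_iff_localized (hs : 0 ≤ s) (h0 : τ ≠ 0) (h1 : 1 - τ ≠ 0)
    (φ : 𝓢(Conf d, ℂ)) (σ : 𝓢'(Phase d, ℂ)) :
    MemAmalgam (tauWigner τ φ φ) s σ ↔ Localized s (tauGraph d h0 h1) (symKer τ φ σ) := by
  constructor
  · intro h
    have hm := measurable_iSup_stft_snd (tauWigner τ φ φ) σ
    refine ⟨_, hm.comp (dilate d h1 h0).continuous.measurable,
      lintegral_comp_mul_ew_lt_top hs (dilate d h1 h0) hm h, fun w z ↦ ?_⟩
    rw [enorm_symKer, Function.comp_apply, ← tauMid_eq_dilate]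
    exact le_iSup (fun ζ ↦ ‖stft (tauWigner τ φ φ) σ (tauMid τ w z) ζ‖ₑ) (sympl (w - z))
  · rintro ⟨H, hm, hH, h⟩
    refine lt_of_le_of_lt (lintegral_mono fun Z ↦ mul_le_mul_left (iSup_le fun ζ ↦ ?_) _)
      (lintegral_comp_mul_ew_lt_top hs (dilate d h1 h0).symm hm hH)
    obtain ⟨w, z, rfl, rfl, e⟩ := exists_enorm_stft_eq τ φ σ Z ζ
    rw [e, tauMid_eq_dilate h0 h1, ContinuousLinearEquiv.symm_apply_apply]
    exact h w z

end Localization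

/-! ### From bounded sesquilinear forms to operators -/

section FormExtension

variable {d : ℕ}

/-- A bounded sesquilinear form on Schwartz functions is given by a bounded operator on `L²`. -/
theorem exists_clm_of_form {b : 𝓢(Conf d, ℂ) → 𝓢(Conf d, ℂ) → ℂ}
    (add_left : ∀ h h' f, b (h + h') f = b h f + b h' f)
    (smul_left : ∀ (c : ℂ) h f, b (c • h) f = conj c * b h f)
    (add_right : ∀ h f f', b h (f + f') = b h f + b h f')
    (smul_right : ∀ (c : ℂ) h f, b h (c • f) = c * b h f) {C : ℝ}
    (hb : ∀ h f, ‖b h f‖ ≤ C * ‖vec h‖ * ‖vec f‖) :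
    ∃ A : L2 d →L[ℂ] L2 d, ∀ f h, inner ℂ (vec h) (A (vec f)) = b h f := by
  let β (h : 𝓢(Conf d, ℂ)) : 𝓢(Conf d, ℂ) →ₗ[ℂ] ℂ :=
    { toFun := b h
      map_add' := add_right h
      map_smul' := fun c f ↦ smul_right c h f }
  have hd : DenseRange (vec : 𝓢(Conf d, ℂ) →L[ℂ] L2 d).toLinearMap := dense_vec
  let L (h : 𝓢(Conf d, ℂ)) : L2 d →L[ℂ] ℂ := (β h).extendOfNorm vec.toLinearMap
  have hL (h f : 𝓢(Conf d, ℂ)) : L h (vec f) = b h f :=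
    LinearMap.extendOfNorm_eq hd ⟨_, hb h⟩ f
  have hLn (h : 𝓢(Conf d, ℂ)) (F : L2 d) : ‖L h F‖ ≤ C * ‖vec h‖ * ‖F‖ :=
    LinearMap.norm_extendOfNorm_apply_le hd _ (hb h) F
  have hext {T T' : L2 d →L[ℂ] ℂ} (h : ∀ f : 𝓢(Conf d, ℂ), T (vec f) = T' (vec f)) : T = T' := by
    ext1 v
    exact congrFun (dense_vec.equalizer (g := T) (h := T') T.continuous T'.continuous
      (funext h)) v
  let Λ : 𝓢(Conf d, ℂ) →ₗ⋆[ℂ] (L2 d →L[ℂ] ℂ) :=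
    { toFun := L
      map_add' := fun h h' ↦ hext fun f ↦ by
        rw [_root_.add_apply, hL, hL, hL, add_left]
      map_smul' := fun c h ↦ hext fun f ↦ by
        rw [_root_.smul_apply, hL, hL, smul_left]
        rfl }
  have hΛ : ∃ C : ℝ, ∀ h, ‖Λ h‖ ≤ C * ‖vec h‖ := by
    refine ⟨|C|, fun h ↦ ContinuousLinearMap.opNorm_le_bound _ (by positivity) fun F ↦ ?_⟩
    refine (hLn h F).trans ?_
    gcongr
    exact le_abs_self C
  let B : L2 d →L⋆[ℂ] L2 d →L[ℂ] ℂ := Λ.extendOfNorm vec.toLinearMap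
  have hB (h : 𝓢(Conf d, ℂ)) : B (vec h) = L h := LinearMap.extendOfNorm_eq hd hΛ h
  -- The form is conjugate-linear in `h`, so the Riesz operator acts on `h`; its adjoint acts on
  -- `f`.
  refine ⟨ContinuousLinearMap.adjoint (InnerProductSpace.continuousLinearMapOfBilin B),
    fun f h ↦ ?_⟩
  rw [ContinuousLinearMap.adjoint_inner_right,
    InnerProductSpace.continuousLinearMapOfBilin_apply, hB, hL]

/-- A form controlled by the sum of the squares of the norms is bounded. -/
theorem norm_form_le_mul {b : 𝓢(Conf d, ℂ) → 𝓢(Conf d, ℂ) → ℂ}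
    (smul_left : ∀ (c : ℂ) h f, b (c • h) f = conj c * b h f)
    (smul_right : ∀ (c : ℂ) h f, b h (c • f) = c * b h f) {C : ℝ}
    (hb : ∀ h f, ‖b h f‖ ≤ C * (‖vec h‖ ^ 2 + ‖vec f‖ ^ 2)) (h f : 𝓢(Conf d, ℂ)) :
    ‖b h f‖ ≤ 2 * C * ‖vec h‖ * ‖vec f‖ := by
  have hinj : ∀ h : 𝓢(Conf d, ℂ), ‖vec h‖ = 0 → h = 0 := fun h e ↦
    SchwartzMap.injective_toLp 2 volume ((norm_eq_zero.1 e).trans (map_zero vec).symm)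
  by_cases h0 : ‖vec h‖ = 0
  · have : b h f = 0 := by
      have := smul_left 0 0 f
      rwa [smul_zero, map_zero, zero_mul, ← hinj h h0] at this
    rw [this, h0]; simp
  by_cases f0 : ‖vec f‖ = 0
  · have : b h f = 0 := by
      have := smul_right 0 h 0
      rwa [smul_zero, zero_mul, ← hinj f f0] at this
    rw [this, f0]; simp
  -- Homogeneity: for unit vectors the sum of squares is `2`, the factor in the conclusion.
  have h1 := hb (((‖vec h‖⁻¹ : ℝ) : ℂ) • h) (((‖vec f‖⁻¹ : ℝ) : ℂ) • f)
  rw [smul_left, smul_right, map_smul, map_smul, norm_smul, norm_smul, norm_mul, norm_mul,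
    RCLike.norm_conj, Complex.norm_real, Complex.norm_real, norm_inv, norm_norm, norm_inv,
    norm_norm, inv_mul_cancel₀ h0, inv_mul_cancel₀ f0, ← mul_assoc, ← mul_inv,
    inv_mul_le_iff₀ (by positivity)] at h1
  refine h1.trans (le_of_eq ?_)
  ring

end FormExtension

/-! ### Boundedness of operators with localized matrices -/

section Boundedness

variable {d : ℕ} {s τ : ℝ} {φ : 𝓢(Conf d, ℂ)}

/-- Moyal's formula with covariance: in the coordinates `(w, z)` the transform of a Wigner
distribution splits into a product. -/
theorem norm_stftS_tauWigner (f h : 𝓢(Conf d, ℂ)) (p : Phase d × Phase d) :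
    ‖stftS (phaseForm d) (tauWigner τ φ φ) (tauWigner τ h f) (tauEquiv d τ p)‖ =
      ‖(inner ℂ (atom φ p.1) (vec h) : ℂ)‖ * ‖(inner ℂ (atom φ p.2) (vec f) : ℂ)‖ := by
  have := integral_conj_tauWigner_mul τ (tfC p.1 φ) (tfC p.2 φ) h f
  rw [← inner_vec, ← inner_vec] at this
  have e : ∫ t, conj (tauWigner τ (tfC p.1 φ) (tfC p.2 φ) t) * tauWigner τ h f t =
      conj (tauPhase τ p.1 p.2) * stftS (phaseForm d) (tauWigner τ φ φ) (tauWigner τ h f)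
        (tauEquiv d τ p) := by
    rw [stftS, ← integral_const_mul]
    congr 1 with t
    rw [tauWigner_tfC, _root_.smul_apply, smul_eq_mul, map_mul, mul_assoc]
    rfl
  rw [e] at this
  have h2 := congrArg norm this
  rw [norm_mul, RCLike.norm_conj, norm_tauPhase, one_mul, norm_mul,
    norm_inner_symm (vec f)] at h2
  exact h2

theorem enorm_pair_tauWigner_le (hφ : φ ≠ 0) (τ : ℝ) (σ : 𝓢'(Phase d, ℂ)) :
    ∃ C : ℝ≥0∞, C ≠ ⊤ ∧ ∀ f h : 𝓢(Conf d, ℂ), ‖pair σ (tauWigner τ h f)‖ₑ ≤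
      C * ∫⁻ p : Phase d × Phase d, ‖(inner ℂ (atom φ p.1) (vec h) : ℂ)‖ₑ *
        ‖(inner ℂ (atom φ p.2) (vec f) : ℂ)‖ₑ * ‖symKer τ φ σ p.1 p.2‖ₑ := by
  set Φ := tauWigner τ φ φ
  have hc : ∫ u, conj (Φ u) * Φ u ≠ 0 :=
    integral_conj_mul_self_ne_zero (tauWigner_self_ne_zero τ hφ)
  set c := ∫ u, conj (Φ u) * Φ u
  obtain ⟨K, hK, hKeq⟩ := exists_lintegral_comp_eq (tauEquiv d τ).symm
  refine ⟨‖c‖ₑ⁻¹ * K, ENNReal.mul_ne_top (by simpa using hc) hK, fun f h ↦ ?_⟩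
  have hr := (map_reconstruction (isFourierForm_phaseForm d) Φ Φ (tauWigner τ h f) (pairCLM σ)).2
  have hn (c : ℂ) (ψ : 𝓢(Phase d, ℂ)) : ‖pairCLM σ (c • ψ)‖ₑ = ‖c‖ₑ * ‖pairCLM σ ψ‖ₑ := by
    rw [← ofReal_norm, norm_pair_smul, ENNReal.ofReal_mul (norm_nonneg _), ofReal_norm,
      ofReal_norm]
  have h1 : ‖c‖ₑ * ‖pair σ (tauWigner τ h f)‖ₑ ≤ ∫⁻ q : Phase d × Phase d,
      ‖stftS (phaseForm d) Φ (tauWigner τ h f) q‖ₑ * ‖stft Φ σ q.1 q.2‖ₑ := by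
    rw [← pairCLM_apply, ← hn, hr]
    refine (enorm_integral_le_lintegral_enorm _).trans (le_of_eq ?_)
    congr 1 with q
    rw [hn, stft_eq]
  have hm : Measurable fun q : Phase d × Phase d ↦
      ‖stftS (phaseForm d) Φ (tauWigner τ h f) q‖ₑ * ‖stft Φ σ q.1 q.2‖ₑ := by
    simp only [stft_eq]
    exact (continuous_stftS _ _ _).enorm.measurable.mul (continuous_enorm_map_tf _ _).measurable
  have h2 : ∫⁻ q : Phase d × Phase d,
      ‖stftS (phaseForm d) Φ (tauWigner τ h f) q‖ₑ * ‖stft Φ σ q.1 q.2‖ₑ =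
      K * ∫⁻ p : Phase d × Phase d, ‖(inner ℂ (atom φ p.1) (vec h) : ℂ)‖ₑ *
        ‖(inner ℂ (atom φ p.2) (vec f) : ℂ)‖ₑ * ‖symKer τ φ σ p.1 p.2‖ₑ := by
    have e (p : Phase d × Phase d) : ‖(inner ℂ (atom φ p.1) (vec h) : ℂ)‖ₑ *
        ‖(inner ℂ (atom φ p.2) (vec f) : ℂ)‖ₑ * ‖symKer τ φ σ p.1 p.2‖ₑ =
        ‖stftS (phaseForm d) Φ (tauWigner τ h f) (tauEquiv d τ p)‖ₑ *
          ‖stft Φ σ (tauEquiv d τ p).1 (tauEquiv d τ p).2‖ₑ := by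
      rw [enorm_symKer, ← ofReal_norm (stftS _ _ _ _), norm_stftS_tauWigner,
        ENNReal.ofReal_mul (norm_nonneg _), ofReal_norm, ofReal_norm]
      rfl
    simp only [e]
    rw [← hKeq]
    · simp only [ContinuousLinearEquiv.apply_symm_apply]
    · exact hm.comp (tauEquiv d τ).continuous.measurable
  rw [h2] at h1
  rw [mul_assoc, ← ENNReal.div_eq_inv_mul, ENNReal.le_div_iff_mul_le (by simp [hc]) (by simp),
    mul_comm]
  exact h1

/-- Schur test for localized kernels. -/
theorem lintegral_mul_localized_le {U : Phase d ≃L[ℝ] Phase d} {κ : Phase d → Phase d → ℂ}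
    (hs : 0 ≤ s) (hκ : Localized s U κ) : ∃ C : ℝ≥0∞, C ≠ ⊤ ∧ ∀ a b : Phase d → ℝ≥0∞,
      Measurable a → Measurable b → ∫⁻ p : Phase d × Phase d, a p.1 * b p.2 * ‖κ p.1 p.2‖ₑ ≤
        C * ((∫⁻ x, a x ^ 2) + ∫⁻ x, b x ^ 2) := by
  obtain ⟨H, hm, hH, hle⟩ := hκ
  -- The Jacobian of `z ↦ -U z`, needed to integrate `H (w - U z)` over `z`; integration over `w` is
  -- a mere translation.
  obtain ⟨c, hc, hceq⟩ := exists_lintegral_comp_eq (U.trans (ContinuousLinearEquiv.neg ℝ))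
  have hI : ∫⁻ x, H x < ⊤ := lt_of_le_of_lt
    (lintegral_mono fun x ↦ le_mul_of_one_le_right' (one_le_ew hs x)) hH
  refine ⟨(c + 1) * ∫⁻ x, H x, ENNReal.mul_ne_top (by simpa using hc) hI.ne, fun a b ha hb ↦ ?_⟩
  have hHU : Measurable fun p : Phase d × Phase d ↦ H (p.1 - U p.2) :=
    hm.comp (measurable_fst.sub (U.continuous.measurable.comp measurable_snd))
  -- This replaces Cauchy-Schwarz; the product bound is recovered afterwards by scaling, in
  -- `norm_form_le_mul`.
  have hab (x y : ℝ≥0∞) : x * y ≤ x ^ 2 + y ^ 2 := by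
    rcases le_total x y with h | h
    · exact le_add_left (by rw [sq]; gcongr)
    · exact le_add_right (by rw [sq]; gcongr)
  have h1 : ∫⁻ p : Phase d × Phase d, a p.1 ^ 2 * H (p.1 - U p.2) =
      (∫⁻ x, a x ^ 2) * (c * ∫⁻ x, H x) := by
    rw [Measure.volume_eq_prod, lintegral_prod _ (by fun_prop), ← lintegral_mul_const _ (by fun_prop)]
    congr 1 with w
    have hw : Measurable fun y ↦ H (w + y) := hm.comp (by fun_prop)
    have hw' : Measurable fun y ↦ H (w - U y) := hHU.comp (by fun_prop : Measurable fun y ↦ (w, y))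
    refine (lintegral_const_mul (a w ^ 2) hw').trans ?_
    rw [← lintegral_add_left_eq_self H w, ← hceq _ hw]
    simp only [sub_eq_add_neg]
    rfl
  have h2 : ∫⁻ p : Phase d × Phase d, b p.2 ^ 2 * H (p.1 - U p.2) =
      (∫⁻ x, b x ^ 2) * ∫⁻ x, H x := by
    rw [Measure.volume_eq_prod, lintegral_prod_symm _ (by fun_prop),
      ← lintegral_mul_const _ (by fun_prop)]
    congr 1 with z
    have hz : Measurable fun x ↦ H (x - U z) := hm.comp (by fun_prop)
    refine (lintegral_const_mul (b z ^ 2) hz).trans ?_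
    rw [lintegral_sub_right_eq_self]
  calc ∫⁻ p : Phase d × Phase d, a p.1 * b p.2 * ‖κ p.1 p.2‖ₑ
      ≤ ∫⁻ p : Phase d × Phase d,
          (a p.1 ^ 2 * H (p.1 - U p.2) + b p.2 ^ 2 * H (p.1 - U p.2)) := by
        refine lintegral_mono fun p ↦ ?_
        rw [← add_mul]
        exact mul_le_mul' (hab _ _) (hle _ _)
    _ = (∫⁻ x, a x ^ 2) * (c * ∫⁻ x, H x) + (∫⁻ x, b x ^ 2) * ∫⁻ x, H x := by
        rw [lintegral_add_left (by fun_prop), h1, h2]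
    _ ≤ (∫⁻ x, a x ^ 2) * ((c + 1) * ∫⁻ x, H x) + (∫⁻ x, b x ^ 2) * ((c + 1) * ∫⁻ x, H x) := by
        gcongr
        · exact le_self_add
        · exact le_mul_of_one_le_left' le_add_self
    _ = _ := by ring

/-- Symbols with a localized kernel define bounded operators on `L²`. -/
theorem exists_isOp_of_localized (hφ : φ ≠ 0) (hs : 0 ≤ s) {σ : 𝓢'(Phase d, ℂ)}
    {U : Phase d ≃L[ℝ] Phase d} (hσ : Localized s U (symKer τ φ σ)) :
    ∃ A : L2 d →L[ℂ] L2 d, IsOp τ σ A := by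
  obtain ⟨C, hC, hCle⟩ := enorm_pair_tauWigner_le hφ τ σ
  obtain ⟨C', hC', hCle'⟩ := lintegral_mul_localized_le hs hσ
  have hsl (c : ℂ) (h f : 𝓢(Conf d, ℂ)) : pair σ (tauWigner τ (c • h) f) =
      conj c * pair σ (tauWigner τ h f) := by rw [tauWigner_smul_left, pair_smul]
  have hsr (c : ℂ) (h f : 𝓢(Conf d, ℂ)) : pair σ (tauWigner τ h (c • f)) =
      c * pair σ (tauWigner τ h f) := by
    rw [tauWigner_smul_right, pair_smul, Complex.conj_conj]
  refine exists_clm_of_form (b := fun h f ↦ pair σ (tauWigner τ h f))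
    (fun h h' f ↦ ?_) hsl (fun h f f' ↦ ?_) hsr
    (norm_form_le_mul hsl hsr (C := (C * C').toReal * ‖vec φ‖ ^ 2) fun h f ↦ ?_)
  · rw [tauWigner_add_left]; exact map_add (pairCLM σ) _ _
  · rw [tauWigner_add_right]; exact map_add (pairCLM σ) _ _
  have hm (h : 𝓢(Conf d, ℂ)) : Measurable fun x ↦ ‖(inner ℂ (atom φ x) (vec h) : ℂ)‖ₑ :=
    ((continuous_atom φ).inner continuous_const).enorm.measurable
  have h1 := (hCle f h).trans (mul_le_mul_right (hCle' _ _ (hm h) (hm f)) C)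
  rw [lintegral_enorm_stft_sq, lintegral_enorm_stft_sq, ← ENNReal.ofReal_add (by positivity)
    (by positivity), ← mul_assoc, ← ENNReal.ofReal_toReal (ENNReal.mul_ne_top hC hC'),
    ← ENNReal.ofReal_mul ENNReal.toReal_nonneg, ← ofReal_norm,
    ENNReal.ofReal_le_ofReal_iff (by positivity)] at h1
  refine h1.trans (le_of_eq ?_)
  ring

end Boundedness

/-! ### Composition of localized matrices -/

section Composition

variable {d : ℕ} {s τ : ℝ} {φ : 𝓢(Conf d, ℂ)}

/-- The matrix coefficients of a bounded operator with respect to time-frequency shifts. -/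
def opKer (φ : 𝓢(Conf d, ℂ)) (A : L2 d →L[ℂ] L2 d) (w z : Phase d) : ℂ :=
  inner ℂ (atom φ w) (A (atom φ z))

theorem IsOp.opKer_eq {σ : 𝓢'(Phase d, ℂ)} {A : L2 d →L[ℂ] L2 d} (h : IsOp τ σ A) :
    opKer φ A = symKer τ φ σ :=
  funext fun w ↦ funext fun z ↦ h.inner_atom w z

theorem Localized.lintegral_lt_top (hs : 0 ≤ s) {U : Phase d ≃L[ℝ] Phase d}
    {κ : Phase d → Phase d → ℂ} (h : Localized s U κ) (z : Phase d) : ∫⁻ u, ‖κ u z‖ₑ < ⊤ := by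
  obtain ⟨H, hm, hH, hle⟩ := h
  calc ∫⁻ u, ‖κ u z‖ₑ ≤ ∫⁻ u, H (u - U z) := lintegral_mono fun u ↦ hle u z
    _ = ∫⁻ u, H u := lintegral_sub_right_eq_self _ _
    _ ≤ ∫⁻ u, H u * ew s u := lintegral_mono fun u ↦ le_mul_of_one_le_right' (one_le_ew hs u)
    _ < ⊤ := hH

/-- Norm convergent expansion of an element of `L²` into time-frequency shifts. -/
theorem smul_eq_integral_atom (φ : 𝓢(Conf d, ℂ)) {F : L2 d}
    (hF : ∫⁻ u, ‖(inner ℂ (atom φ u) F : ℂ)‖ₑ < ⊤) (G : L2 d) :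
    ip φ φ * inner ℂ G F = ∫ u, inner ℂ G (atom φ u) * inner ℂ (atom φ u) F := by
  have hc : Continuous fun u ↦ (inner ℂ (atom φ u) F : ℂ) :=
    (continuous_atom φ).inner continuous_const
  have h1 : Integrable fun u ↦ (inner ℂ (atom φ u) F : ℂ) :=
    ⟨hc.aestronglyMeasurable, hF⟩
  have h2 : Integrable fun u ↦ (inner ℂ (atom φ u) F : ℂ) • atom φ u := by
    refine (h1.norm.mul_const ‖vec φ‖).mono'
      (hc.smul (continuous_atom φ)).aestronglyMeasurable (Filter.Eventually.of_forall fun u ↦ ?_)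
    rw [norm_smul, norm_atom]
  have h3 (G : L2 d) : inner ℂ G (∫ u, (inner ℂ (atom φ u) F : ℂ) • atom φ u) =
      ∫ u, inner ℂ G (atom φ u) * inner ℂ (atom φ u) F := by
    rw [← integral_inner h2]
    congr 1 with u
    rw [inner_smul_right, mul_comm]
  -- Integrable coefficients make the expansion converge in norm. It is identified by testing on
  -- Schwartz functions and then holds against every `G`, which need not be Schwartz.
  have h4 : ip φ φ • F = ∫ u, (inner ℂ (atom φ u) F : ℂ) • atom φ u := by
    refine ext_inner_vec fun h ↦ ?_
    rw [h3, inner_smul_right, (inner_reconstruction' φ h F).2]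
  rw [← h3, ← h4, inner_smul_right]

/-- Matrix multiplication: the resolution of the identity by time-frequency shifts is inserted
between `A` and `B`, with `A` moved to the other side by its adjoint. -/
theorem enorm_opKer_comp_le (hφ : φ ≠ 0) {A B : L2 d →L[ℂ] L2 d} {z : Phase d}
    (hB : ∫⁻ u, ‖opKer φ B u z‖ₑ < ⊤) (w : Phase d) :
    ‖opKer φ (A ∘L B) w z‖ₑ ≤ ‖ip φ φ‖ₑ⁻¹ * ∫⁻ u, ‖opKer φ A w u‖ₑ * ‖opKer φ B u z‖ₑ := by
  have h := smul_eq_integral_atom φ hB (ContinuousLinearMap.adjoint A (atom φ w))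
  simp only [ContinuousLinearMap.adjoint_inner_left] at h
  have hc := ip_self_ne_zero hφ
  rw [← ENNReal.div_eq_inv_mul, ENNReal.le_div_iff_mul_le (by simp [hc]) (by simp), mul_comm,
    ← enorm_mul]
  refine (congrArg _ h).le.trans ((enorm_integral_le_lintegral_enorm _).trans (le_of_eq ?_))
  congr 1 with u
  rw [enorm_mul]
  rfl

/-- Composition of operators with localized kernels. -/
theorem Localized.comp (hφ : φ ≠ 0) (hs : 0 ≤ s) {U V : Phase d ≃L[ℝ] Phase d}
    {A B : L2 d →L[ℂ] L2 d} (hA : Localized s U (opKer φ A)) (hB : Localized s V (opKer φ B)) :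
    Localized s (V.trans U) (opKer φ (A ∘L B)) := by
  have hB1 := hB.lintegral_lt_top hs
  obtain ⟨HA, hAm, hAH, hAle⟩ := hA
  obtain ⟨HB, hBm, hBH, hBle⟩ := hB
  have hc := ip_self_ne_zero hφ
  -- With `u = x + V z` one has `w - U u = (w - U (V z)) - U x`, so the envelope of the product is a
  -- convolution with shift `-U x`.
  let N : Phase d →L[ℝ] Phase d := -(U : Phase d →L[ℝ] Phase d)
  obtain ⟨K, hK, hKle⟩ := exists_ew_map_le hs N
  have hNm : Measurable N := N.continuous.measurable
  refine ⟨fun y ↦ ‖ip φ φ‖ₑ⁻¹ * ∫⁻ x, HB x * HA (y + N x), ?_, ?_, fun w z ↦ ?_⟩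
  · refine Measurable.const_mul (Measurable.lintegral_prod_right' (f := fun p : Phase d × Phase d ↦
      HB p.2 * HA (p.1 + N p.2)) ?_) _
    fun_prop
  · refine lt_of_le_of_lt (lintegral_weight_convolution_le (measurable_ew s) hAm hBm hNm
      (ew_sub_le hs) fun y ↦ le_rfl) ?_
    refine ENNReal.mul_lt_top (by simpa [pos_iff_ne_zero] using hc)
      (ENNReal.mul_lt_top ENNReal.ofReal_lt_top (ENNReal.mul_lt_top ?_ hAH))
    calc ∫⁻ x, HB x * ew s (N x) ≤ ∫⁻ x, K * (HB x * ew s x) := by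
          refine lintegral_mono fun x ↦ ?_
          rw [mul_left_comm]
          gcongr
          exact hKle x
      _ = K * ∫⁻ x, HB x * ew s x := lintegral_const_mul _ (hBm.mul (measurable_ew s))
      _ < ⊤ := ENNReal.mul_lt_top hK.lt_top hBH
  · refine (enorm_opKer_comp_le hφ (hB1 z) w).trans ?_
    refine mul_le_mul_right ?_ _
    rw [← lintegral_add_right_eq_self _ (V z)]
    refine lintegral_mono fun x ↦ ?_
    rw [mul_comm]
    refine mul_le_mul' ((hBle _ _).trans (le_of_eq ?_)) ((hAle _ _).trans (le_of_eq ?_))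
    · rw [add_sub_cancel_right]
    · congr 1
      simp [N]
      abel

/-- Up to phase the Gram matrix of the shifts is the transform of `φ` with window `φ` at `w - z`,
which decays faster than any polynomial. This puts the unit into the Sjöstrand class. -/
theorem localized_opKer_id (hs : 0 ≤ s) (φ : 𝓢(Conf d, ℂ)) :
    Localized s (ContinuousLinearEquiv.refl ℝ (Phase d))
      (opKer φ (ContinuousLinearMap.id ℂ (L2 d))) := by
  obtain ⟨A, k, hA⟩ := exists_ew_le_pow (d := d) hs
  refine ⟨fun x ↦ ‖stftS (innerForm (Conf d)) φ φ x‖ₑ,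
    (continuous_stftS _ _ _).enorm.measurable,
    lintegral_stftS_mul_lt_top isFourierForm_innerForm φ φ hA (ρ := id) fun r ↦ le_rfl,
    fun w z ↦ ?_⟩
  have h := norm_stftS_tf (B := innerForm (Conf d)) φ φ z w
  beta_reduce
  rw [ContinuousLinearEquiv.refl_apply, ← ofReal_norm (stftS _ _ _ _), ← h, ofReal_norm]
  exact le_of_eq (congrArg _ (stftS_eq_inner φ (tfC z φ) w).symm)

end Composition

/-! ### Products of symbols from the two classes -/

section SymbolClasses

variable {d : ℕ} {s τ : ℝ} {φ : 𝓢(Conf d, ℂ)} {g : 𝓢(Phase d, ℂ)}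

/-- A smooth bump. Its nonnegativity is used only for the counterexample, where its overlap with a
dilate must not vanish. -/
theorem exists_schwartz_window (d : ℕ) : ∃ φ : 𝓢(Conf d, ℂ), φ ≠ 0 ∧ ∃ ρ : Conf d → ℝ,
    Continuous ρ ∧ (∀ x, 0 ≤ ρ x) ∧ 0 < ρ 0 ∧ ∀ x, φ x = ρ x := by
  let b : ContDiffBump (0 : Conf d) := ⟨1, 2, one_pos, one_lt_two⟩
  have hs : HasCompactSupport fun x ↦ ((b x : ℝ) : ℂ) :=
    b.hasCompactSupport.comp_left (g := fun r : ℝ ↦ (r : ℂ)) Complex.ofReal_zero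
  have hc : ContDiff ℝ ∞ fun x ↦ ((b x : ℝ) : ℂ) := Complex.ofRealCLM.contDiff.comp b.contDiff
  have h0 : b 0 = 1 := b.one_of_mem_closedBall (by simp [b])
  refine ⟨hs.toSchwartzMap hc, fun h ↦ ?_, b, b.continuous, fun x ↦ b.nonneg, ?_, fun x ↦ rfl⟩
  · have := DFunLike.congr_fun h 0
    change ((b 0 : ℝ) : ℂ) = 0 at this
    rw [h0] at this
    simp at this
  · rw [h0]; exact one_pos

theorem memSjostrand_iff (hφ : φ ≠ 0) (hs : 0 ≤ s) (hg : g ≠ 0) (τ : ℝ) (σ : 𝓢'(Phase d, ℂ)) :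
    MemSjostrand g s σ ↔ Localized s (ContinuousLinearEquiv.refl ℝ (Phase d)) (symKer τ φ σ) :=
  (Iff.intro (fun h ↦ h.of_window hs hg _)
    (fun h ↦ h.of_window hs (tauWigner_self_ne_zero τ hφ) _)).trans
    (memSjostrand_iff_localized hs τ φ σ)

theorem memAmalgam_iff (hφ : φ ≠ 0) (hs : 0 ≤ s) (hg : g ≠ 0) (h0 : τ ≠ 0) (h1 : 1 - τ ≠ 0)
    (σ : 𝓢'(Phase d, ℂ)) :
    MemAmalgam g s σ ↔ Localized s (tauGraph d h0 h1) (symKer τ φ σ) :=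
  (Iff.intro (fun h ↦ h.of_window hs hg _)
    (fun h ↦ h.of_window hs (tauWigner_self_ne_zero τ hφ) _)).trans
    (memAmalgam_iff_localized hs h0 h1 φ σ)

theorem exists_isOp_of_memSjostrand (hs : 0 ≤ s) (hg : g ≠ 0) (τ : ℝ) {σ : 𝓢'(Phase d, ℂ)}
    (h : MemSjostrand g s σ) : ∃ A : L2 d →L[ℂ] L2 d, IsOp τ σ A := by
  obtain ⟨φ, hφ, -⟩ := exists_schwartz_window d
  exact exists_isOp_of_localized hφ hs ((memSjostrand_iff hφ hs hg τ σ).1 h)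

theorem exists_isOp_of_memAmalgam (hs : 0 ≤ s) (hg : g ≠ 0) (h0 : τ ≠ 0) (h1 : 1 - τ ≠ 0)
    {σ : 𝓢'(Phase d, ℂ)} (h : MemAmalgam g s σ) : ∃ A : L2 d →L[ℂ] L2 d, IsOp τ σ A := by
  obtain ⟨φ, hφ, -⟩ := exists_schwartz_window d
  exact exists_isOp_of_localized hφ hs ((memAmalgam_iff hφ hs hg h0 h1 σ).1 h)

/-- Replacing `τ` by `1 - τ` inverts both scaling factors, and the two signs cancel. This is why the
complementary parameters lead back to the diagonal. -/
theorem tauGraph_trans (h0 : τ ≠ 0) (h1 : 1 - τ ≠ 0) (h0' : 1 - τ ≠ 0) (h1' : 1 - (1 - τ) ≠ 0) :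
    (tauGraph d h0' h1').trans (tauGraph d h0 h1) = ContinuousLinearEquiv.refl ℝ (Phase d) := by
  refine ContinuousLinearEquiv.ext (funext fun z ↦ ?_)
  simp only [tauGraph, ContinuousLinearEquiv.trans_apply, dilate_apply, smul_smul,
    ContinuousLinearEquiv.refl_apply, sub_sub_cancel]
  have e1 : -(τ / (1 - τ)) * -((1 - τ) / τ) = 1 := by field_simp
  have e2 : -((1 - τ) / τ) * -(τ / (1 - τ)) = 1 := by field_simp
  rw [e1, e2, one_smul, one_smul]

/-- The composition is localized on the diagonal, and diagonal localization means the Sjöstrand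
class for any quantization, the Weyl one in particular. -/
theorem exists_isOpComp_half (hs : 0 ≤ s) (hg : g ≠ 0) (h0 : τ ≠ 0) (h1 : 1 - τ ≠ 0)
    {a b : 𝓢'(Phase d, ℂ)} (ha : MemAmalgam g s a) (hb : MemAmalgam g s b) :
    ∃ c : 𝓢'(Phase d, ℂ), MemSjostrand g s c ∧ IsOpComp τ a (1 - τ) b (1 / 2) c := by
  obtain ⟨φ, hφ, -⟩ := exists_schwartz_window d
  have h1' : 1 - (1 - τ) ≠ 0 := by rwa [sub_sub_cancel]
  obtain ⟨A, hA⟩ := exists_isOp_of_memAmalgam hs hg h0 h1 ha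
  obtain ⟨B, hB⟩ := exists_isOp_of_memAmalgam hs hg h1 h1' hb
  obtain ⟨c, hc⟩ := exists_isOp_symbol hφ (1 / 2) (A ∘L B)
  rw [memAmalgam_iff hφ hs hg h0 h1, ← hA.opKer_eq] at ha
  rw [memAmalgam_iff hφ hs hg h1 h1', ← hB.opKer_eq] at hb
  have hab := ha.comp hφ hs hb
  rw [tauGraph_trans, hc.opKer_eq] at hab
  exact ⟨c, (memSjostrand_iff hφ hs hg (1 / 2) c).2 hab, A, B, hA, hB, hc⟩

theorem exists_isOpComp_sjostrand (hs : 0 ≤ s) (hg : g ≠ 0) (τ : ℝ)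
    {a b : 𝓢'(Phase d, ℂ)} (ha : MemSjostrand g s a) (hb : MemSjostrand g s b) :
    ∃ c : 𝓢'(Phase d, ℂ), MemSjostrand g s c ∧ IsOpComp τ a τ b τ c := by
  obtain ⟨φ, hφ, -⟩ := exists_schwartz_window d
  obtain ⟨A, hA⟩ := exists_isOp_of_memSjostrand hs hg τ ha
  obtain ⟨B, hB⟩ := exists_isOp_of_memSjostrand hs hg τ hb
  obtain ⟨c, hc⟩ := exists_isOp_symbol hφ τ (A ∘L B)
  rw [memSjostrand_iff hφ hs hg τ, ← hA.opKer_eq] at ha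
  rw [memSjostrand_iff hφ hs hg τ, ← hB.opKer_eq] at hb
  have hab := ha.comp hφ hs hb
  rw [hc.opKer_eq] at hab
  exact ⟨c, (memSjostrand_iff hφ hs hg τ c).2 hab, A, B, hA, hB, hc⟩

theorem exists_isOpComp_left (hs : 0 ≤ s) (hg : g ≠ 0) (τ₀ : ℝ) (h0 : τ ≠ 0) (h1 : 1 - τ ≠ 0)
    {b a : 𝓢'(Phase d, ℂ)} (hb : MemSjostrand g s b) (ha : MemAmalgam g s a) :
    ∃ c : 𝓢'(Phase d, ℂ), MemAmalgam g s c ∧ IsOpComp τ₀ b τ a τ c := by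
  obtain ⟨φ, hφ, -⟩ := exists_schwartz_window d
  obtain ⟨B, hB⟩ := exists_isOp_of_memSjostrand hs hg τ₀ hb
  obtain ⟨A, hA⟩ := exists_isOp_of_memAmalgam hs hg h0 h1 ha
  obtain ⟨c, hc⟩ := exists_isOp_symbol hφ τ (B ∘L A)
  rw [memSjostrand_iff hφ hs hg τ₀, ← hB.opKer_eq] at hb
  rw [memAmalgam_iff hφ hs hg h0 h1, ← hA.opKer_eq] at ha
  have hab := hb.comp hφ hs ha
  rw [hc.opKer_eq] at hab
  exact ⟨c, (memAmalgam_iff hφ hs hg h0 h1 c).2 hab, B, A, hB, hA, hc⟩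

theorem exists_isOpComp_right (hs : 0 ≤ s) (hg : g ≠ 0) (τ₀ : ℝ) (h0 : τ ≠ 0) (h1 : 1 - τ ≠ 0)
    {a b : 𝓢'(Phase d, ℂ)} (ha : MemAmalgam g s a) (hb : MemSjostrand g s b) :
    ∃ c : 𝓢'(Phase d, ℂ), MemAmalgam g s c ∧ IsOpComp τ a τ₀ b τ c := by
  obtain ⟨φ, hφ, -⟩ := exists_schwartz_window d
  obtain ⟨B, hB⟩ := exists_isOp_of_memSjostrand hs hg τ₀ hb
  obtain ⟨A, hA⟩ := exists_isOp_of_memAmalgam hs hg h0 h1 ha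
  obtain ⟨c, hc⟩ := exists_isOp_symbol hφ τ (A ∘L B)
  rw [memSjostrand_iff hφ hs hg τ₀, ← hB.opKer_eq] at hb
  rw [memAmalgam_iff hφ hs hg h0 h1, ← hA.opKer_eq] at ha
  have hab := ha.comp hφ hs hb
  rw [hc.opKer_eq] at hab
  exact ⟨c, (memAmalgam_iff hφ hs hg h0 h1 c).2 hab, A, B, hA, hB, hc⟩

theorem exists_isOp_id (hs : 0 ≤ s) (hg : g ≠ 0) (τ : ℝ) :
    ∃ c : 𝓢'(Phase d, ℂ), MemSjostrand g s c ∧ IsOp τ c (ContinuousLinearMap.id ℂ (L2 d)) := by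
  obtain ⟨φ, hφ, -⟩ := exists_schwartz_window d
  obtain ⟨c, hc⟩ := exists_isOp_symbol hφ τ (ContinuousLinearMap.id ℂ (L2 d))
  have h := localized_opKer_id hs φ
  rw [hc.opKer_eq] at h
  exact ⟨c, (memSjostrand_iff hφ hs hg τ c).2 h, hc⟩

end SymbolClasses

/-! ### The algebra and bimodule laws -/

section Bimodule

variable {d : ℕ}

/-- The quantization of a space of symbols of bounded operators. -/
def quantization (τ : ℝ) {S : Submodule ℂ 𝓢'(Phase d, ℂ)}
    (h : ∀ σ ∈ S, ∃ A : L2 d →L[ℂ] L2 d, IsOp τ σ A) : S →ₗ[ℂ] L2 d →L[ℂ] L2 d where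
  toFun σ := (h σ.1 σ.2).choose
  map_add' σ σ' := (h _ (σ + σ').2).choose_spec.operator_unique
    ((h σ.1 σ.2).choose_spec.add (h σ'.1 σ'.2).choose_spec)
  map_smul' c σ := (h _ (c • σ).2).choose_spec.operator_unique
    ((h σ.1 σ.2).choose_spec.smul c)

theorem isOp_quantization {τ : ℝ} {S : Submodule ℂ 𝓢'(Phase d, ℂ)}
    (h : ∀ σ ∈ S, ∃ A : L2 d →L[ℂ] L2 d, IsOp τ σ A) (σ : S) : IsOp τ σ.1 (quantization τ h σ) :=
  (h σ.1 σ.2).choose_spec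

theorem quantization_injective {τ : ℝ} {S : Submodule ℂ 𝓢'(Phase d, ℂ)}
    (h : ∀ σ ∈ S, ∃ A : L2 d →L[ℂ] L2 d, IsOp τ σ A) : Function.Injective (quantization τ h) := by
  obtain ⟨φ, hφ, -⟩ := exists_schwartz_window d
  intro σ σ' e
  refine Subtype.ext ((isOp_quantization h σ).symbol_unique hφ ?_)
  rw [e]
  exact isOp_quantization h σ'

/-- A bilinear law on symbols realizing the composition of their operators. -/
theorem exists_bilinear_symbol {τ₁ τ₂ τ : ℝ} {S₁ S₂ S : Submodule ℂ 𝓢'(Phase d, ℂ)}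
    (h₁ : ∀ σ ∈ S₁, ∃ A : L2 d →L[ℂ] L2 d, IsOp τ₁ σ A)
    (h₂ : ∀ σ ∈ S₂, ∃ A : L2 d →L[ℂ] L2 d, IsOp τ₂ σ A)
    (h : ∀ σ ∈ S, ∃ A : L2 d →L[ℂ] L2 d, IsOp τ σ A)
    (hc : ∀ a ∈ S₁, ∀ b ∈ S₂, ∃ c ∈ S, IsOpComp τ₁ a τ₂ b τ c) :
    ∃ m : S₁ →ₗ[ℂ] S₂ →ₗ[ℂ] S, ∀ a b,
      quantization τ h (m a b) = quantization τ₁ h₁ a ∘L quantization τ₂ h₂ b := by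
  have key (a : S₁) (b : S₂) : ∃ c : S,
      quantization τ h c = quantization τ₁ h₁ a ∘L quantization τ₂ h₂ b := by
    obtain ⟨c, hcS, A, B, hA, hB, hAB⟩ := hc a.1 a.2 b.1 b.2
    refine ⟨⟨c, hcS⟩, ?_⟩
    rw [(isOp_quantization h₁ a).operator_unique hA, (isOp_quantization h₂ b).operator_unique hB]
    exact (isOp_quantization h ⟨c, hcS⟩).operator_unique hAB
  choose m hm using key
  have inj := quantization_injective h
  refine ⟨LinearMap.mk₂ ℂ m (fun a a' b ↦ inj ?_) (fun c a b ↦ inj ?_) (fun a b b' ↦ inj ?_)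
    (fun c a b ↦ inj ?_), fun a b ↦ hm a b⟩
  · simp only [map_add, hm, ContinuousLinearMap.add_comp]
  · simp only [map_smul, hm, ContinuousLinearMap.smul_comp]
  · simp only [map_add, hm, ContinuousLinearMap.comp_add]
  · simp only [map_smul, hm, ContinuousLinearMap.comp_smul]

/-- Quantization is linear and injective on each class, so every identity may be checked for
operators, where it is associativity of composition or neutrality of the identity. -/
theorem exists_algebraBimodule {s : ℝ} (hs : 0 ≤ s) {g : 𝓢(Phase d, ℂ)} (hg : g ≠ 0) {τ : ℝ}
    (h0 : τ ≠ 0) (h1 : 1 - τ ≠ 0) (τ₀ : ℝ) :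
    ∃ (mul : sjostrand g s →ₗ[ℂ] sjostrand g s →ₗ[ℂ] sjostrand g s) (one : sjostrand g s)
      (l : sjostrand g s →ₗ[ℂ] amalgam g s →ₗ[ℂ] amalgam g s)
      (r : amalgam g s →ₗ[ℂ] sjostrand g s →ₗ[ℂ] amalgam g s),
      IsAlgebraBimodule mul one l r ∧
      (∀ b₁ b₂ : sjostrand g s, IsOpComp τ₀ b₁.1 τ₀ b₂.1 τ₀ (mul b₁ b₂).1) ∧
      IsOp τ₀ one.1 (ContinuousLinearMap.id ℂ (L2 d)) ∧
      (∀ (b : sjostrand g s) (a : amalgam g s), IsOpComp τ₀ b.1 τ a.1 τ (l b a).1) ∧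
      (∀ (a : amalgam g s) (b : sjostrand g s), IsOpComp τ a.1 τ₀ b.1 τ (r a b).1) := by
  have hM : ∀ σ ∈ sjostrand g s, ∃ A : L2 d →L[ℂ] L2 d, IsOp τ₀ σ A :=
    fun σ hσ ↦ exists_isOp_of_memSjostrand hs hg τ₀ hσ
  have hW : ∀ σ ∈ amalgam g s, ∃ A : L2 d →L[ℂ] L2 d, IsOp τ σ A :=
    fun σ hσ ↦ exists_isOp_of_memAmalgam hs hg h0 h1 hσ
  obtain ⟨mul, hmul⟩ := exists_bilinear_symbol hM hM hM
    fun a ha b hb ↦ exists_isOpComp_sjostrand hs hg τ₀ ha hb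
  obtain ⟨l, hl⟩ := exists_bilinear_symbol hM hW hW
    fun b hb a ha ↦ exists_isOpComp_left hs hg τ₀ h0 h1 hb ha
  obtain ⟨r, hr⟩ := exists_bilinear_symbol hW hM hW
    fun a ha b hb ↦ exists_isOpComp_right hs hg τ₀ h0 h1 ha hb
  obtain ⟨e, heM, he⟩ := exists_isOp_id hs hg τ₀
  have hone : quantization τ₀ hM ⟨e, heM⟩ = ContinuousLinearMap.id ℂ (L2 d) :=
    (isOp_quantization hM ⟨e, heM⟩).operator_unique he
  have injM := quantization_injective hM
  have injW := quantization_injective hW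
  refine ⟨mul, ⟨e, heM⟩, l, r, ?_, fun b₁ b₂ ↦ ⟨_, _, isOp_quantization hM b₁,
    isOp_quantization hM b₂, ?_⟩, he, fun b a ↦ ⟨_, _, isOp_quantization hM b,
    isOp_quantization hW a, ?_⟩, fun a b ↦ ⟨_, _, isOp_quantization hW a,
    isOp_quantization hM b, ?_⟩⟩
  · constructor
    · exact fun b₁ b₂ b₃ ↦ injM (by simp only [hmul, ContinuousLinearMap.comp_assoc])
    · exact fun b ↦ injM (by rw [hmul, hone, ContinuousLinearMap.id_comp])
    · exact fun b ↦ injM (by rw [hmul, hone, ContinuousLinearMap.comp_id])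
    · exact fun b₁ b₂ a ↦ injW (by simp only [hmul, hl, ContinuousLinearMap.comp_assoc])
    · exact fun a ↦ injW (by rw [hl, hone, ContinuousLinearMap.id_comp])
    · exact fun a b₁ b₂ ↦ injW (by simp only [hmul, hr, ContinuousLinearMap.comp_assoc])
    · exact fun a ↦ injW (by rw [hr, hone, ContinuousLinearMap.comp_id])
    · exact fun b₁ a b₂ ↦ injW (by simp only [hl, hr, ContinuousLinearMap.comp_assoc])
  · rw [← hmul]; exact isOp_quantization hM _
  · rw [← hl]; exact isOp_quantization hW _
  · rw [← hr]; exact isOp_quantization hW _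

end Bimodule

/-! ### Dilations and time-frequency shifts -/

section Dilation

variable {d : ℕ} {s τ : ℝ}

/-- The dilation `x ↦ f (r x)` of a Schwartz function. -/
def dilS {r : ℝ} (hr : r ≠ 0) (f : 𝓢(Conf d, ℂ)) : 𝓢(Conf d, ℂ) :=
  SchwartzMap.compCLMOfContinuousLinearEquiv ℂ
    (LinearEquiv.smulOfNeZero ℝ (Conf d) r hr).toContinuousLinearEquiv f

@[simp]
theorem dilS_apply {r : ℝ} (hr : r ≠ 0) (f : 𝓢(Conf d, ℂ)) (x : Conf d) :
    dilS hr f x = f (r • x) := rfl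

/-- A dilation intertwines time-frequency shifts, contracting positions and stretching frequencies
by the same factor. Its matrix is therefore constant along the corresponding graph. -/
theorem dilS_tfC {r : ℝ} (hr : r ≠ 0) (f : 𝓢(Conf d, ℂ)) (u : Phase d) :
    dilS hr (tfC u f) = tfC (r⁻¹ • u.1, r • u.2) (dilS hr f) := by
  ext x
  rw [dilS_apply, tfC_apply, tfC_apply, dilS_apply, smul_sub, smul_inv_smul₀ hr]
  simp only [chr, innerForm_apply, inner_smul_left, inner_smul_right]
  rfl

theorem inner_vec_tfC (v : Phase d) (f h : 𝓢(Conf d, ℂ)) :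
    inner ℂ (vec (tfC v f)) (vec (tfC v h)) = ip f h := by
  rw [inner_vec, ip, ← integral_sub_right_eq_self (fun x ↦ conj (f x) * h x) v.1]
  congr 1 with x
  rw [tfC_apply, tfC_apply, map_mul]
  have := chr_mul_conj (innerForm (Conf d)) v.2 x
  linear_combination (conj (f (x - v.1)) * h (x - v.1)) * this

theorem ip_dilS_pos {φ : 𝓢(Conf d, ℂ)} {ρ : Conf d → ℝ} (hρ : Continuous ρ) (h0 : ∀ x, 0 ≤ ρ x)
    (hpos : 0 < ρ 0) (hφ : ∀ x, φ x = ρ x) {r : ℝ} (hr : r ≠ 0) : ip φ (dilS hr φ) ≠ 0 := by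
  have e (x : Conf d) : conj (φ x) * dilS hr φ x = ((ρ x * ρ (r • x) : ℝ) : ℂ) := by
    rw [dilS_apply, hφ, hφ, Complex.conj_ofReal, Complex.ofReal_mul]
  have hint : Integrable fun x : Conf d ↦ ρ x * ρ (r • x) := by
    refine (Complex.reCLM.integrable_comp ((mulS (conjS φ) (dilS hr φ)).integrable
      (μ := volume))).congr (Filter.Eventually.of_forall fun x ↦ ?_)
    exact (congrArg Complex.re (e x)).trans (Complex.ofReal_re _)
  rw [ip]
  simp only [e]
  rw [integral_complex_ofReal, Ne, Complex.ofReal_eq_zero]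
  refine (integral_pos_of_integrable_nonneg_nonzero (x := (0 : Conf d)) (by fun_prop) hint
    (fun x ↦ mul_nonneg (h0 _) (h0 _)) ?_).ne'
  rw [smul_zero]
  exact (mul_pos hpos hpos).ne'

end Dilation

/-! ### The Dirac mass as an amalgam symbol -/

section Delta

variable {d : ℕ} {s τ : ℝ}

/-- The Dirac distribution at the origin. -/
def dirac (d : ℕ) : 𝓢'(Phase d, ℂ) := TemperedDistribution.delta (0 : Phase d)

theorem pair_dirac (ψ : 𝓢(Phase d, ℂ)) : pair (dirac d) ψ = conj (ψ 0) := rfl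

theorem enorm_stft_dirac (g : 𝓢(Phase d, ℂ)) (z ζ : Phase d) :
    ‖stft g (dirac d) z ζ‖ₑ = ‖g (-z)‖ₑ := by
  rw [stft, pair_dirac, tfShift_eq_tf, ← ofReal_norm, RCLike.norm_conj, norm_tf_apply, zero_sub,
    ofReal_norm]

/-- The modulus of the transform is `|g(-z)|`, independent of the frequency, and a Schwartz function
is integrable against any polynomial weight. -/
theorem memAmalgam_dirac (hs : 0 ≤ s) (g : 𝓢(Phase d, ℂ)) : MemAmalgam g s (dirac d) := by
  obtain ⟨A, k, hA⟩ := exists_ew_le_pow (d := d) hs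
  set N := (volume : Measure (Phase d)).integrablePower
  have hb := SchwartzMap.one_add_le_sup_seminorm_apply (𝕜 := ℝ) (m := (k + N, 0)) (k := k + N)
    (n := 0) le_rfl le_rfl g
  set S := 2 ^ (k + N, 0).1 *
    ((Finset.Iic (k + N, 0)).sup fun m ↦ SchwartzMap.seminorm ℝ m.1 m.2) g with hS
  have hint := ((Measure.integrable_pow_neg_integrablePower
    (volume : Measure (Phase d))).const_mul (|A| * S)).lintegral_lt_top
  simp only [MemAmalgam, enorm_stft_dirac, iSup_const]
  refine lt_of_le_of_lt (lintegral_mono fun z ↦ ?_) hint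
  refine (mul_le_mul_right (hA z) _).trans ?_
  rw [← ofReal_norm, ← ENNReal.ofReal_mul (norm_nonneg _)]
  refine ENNReal.ofReal_le_ofReal ?_
  have h1 := hb (-z)
  rw [norm_neg, norm_iteratedFDeriv_zero, pow_add] at h1
  have hz : (0 : ℝ) < 1 + ‖z‖ := by positivity
  rw [Real.rpow_neg hz.le, Real.rpow_natCast, ← div_eq_mul_inv, le_div_iff₀ (by positivity)]
  calc ‖g (-z)‖ * (A * (1 + ‖z‖) ^ k) * (1 + ‖z‖) ^ N
      = A * ((1 + ‖z‖) ^ k * (1 + ‖z‖) ^ N * ‖g (-z)‖) := by ring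
    _ ≤ |A| * ((1 + ‖z‖) ^ k * (1 + ‖z‖) ^ N * ‖g (-z)‖) := by gcongr; exact le_abs_self A
    _ ≤ |A| * S := by gcongr

/-- The operator with symbol `δ₀` is a reflected dilation. -/
theorem IsOp.dirac_apply {A : L2 d →L[ℂ] L2 d} (hA : IsOp τ (dirac d) A) (h0 : τ ≠ 0)
    (hr : -((1 - τ) / τ) ≠ 0) (f : 𝓢(Conf d, ℂ)) :
    A (vec f) = ((|(τ ^ d)⁻¹| : ℝ) : ℂ) • vec (dilS hr f) := by
  refine ext_inner_vec fun h ↦ ?_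
  refine (hA f h).trans ?_
  rw [pair_dirac, tauWigner_apply, ← integral_conj, inner_smul_right, inner_vec]
  -- The substitution `x = τ y` turns `f(-(1 - τ) y)` into a dilate of `f` at `x` and produces the
  -- factor `|τ ^ d|⁻¹`.
  have := Measure.integral_comp_smul volume (fun x : Conf d ↦ conj (h x) * dilS hr f x) τ
  rw [finrank_euclideanSpace_fin, Complex.real_smul] at this
  rw [← this]
  congr 1 with y
  rw [dilS_apply, smul_smul, neg_mul, div_mul_cancel₀ _ h0]
  simp [chr]
  exact Or.inl (congrArg f (by module))

end Delta

/-! ### Failure of the algebra property -/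

section NonAlgebra

variable {d : ℕ} {s τ τ₁ τ₂ : ℝ}

theorem volume_phase_eq_top (hd : 1 ≤ d) : (volume : Measure (Phase d)) Set.univ = ⊤ := by
  have : Nonempty (Fin d) := ⟨⟨0, hd⟩⟩
  have : NoncompactSpace (Phase d) := NormedSpace.noncompactSpace ℝ (Phase d)
  exact measure_univ_of_isAddLeftInvariant _

/-- A multiple of a dilation has no symbol in the amalgam space. -/
theorem not_isOp_dilation (hd : 1 ≤ d) (hs : 0 ≤ s) {g : 𝓢(Phase d, ℂ)} (hg : g ≠ 0)
    (hτ : τ ∈ Set.Icc (0 : ℝ) 1) {C : L2 d →L[ℂ] L2 d} {r : ℝ} (hr : 0 < r) {γ : ℂ} (hγ : γ ≠ 0)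
    (hC : ∀ f : 𝓢(Conf d, ℂ), C (vec f) = γ • vec (dilS hr.ne' f)) {c : 𝓢'(Phase d, ℂ)}
    (hc : MemAmalgam g s c) : ¬ IsOp τ c C := by
  intro hop
  obtain ⟨φ, hφ, ρ, hρ, hρ0, hρpos, hφρ⟩ := exists_schwartz_window d
  have hm := hc.of_window hs hg (tauWigner τ φ φ)
  set m := γ * ip φ (dilS hr.ne' φ)
  have hm0 : m ≠ 0 := mul_ne_zero hγ (ip_dilS_pos hρ hρ0 hρpos hφρ hr.ne')
  have hker (u : Phase d) : symKer τ φ c (r⁻¹ • u.1, r • u.2) u = m := by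
    rw [← hop.inner_atom, atom, atom, hC, inner_smul_right, dilS_tfC, inner_vec_tfC]
  -- The positions met along the graph are `u` scaled by convex combinations of `r⁻¹` and `1`, and
  -- of `r` and `1`. These are positive also for `τ = 0` and `τ = 1`, so every point `Z` is such a
  -- position. Positivity of `r` is essential here: for a negative factor they may vanish, as they
  -- do for the amalgam graphs.
  have h1 : 0 < (1 - τ) * r⁻¹ + τ := by
    rcases hτ.1.eq_or_lt with h | h
    · rw [← h]; simpa using hr
    · have := mul_nonneg (sub_nonneg.2 hτ.2) (inv_pos.2 hr).le
      linarith
  have h2 : 0 < τ * r + (1 - τ) := by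
    rcases hτ.1.eq_or_lt with h | h
    · rw [← h]; simp
    · have := mul_pos h hr
      linarith [hτ.2]
  have hle (Z : Phase d) : ‖m‖ₑ ≤ (⨆ ζ, ‖stft (tauWigner τ φ φ) c Z ζ‖ₑ) * ew s Z := by
    obtain ⟨u, rfl⟩ := (dilate d h1.ne' h2.ne').surjective Z
    have e : dilate d h1.ne' h2.ne' u = tauMid τ (r⁻¹ • u.1, r • u.2) u := by
      rw [dilate_apply, tauMid, add_smul, add_smul, mul_smul, mul_smul]
    rw [← hker u, enorm_symKer, e]
    refine le_trans ?_ (le_mul_of_one_le_right' (one_le_ew hs _))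
    exact le_iSup (fun ζ ↦ ‖stft (tauWigner τ φ φ) c (tauMid τ (r⁻¹ • u.1, r • u.2) u) ζ‖ₑ) _
  -- A positive constant would have finite integral over a space of infinite volume; this is where
  -- `1 ≤ d` enters.
  have := (lintegral_mono hle).trans_lt hm
  rw [lintegral_const, volume_phase_eq_top hd, ENNReal.mul_top (by simpa using hm0)] at this
  exact lt_irrefl _ this

/-- Both symbols are the Dirac mass. The two reflections cancel, leaving a nonzero multiple of the
dilation by `(1 - τ₂)/τ₂ · (1 - τ₁)/τ₁ > 0`. -/
theorem exists_amalgam_comp_not_isOp (hd : 1 ≤ d) (hs : 0 ≤ s) {g : 𝓢(Phase d, ℂ)} (hg : g ≠ 0)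
    (hτ₁ : τ₁ ∈ Set.Ioo (0 : ℝ) 1) (hτ₂ : τ₂ ∈ Set.Ioo (0 : ℝ) 1) (hτ : τ ∈ Set.Icc (0 : ℝ) 1) :
    ∃ a b : 𝓢'(Phase d, ℂ), MemAmalgam g s a ∧ MemAmalgam g s b ∧
      ∃ A B : L2 d →L[ℂ] L2 d, IsOp τ₁ a A ∧ IsOp τ₂ b B ∧
        ∀ c : 𝓢'(Phase d, ℂ), MemAmalgam g s c → ¬ IsOp τ c (A ∘L B) := by
  have hδ := memAmalgam_dirac hs g
  have p₁ : 0 < (1 - τ₁) / τ₁ := div_pos (sub_pos.2 hτ₁.2) hτ₁.1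
  have p₂ : 0 < (1 - τ₂) / τ₂ := div_pos (sub_pos.2 hτ₂.2) hτ₂.1
  obtain ⟨A, hA⟩ := exists_isOp_of_memAmalgam hs hg hτ₁.1.ne' (sub_pos.2 hτ₁.2).ne' hδ
  obtain ⟨B, hB⟩ := exists_isOp_of_memAmalgam hs hg hτ₂.1.ne' (sub_pos.2 hτ₂.2).ne' hδ
  refine ⟨dirac d, dirac d, hδ, hδ, A, B, hA, hB, fun c hc ↦ ?_⟩
  refine not_isOp_dilation hd hs hg hτ (mul_pos p₂ p₁)
    (γ := ((|(τ₂ ^ d)⁻¹| : ℝ) : ℂ) * ((|(τ₁ ^ d)⁻¹| : ℝ) : ℂ)) ?_ (fun f ↦ ?_) hc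
  · have := hτ₁.1.ne'
    have := hτ₂.1.ne'
    simp [*]
  · rw [ContinuousLinearMap.comp_apply, hB.dirac_apply hτ₂.1.ne' (neg_ne_zero.2 p₂.ne'), map_smul,
      hA.dirac_apply hτ₁.1.ne' (neg_ne_zero.2 p₁.ne'), smul_smul]
    congr 2
    ext x
    simp only [dilS_apply, smul_smul, neg_mul_neg]

end NonAlgebra

end TauPseudo
end

open TauPseudo

theorem mainTheorem10 (d : ℕ) (hd : 1 ≤ d) (s : ℝ) (hs : 0 ≤ s)
    (g : 𝓢(Phase d, ℂ)) (hg : g ≠ 0) :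
    (∀ τ ∈ Set.Ioo (0 : ℝ) 1, ∀ a b : 𝓢'(Phase d, ℂ), MemAmalgam g s a → MemAmalgam g s b →
      ∃ c : 𝓢'(Phase d, ℂ), MemSjostrand g s c ∧ IsOpComp τ a (1 - τ) b (1 / 2) c) ∧
    (∃ M W : Submodule ℂ 𝓢'(Phase d, ℂ),
      (∀ σ, σ ∈ M ↔ MemSjostrand g s σ) ∧ (∀ σ, σ ∈ W ↔ MemAmalgam g s σ) ∧
      ∀ τ ∈ Set.Ioo (0 : ℝ) 1, ∀ τ₀ ∈ Set.Ioo (0 : ℝ) 1,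
        ∃ (mul : M →ₗ[ℂ] M →ₗ[ℂ] M) (one : M) (l : M →ₗ[ℂ] W →ₗ[ℂ] W) (r : W →ₗ[ℂ] M →ₗ[ℂ] W),
          IsAlgebraBimodule mul one l r ∧
          (∀ b₁ b₂ : M, IsOpComp τ₀ b₁.1 τ₀ b₂.1 τ₀ (mul b₁ b₂).1) ∧
          IsOp τ₀ one.1 (ContinuousLinearMap.id ℂ (L2 d)) ∧
          (∀ (b : M) (a : W), IsOpComp τ₀ b.1 τ a.1 τ (l b a).1) ∧
          (∀ (a : W) (b : M), IsOpComp τ a.1 τ₀ b.1 τ (r a b).1)) ∧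
    (∀ τ₁ ∈ Set.Ioo (0 : ℝ) 1, ∀ τ₂ ∈ Set.Ioo (0 : ℝ) 1, ∀ τ ∈ Set.Icc (0 : ℝ) 1,
      ∃ a b : 𝓢'(Phase d, ℂ), MemAmalgam g s a ∧ MemAmalgam g s b ∧
        ∃ A B : L2 d →L[ℂ] L2 d, IsOp τ₁ a A ∧ IsOp τ₂ b B ∧
          ∀ c : 𝓢'(Phase d, ℂ), MemAmalgam g s c → ¬ IsOp τ c (A ∘L B)) := by
  refine ⟨fun τ hτ a b ha hb ↦ exists_isOpComp_half hs hg hτ.1.ne' (sub_pos.2 hτ.2).ne' ha hb,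
    ⟨sjostrand g s, amalgam g s, fun σ ↦ Iff.rfl, fun σ ↦ Iff.rfl, fun τ hτ τ₀ _ ↦
      exists_algebraBimodule hs hg hτ.1.ne' (sub_pos.2 hτ.2).ne' τ₀⟩,
    fun τ₁ h₁ τ₂ h₂ τ hτ ↦ exists_amalgam_comp_not_isOp hd hs hg h₁ h₂ hτ⟩
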